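/- **Setting.** Let $W$ be a Brownian motion, $z_0\in\mathbb R$, and let $\sigma:[0,1]\to(0,\infty)$ be measurable with $\|\sigma\|_{L^2}^2:=\int_0^1\sigma(s)^2\,ds<\infty$. Under $\mathbb P_\sigma$ one observes $\mathbf Z_n=(Z_0,Z_{1/n},\dots,Z_1)$, where $dZ_t=\sigma(t)\,dW_t$, $Z_0=z_0$, $t\in[0,1]$. Write $\Delta_k=Z_{k/n}-Z_{(k-1)/n}$. **The test.** A kernel is a function $\psi:\mathbb R\to[0,\infty)$ with $\psi\le\psi(0)=1$, support in $[-1,1]$, bounded variation, and $|\psi(x)-\psi(y)|\le|x-y|^{\gamma}$ for all $x,y$ and some $\gamma\in(0,1]$. Given $\psi$, put $$\lambda_k(t,h)=\sqrt n\int_{(k-1)/n}^{k/n}\psi\Big(\frac{s-t}{h}\Big)ds,\qquad \Lambda_n(t,h)=\Big(\sum_{k=1}^n\lambda_k(t,h)^2\Big)^{1/2},\qquad \hat c_n^2=\sum_{k=1}^n\Delta_k^2,$$ $$\hat\Psi_{n,t,h}=\frac{\frac1{\sqrt2}\sum_{k=1}^n\lambda_k(t,h)\,(n\Delta_k^2-\hat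 c_n^2)}{\hat c_n^2\,\Lambda_n(t,h)},\qquad G_n(\eta,\delta)=\sqrt{2\eta}+\frac{2\eta}{\max\{1,\sqrt n\,\delta\}},$$ and, for $K>0$, $\mathcal T_n(K)=\{(t,h): K/n\le h<1/2,\ h\le t\le 1-h\}$. Call $K>0$ admissible for $\psi$ if $\Lambda_n(t,h)^2\ge 1/n$ for all $n\ge1$ and $(t,h)\in\mathcal T_n(K)$. For an admissible $K$ let $$S_n=\sup_{(t,h)\in\mathcal T_n(K)}\Big(|\hat\Psi_{n,t,h}|-G_n\big(2\log(1/\Lambda_n(t,h)),\Lambda_n(t,h)\big)\Big),$$ and for $\alpha\in(0,1)$ let $\kappa_n^\alpha=\inf\{r\in\mathbb R:\mathbb P_1(S_n\le r)\ge1-\alpha\}$, where $\mathbb P_1$ refers to $\sigma\equiv1$. The test is $T_n(\mathbf Z_n)=\mathbf 1_{\{S_n>\kappa_n^\alpha\}}$. **The alternatives.** For $\beta,L>0$ let $m$ be the largest integer strictly smaller than $\beta$, and let $\mathcal H(\beta,L)$ be the set of all $m$ times differentiable $f:\mathbb R\to\mathbb R$ with $|f^{(m)}(x)-f^{(m)}(y)|\le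 L|x-y|^{\beta-m}$ for all $x,y$; a function on $[0,1]$ is said to be in $\mathcal H(\beta,L)$ if it is the restriction of such an $f$. Let $d_J(\sigma,H_0)=\sup_{t\in J}\big|\sigma(t)^2/\|\sigma\|_{L^2}^2-1\big|$ and $\rho_n=(\log n/n)^{\beta/(2\beta+1)}$. **Theorem (minimax upper bound).** Let $\beta,L>0$. 1. Let $\psi$ be a kernel. Then an admissible $K$ exists, and there is a constant $c=c(\beta,L,\psi)>0$ such that for every admissible $K$, all $z_0\in\mathbb R$ and $\alpha\in(0,1)$, all numbers $\epsilon_n>0$ with $\epsilon_n\to0$ and $\epsilon_n^2\log n\to\infty$, and every compact interval $\emptyset\neq J\subset(0,1)$, $$\lim_{n\to\infty}\ \inf_{\substack{\sigma^2/\|\sigma\|_{L^2}^2\in\mathcal H(\beta,L):\\ d_J(\sigma,H_0)\ge(1+\epsilon_n)c\rho_n}}\mathbb P_\sigma\big(T_n(\mathbf Z_n)=1\big)=1.\qquad(*)$$ 2. Let $\beta\le1$. Then the problem of minimizing $\|\psi\|_{L^2(\mathbb R)}$ over all $\psi\in\mathcal H(\beta,1)$ with $\psi(0)\ge1$ has the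 unique solution $\psi_\beta(x)=\mathbf 1_{\{|x|\le1\}}(1-|x|^\beta)$, this $\psi_\beta$ is a kernel in the above sense, and for the test built on $\psi=\psi_\beta$ the statement $(*)$ holds, for all $K,z_0,\alpha,(\epsilon_n),J$ as in 1, with $$c=c_*(\beta,L)=\Big(\frac{4L^{1/\beta}}{(2\beta+1)\|\psi_\beta\|_{L^2}^2}\Big)^{\beta/(2\beta+1)}.$$ -/

import Mathlib

noncomputable section

open MeasureTheory ProbabilityTheory Filter Set
open scoped Topology NNReal ENNReal

namespace ConstVol

/-! ### The observations -/

/-- Volatility functions: measurable, positive on `[0,1]`, and square integrable on `[0,1]`, so that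
`Z_t = z₀ + ∫₀ᵗ σ dW` makes sense. Only the values on `[0,1]` matter. -/
structure IsVolatility (σ : ℝ → ℝ) : Prop where
  measurable : Measurable σ
  pos : ∀ t ∈ Icc (0 : ℝ) 1, 0 < σ t
  integrable : IntegrableOn (fun t => σ t ^ 2) (Icc 0 1)

/-- `∫_s^t σ(u)² du`, the variance of `Z_t - Z_s`. -/
def quadVar (σ : ℝ → ℝ) (s t : ℝ) : ℝ≥0 := (∫ u in s..t, σ u ^ 2).toNNReal

/-- The law of `(Z_{k/n} - Z_{(k-1)/n})_{k = 1, …, n}`: independent centred Gaussians with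
variances `∫_{(k-1)/n}^{k/n} σ²`. The index `k : Fin n` stands for the `(k+1)`-st increment. -/
def incrementLaw (σ : ℝ → ℝ) (n : ℕ) : Measure (Fin n → ℝ) :=
  Measure.pi fun k => gaussianReal 0 (quadVar σ ((k : ℝ) / n) (((k : ℝ) + 1) / n))

/-- The law of the observation vector `(Z_0, Z_{1/n}, …, Z_1)` under `P_σ`, where
`dZ_t = σ(t) dW_t`, `Z_0 = z₀`. -/
def obsLaw (z₀ : ℝ) (σ : ℝ → ℝ) (n : ℕ) : Measure (Fin (n + 1) → ℝ) :=
  (incrementLaw σ n).map fun x j => z₀ + ∑ k : Fin n with k.castSucc < j, x k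

/-- The law of the whole process `Z_t = z₀ + ∫₀ᵗ σ dW`, `t ∈ [0,1]`: a continuous process started
at `z₀` with independent increments `Z_t - Z_s ∼ N(0, ∫_s^t σ²)`. -/
structure IsWhiteNoiseProcess {Ω : Type*} [MeasurableSpace Ω] (z₀ : ℝ) (σ : ℝ → ℝ)
    (Z : unitInterval → Ω → ℝ) (P : Measure Ω) : Prop where
  start : ∀ᵐ ω ∂P, Z 0 ω = z₀
  indep : HasIndepIncrements Z P
  law : ∀ s t : unitInterval, s ≤ t → HasLaw (Z t - Z s) (gaussianReal 0 (quadVar σ s t)) P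
  cont : ∀ᵐ ω ∂P, Continuous fun t => Z t ω

/-- The grid point `k/n` of `[0,1]`. -/
def gridPoint (n : ℕ) (k : Fin (n + 1)) : unitInterval :=
  ⟨(k : ℝ) / n, by positivity, div_le_one_of_le₀ (by exact_mod_cast Fin.is_le k) (by positivity)⟩

theorem sum_incr {n : ℕ} (z : Fin (n + 1) → ℝ) (j : Fin (n + 1)) :
    z 0 + ∑ k : Fin n with k.castSucc < j, (z k.succ - z k.castSucc) = z j := by
  induction j using Fin.induction with
  | zero => simp
  | succ i ih =>
    have h : (Finset.univ.filter fun k : Fin n => k.castSucc < i.succ)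
        = insert i (Finset.univ.filter fun k : Fin n => k.castSucc < i.castSucc) := by
      ext k
      simp only [Finset.mem_filter, Finset.mem_univ, true_and, Finset.mem_insert, Fin.lt_def,
        Fin.ext_iff, Fin.val_castSucc, Fin.val_succ]
      omega
    rw [h, Finset.sum_insert (by simp), ← ih]
    linarith

/-- `obsLaw` is the law of the discretely observed process. -/
theorem IsWhiteNoiseProcess.hasLaw_obs {Ω : Type*} [MeasurableSpace Ω] {z₀ : ℝ} {σ : ℝ → ℝ}
    {Z : unitInterval → Ω → ℝ} {P : Measure Ω} (hZ : IsWhiteNoiseProcess z₀ σ Z P) (n : ℕ) :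
    HasLaw (fun ω k => Z (gridPoint n k) ω) (obsLaw z₀ σ n) P := by
  have hmono : Monotone (gridPoint n) := fun i j hij => by
    have hij' : ((i : ℕ) : ℝ) ≤ ((j : ℕ) : ℝ) := by exact_mod_cast hij
    exact Subtype.mk_le_mk.2 (by gcongr)
  have hpi : HasLaw (fun ω (k : Fin n) =>
      Z (gridPoint n k.succ) ω - Z (gridPoint n k.castSucc) ω) (incrementLaw σ n) P := by
    refine (hZ.indep n (gridPoint n) hmono).hasLaw_pi fun k => ?_
    have := hZ.law _ _ (hmono (Fin.castSucc_le_succ k))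
    simpa [gridPoint, Pi.sub_def] using this
  have hsum : Measurable fun (x : Fin n → ℝ) (j : Fin (n + 1)) =>
      z₀ + ∑ k : Fin n with k.castSucc < j, x k := by fun_prop
  refine (HasLaw.fun_comp (Y := fun (x : Fin n → ℝ) (j : Fin (n + 1)) =>
    z₀ + ∑ k : Fin n with k.castSucc < j, x k) ⟨hsum.aemeasurable, rfl⟩ hpi).congr ?_
  filter_upwards [hZ.start] with ω hω
  funext j
  have h0 : gridPoint n 0 = 0 := by ext; simp [gridPoint]
  rw [← sum_incr (fun k => Z (gridPoint n k) ω) j]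
  simp only [h0, hω]

/-! ### The multiscale test -/

/-- The kernels `ψ ≥ 0` admitted for the test: `1 = ψ(0) ≥ ψ(x)`, support in `[-1,1]`, bounded
variation, and Hölder continuous (of some order) with Hölder constant one. -/
structure IsKernel (ψ : ℝ → ℝ) : Prop where
  nonneg : ∀ x, 0 ≤ ψ x
  at_zero : ψ 0 = 1
  le_one : ∀ x, ψ x ≤ 1
  support : Function.support ψ ⊆ Icc (-1) 1
  boundedVariation : BoundedVariationOn ψ univ
  holder : ∃ γ : ℝ, 0 < γ ∧ γ ≤ 1 ∧ ∀ x y, |ψ x - ψ y| ≤ |x - y| ^ γ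

/-- `λ_k(t,h) = √n ∫_{(k-1)/n}^{k/n} ψ((s-t)/h) ds` (with `k` shifted by one). -/
def weight (ψ : ℝ → ℝ) (n : ℕ) (t h : ℝ) (k : Fin n) : ℝ :=
  √n * ∫ s in ((k : ℝ) / n)..(((k : ℝ) + 1) / n), ψ ((s - t) / h)

/-- `Λ_n(t,h)`. -/
def weightNorm (ψ : ℝ → ℝ) (n : ℕ) (t h : ℝ) : ℝ :=
  √(∑ k, weight ψ n t h k ^ 2)

/-- The increments `Z_{k/n} - Z_{(k-1)/n}` of an observation vector. -/
def incr {n : ℕ} (z : Fin (n + 1) → ℝ) (k : Fin n) : ℝ := z k.succ - z k.castSucc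

/-- The quadratic variation estimator `ĉ_n²`. -/
def cHatSq {n : ℕ} (z : Fin (n + 1) → ℝ) : ℝ := ∑ k, incr z k ^ 2

/-- The local statistic `Ψ̂^c_{n,t,h}`, as a function of `c² = csq`. -/
def localStat (ψ : ℝ → ℝ) {n : ℕ} (t h csq : ℝ) (z : Fin (n + 1) → ℝ) : ℝ :=
  (1 / √2 * ∑ k, weight ψ n t h k * (n * incr z k ^ 2 - csq)) / (csq * weightNorm ψ n t h)

/-- The correction `G_n(η,δ)`. -/
def corr (n : ℕ) (η δ : ℝ) : ℝ := √(2 * η) + 2 * η / max 1 (√n * δ)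

/-- The index set `𝒯_n(K)` of pairs `(t,h)`. -/
def scaleSet (n : ℕ) (K : ℝ) : Set (ℝ × ℝ) :=
  {p | p.2 ∈ Ico (K / n) (1 / 2) ∧ p.1 ∈ Icc p.2 (1 - p.2)}

/-- `K` is an admissible value of the constant `K_ψ`: `Λ_n(t,h)² ≥ 1/n` on `𝒯_n(K)`, for all `n`. -/
def IsCalibrationConstant (ψ : ℝ → ℝ) (K : ℝ) : Prop :=
  0 < K ∧ ∀ n : ℕ, 0 < n → ∀ p ∈ scaleSet n K, 1 / (n : ℝ) ≤ weightNorm ψ n p.1 p.2 ^ 2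

/-- The multiscale statistic. -/
def multiscaleStat (ψ : ℝ → ℝ) (K : ℝ) {n : ℕ} (z : Fin (n + 1) → ℝ) : ℝ :=
  ⨆ p : scaleSet n K, (|localStat ψ p.1.1 p.1.2 (cHatSq z) z|
    - corr n (2 * Real.log (1 / weightNorm ψ n p.1.1 p.1.2)) (weightNorm ψ n p.1.1 p.1.2))

/-- The `(1-α)`-quantile `κ_n^α` of the multiscale statistic under `P_1`. -/
def critValue (ψ : ℝ → ℝ) (K z₀ α : ℝ) (n : ℕ) : ℝ :=
  sInf {r : ℝ | 1 - α ≤ (obsLaw z₀ (fun _ => 1) n).real {z | multiscaleStat ψ K z ≤ r}}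

open Classical in
/-- The test `T_n` for constant volatility. -/
def test (ψ : ℝ → ℝ) (K z₀ α : ℝ) (n : ℕ) (z : Fin (n + 1) → ℝ) : ℝ :=
  if critValue ψ K z₀ α n < multiscaleStat ψ K z then 1 else 0

/-- The power `P_σ(T_n(Z_n) = 1)`. -/
def power (ψ : ℝ → ℝ) (K z₀ α : ℝ) (n : ℕ) (σ : ℝ → ℝ) : ℝ :=
  (obsLaw z₀ σ n).real {z | test ψ K z₀ α n z = 1}

/-! ### The alternatives -/

/-- The Hölder class `ℋ(β,L)` of functions on the real line; `⌈β⌉₊ - 1` is the largest integer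
strictly smaller than `β > 0`. As the Hölder condition makes the top derivative continuous, the
existence of the derivatives up to that order is the same as `ContDiff`. -/
def holderClass (β L : ℝ) : Set (ℝ → ℝ) :=
  {f | ContDiff ℝ (⌈β⌉₊ - 1 : ℕ) f ∧ ∀ x y,
    |iteratedDeriv (⌈β⌉₊ - 1) f x - iteratedDeriv (⌈β⌉₊ - 1) f y|
      ≤ L * |x - y| ^ (β - (⌈β⌉₊ - 1 : ℕ))}

/-- `‖σ‖²_{L²}` on `[0,1]`. -/
def l2NormSq (σ : ℝ → ℝ) : ℝ := ∫ s in (0 : ℝ)..1, σ s ^ 2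

/-- `d_J(σ, H₀) = sup_{t ∈ J} |σ(t)²/‖σ‖² - 1|`. -/
def devDist (J : Set ℝ) (σ : ℝ → ℝ) : ℝ := ⨆ t : J, |σ t ^ 2 / l2NormSq σ - 1|

/-- The rate `ρ_n(β)`. -/
def rate (β : ℝ) (n : ℕ) : ℝ := (Real.log n / n) ^ (β / (2 * β + 1))

/-- The volatilities with `σ²/‖σ‖² ∈ ℋ(β,L)` and `d_J(σ, H₀) ≥ r`. A function on `[0,1]` belongs
to the class when it is the restriction of a member of `ℋ(β,L)`. -/
def alternatives (β L : ℝ) (J : Set ℝ) (r : ℝ) : Set (ℝ → ℝ) :=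
  {σ | IsVolatility σ ∧ (∃ g ∈ holderClass β L, ∀ t ∈ Icc (0 : ℝ) 1, g t = σ t ^ 2 / l2NormSq σ) ∧
    r ≤ devDist J σ}

/-- The test with kernel `ψ` has power tending to one, uniformly over the alternatives in `ℋ(β,L)`
at distance at least `(1+ε_n) c ρ_n` from the null hypothesis. -/
def PowerTendsToOne (ψ : ℝ → ℝ) (β L c : ℝ) : Prop :=
  ∀ K : ℝ, IsCalibrationConstant ψ K →
  ∀ z₀ α : ℝ, 0 < α → α < 1 →
  ∀ ε : ℕ → ℝ, (∀ n, 0 < ε n) → Tendsto ε atTop (𝓝 0) →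
    Tendsto (fun n : ℕ => ε n ^ 2 * Real.log n) atTop atTop →
  ∀ a b : ℝ, 0 < a → a ≤ b → b < 1 →
    Tendsto (fun n : ℕ => ⨅ σ : alternatives β L (Icc a b) ((1 + ε n) * c * rate β n),
      power ψ K z₀ α n σ) atTop (𝓝 1)

/-! ### The optimal recovery kernel -/

/-- `ψ` solves: minimize `‖ψ‖_{L²(ℝ)}` over all `ψ ∈ ℋ(β,1)` with `ψ(0) ≥ 1`. -/
def IsOptimalRecoveryKernel (β : ℝ) (ψ : ℝ → ℝ) : Prop :=
  ψ ∈ holderClass β 1 ∧ 1 ≤ ψ 0 ∧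
    ∀ φ ∈ holderClass β 1, 1 ≤ φ 0 → eLpNorm ψ 2 volume ≤ eLpNorm φ 2 volume

/-- `ψ_β(x) = 1_{|x| ≤ 1} (1 - |x|^β)`, the optimal recovery kernel for `0 < β ≤ 1`. -/
def recoveryKernel (β : ℝ) (x : ℝ) : ℝ := if |x| ≤ 1 then 1 - |x| ^ β else 0

/-- The constant `c_*(β,L)` for `0 < β ≤ 1`. -/
def cStar (β L : ℝ) : ℝ :=
  (4 * L ^ (1 / β) / ((2 * β + 1) * ∫ x, recoveryKernel β x ^ 2)) ^ (β / (2 * β + 1))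

end ConstVol

end

section

open MeasureTheory ProbabilityTheory Filter Set
open scoped Topology NNReal ENNReal

namespace ConstVol

/-! ### Concentration of weighted sums of squared Gaussians -/

/-! The test separates because its critical values stay bounded, whereas under the alternative a
single term of the supremum exceeds its own correction by an amount tending to infinity.

Null hypothesis. For `σ ≡ 1` a local statistic is, up to replacing the estimated variance by 1, a
centred quadratic form `noise` in independent Gaussians divided by its norm `Λ`. A Bernstein bound
(`pi_gaussianReal_tail`) controls one such form. Chaining over dyadic nets in `(t,h)` makes this
uniform: at scale `2⁻ʲ` the coarsest net has only `2^(j + O(log j))` points, so the maximum costs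
`√(2 log (1/h)) + O(1)`, which the correction `corr` subtracts exactly, and the links add `O(Λ)`.
The carrying lemmas are `IsKernel.prob_isControlled` and `IsControlled.exists_bound`;
`exists_critValue_le` then bounds the critical values uniformly in `n`.

Alternative. Normalized squared volatilities in the Hölder class are uniformly bounded
(`exists_bound_of_mem_holderClass`), so the same Bernstein bound makes all errors `O(1)` at one
chosen pair `(t,h)`. By `tendsto_iInf_power` it is enough that the standardized `signal` there
exceed `√(2 log (1/h))` by a diverging amount. Take `h` of order `(log n / n)^(1/(2β+1))`. For a
general kernel, a deviation at a point persists with constant sign on a nearby interval of length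
proportional to `h`, because the function is close to a polynomial of fixed degree; a large constant
`c` then suffices.

Sharp constant, `β ≤ 1`. A deviation `L h^β` at `t` forces the deviation at `x` to be at least `L
h^β ψ_β((x - t)/h)`, so correlating with `ψ_β` itself gives a signal of size `L h^β √(n h / 2)
‖ψ_β‖`. The constant `cStar` makes this at least `√(2 log (1/h))`, and the factor `1 + ε` turns
equality into divergence. Optimality of `ψ_β` is pointwise: a competitor satisfies `φ(x) ≥ φ(0) -
|x|^β ≥ 1 - |x|^β`. -/

theorem neg_log_one_sub_le {y b : ℝ} (hy : |y| ≤ b) (hb : b < 1) :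
    -Real.log (1 - y) ≤ y + y ^ 2 / (2 * (1 - b)) := by
  have hb0 : 0 ≤ b := (abs_nonneg y).trans hy
  rcases le_total 0 y with h0 | h0
  · rw [abs_of_nonneg h0] at hy
    have h1 : 0 < 1 - y := by linarith
    -- With `u = (1 - y)⁻¹`, the inequality `log u ≤ sinh (log u) = (u - u⁻¹)/2` is exactly the
    -- claim with `y` in place of `b`.
    have h2 : Real.log (1 - y)⁻¹ ≤ Real.sinh (Real.log (1 - y)⁻¹) := by
      rw [Real.self_le_sinh_iff]
      exact Real.log_nonneg (by rw [one_le_inv₀ h1]; linarith)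
    rw [Real.sinh_log (inv_pos.2 h1), Real.log_inv, inv_inv] at h2
    have h3 : ((1 - y)⁻¹ - (1 - y)) / 2 = y + y ^ 2 / (2 * (1 - y)) := by
      field_simp
      ring
    rw [h3] at h2
    refine h2.trans ?_
    gcongr
  · have h1 := Real.le_log_one_add_of_nonneg (x := -y) (by linarith)
    have h2 : 2 * -y / (-y + 2) = -y - y ^ 2 / (2 - y) := by
      have : (2 : ℝ) - y ≠ 0 := by linarith
      have : -y + 2 ≠ 0 := by linarith
      field_simp
      ring
    rw [h2, ← sub_eq_add_neg] at h1
    have h3 : y ^ 2 / (2 - y) ≤ y ^ 2 / (2 * (1 - b)) := by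
      gcongr
      linarith
    linarith

theorem integrable_exp_mul_sq_gaussianReal (v : ℝ≥0) {s : ℝ} (hs : 2 * s * v < 1) :
    Integrable (fun x => Real.exp (s * x ^ 2)) (gaussianReal 0 v) := by
  by_cases hv : v = 0
  · subst hv
    rw [gaussianReal_zero_var]
    exact integrable_dirac (by simp)
  have hv' : (0 : ℝ) < v := by positivity
  rw [gaussianReal_of_var_ne_zero _ hv]
  rw [integrable_withDensity_iff (by fun_prop) (by simp [gaussianPDF])]
  have hb : 0 < 1 / (2 * v) - s := by
    rw [sub_pos, lt_div_iff₀ (by positivity)]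
    linarith
  refine ((integrable_exp_neg_mul_sq hb).const_mul (√(2 * Real.pi * v))⁻¹).congr ?_
  refine ae_of_all _ fun x => ?_
  simp only [toReal_gaussianPDF, gaussianPDFReal_def]
  rw [mul_comm (Real.exp (s * x ^ 2)), mul_assoc (√(2 * Real.pi * v))⁻¹, ← Real.exp_add]
  congr 2
  field_simp
  ring

theorem integral_exp_mul_sq_gaussianReal (v : ℝ≥0) {s : ℝ} (hs : 2 * s * v < 1) :
    ∫ x, Real.exp (s * x ^ 2) ∂(gaussianReal 0 v) = (√(1 - 2 * s * v))⁻¹ := by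
  by_cases hv : v = 0
  · subst hv
    simp
  have hv' : (0 : ℝ) < v := by positivity
  rw [integral_gaussianReal_eq_integral_smul hv]
  have h1 : ∀ x : ℝ, gaussianPDFReal 0 v x • Real.exp (s * x ^ 2)
      = (√(2 * Real.pi * v))⁻¹ * Real.exp (-(1 / (2 * v) - s) * x ^ 2) := fun x => by
    rw [gaussianPDFReal_def, smul_eq_mul, mul_assoc, ← Real.exp_add]
    congr 2
    field_simp
    ring
  simp_rw [h1]
  rw [integral_const_mul, integral_gaussian, ← Real.sqrt_inv, ← Real.sqrt_inv,
    ← Real.sqrt_mul (by positivity)]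
  congr 1
  have : (1 : ℝ) - 2 * s * v ≠ 0 := by linarith
  have hπ := Real.pi_pos
  field_simp

theorem integral_exp_mul_sq_sub_le (v : ℝ≥0) {s b : ℝ} (hs : |2 * s * v| ≤ b) (hb : b < 1) :
    ∫ x, Real.exp (s * (x ^ 2 - v)) ∂(gaussianReal 0 v)
      ≤ Real.exp ((s * v) ^ 2 / (1 - b)) := by
  have hlt : 2 * s * v < 1 := (le_abs_self _).trans_lt (hs.trans_lt hb)
  have h1 : ∀ x : ℝ, Real.exp (s * (x ^ 2 - v)) = Real.exp (-(s * v)) * Real.exp (s * x ^ 2) :=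
    fun x => by rw [← Real.exp_add]; ring_nf
  simp_rw [h1]
  rw [integral_const_mul, integral_exp_mul_sq_gaussianReal v hlt]
  have hpos : 0 < 1 - 2 * s * v := by linarith
  rw [← Real.exp_log (Real.sqrt_pos.2 hpos), ← Real.exp_neg, ← Real.exp_add, Real.exp_le_exp,
    Real.log_sqrt hpos.le]
  have h2 := neg_log_one_sub_le hs hb
  have h3 : (2 * s * v) ^ 2 / (2 * (1 - b)) = 2 * ((s * v) ^ 2 / (1 - b)) := by
    have : 1 - b ≠ 0 := by linarith
    field_simp
  linarith

/-- Chernoff bound: the logarithmic Laplace transform of the sum at `θ` is at most `θ² A² / (1 -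
2θB)`, since each factor is that of a centred squared Gaussian. -/
theorem pi_gaussianReal_upper_tail {ι : Type*} [Fintype ι] (v : ι → ℝ≥0) (a : ι → ℝ) {A B η : ℝ}
    (hA : 0 < A) (hη : 0 ≤ η) (hAa : ∑ k, (a k * v k) ^ 2 ≤ A ^ 2) (hB : ∀ k, |a k * v k| ≤ B)
    (hB0 : 0 ≤ B) :
    (Measure.pi fun k => gaussianReal 0 (v k)).real
      {x | 2 * A * √η + 2 * B * η ≤ ∑ k, a k * (x k ^ 2 - v k)} ≤ Real.exp (-η) := by
  set r := √η with hr
  have hr0 : 0 ≤ r := Real.sqrt_nonneg η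
  have hrη : r ^ 2 = η := Real.sq_sqrt hη
  set D := A + 2 * B * r with hD
  have hD0 : 0 < D := by positivity
  -- With this choice `1 - 2θB = A / D`, and the Chernoff exponent equals `-η` exactly.
  set θ := r / D with hθ
  have hθ0 : 0 ≤ θ := by positivity
  have hb : 2 * θ * B < 1 := by
    rw [hθ, mul_div_assoc', div_mul_eq_mul_div, div_lt_one hD0]
    linarith
  have hbk : ∀ k, |2 * (θ * a k) * v k| ≤ 2 * θ * B := fun k => by
    rw [show 2 * (θ * a k) * v k = 2 * θ * (a k * v k) by ring, abs_mul,
      abs_of_nonneg (by positivity : 0 ≤ 2 * θ)]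
    exact mul_le_mul_of_nonneg_left (hB k) (by positivity)
  have hprod : ∀ x : ι → ℝ, Real.exp (θ * ∑ k, a k * (x k ^ 2 - v k))
      = ∏ k, Real.exp ((θ * a k) * (x k ^ 2 - v k)) := fun x => by
    rw [← Real.exp_sum, Finset.mul_sum]
    simp only [mul_assoc]
  have hInt : Integrable (fun x : ι → ℝ => Real.exp (θ * ∑ k, a k * (x k ^ 2 - v k)))
      (Measure.pi fun k => gaussianReal 0 (v k)) := by
    simp_rw [hprod]
    refine Integrable.fintype_prod_dep
      (f := fun k x => Real.exp ((θ * a k) * (x ^ 2 - v k))) fun k => ?_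
    have h1 : ∀ x : ℝ, Real.exp ((θ * a k) * (x ^ 2 - v k))
        = Real.exp (-((θ * a k) * v k)) * Real.exp ((θ * a k) * x ^ 2) :=
      fun x => by rw [← Real.exp_add]; ring_nf
    simp_rw [h1]
    exact (integrable_exp_mul_sq_gaussianReal _
      ((le_abs_self _).trans_lt ((hbk k).trans_lt hb))).const_mul _
  have hch := measure_ge_le_exp_mul_mgf (μ := Measure.pi fun k => gaussianReal 0 (v k))
    (X := fun x => ∑ k, a k * (x k ^ 2 - v k)) (2 * A * r + 2 * B * η) hθ0 hInt
  refine hch.trans ?_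
  have hmgf : mgf (fun x : ι → ℝ => ∑ k, a k * (x k ^ 2 - v k))
      (Measure.pi fun k => gaussianReal 0 (v k)) θ
      ≤ Real.exp (θ ^ 2 * A ^ 2 / (1 - 2 * θ * B)) := by
    rw [mgf]
    simp_rw [hprod]
    rw [integral_fintype_prod_eq_prod
      (f := fun k x => Real.exp ((θ * a k) * (x ^ 2 - v k)))]
    calc ∏ k, ∫ x, Real.exp ((θ * a k) * (x ^ 2 - v k)) ∂(gaussianReal 0 (v k))
        ≤ ∏ k, Real.exp ((θ * a k * v k) ^ 2 / (1 - 2 * θ * B)) :=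
          Finset.prod_le_prod (fun k _ => integral_nonneg fun x => (Real.exp_pos _).le)
            fun k _ => integral_exp_mul_sq_sub_le _ (hbk k) hb
      _ = Real.exp (θ ^ 2 * (∑ k, (a k * v k) ^ 2) / (1 - 2 * θ * B)) := by
          rw [← Real.exp_sum, Finset.mul_sum, Finset.sum_div]
          congr 1
          refine Finset.sum_congr rfl fun k _ => ?_
          ring
      _ ≤ _ := by
          have : 0 < 1 - 2 * θ * B := by linarith
          gcongr
  calc Real.exp (-θ * (2 * A * r + 2 * B * η)) * mgf _ _ θ
      ≤ Real.exp (-θ * (2 * A * r + 2 * B * η)) * Real.exp (θ ^ 2 * A ^ 2 / (1 - 2 * θ * B)) := by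
        gcongr
    _ = Real.exp (-η) := by
        rw [← Real.exp_add]
        congr 1
        have h1 : 1 - 2 * θ * B = A / D := by
          rw [hθ, eq_div_iff hD0.ne']
          field_simp
          rw [hD]
          ring
        rw [h1, hθ, ← hrη]
        field_simp
        rw [hD]
        ring

theorem pi_gaussianReal_tail {ι : Type*} [Fintype ι] (v : ι → ℝ≥0) (a : ι → ℝ) {A B η : ℝ}
    (hA : 0 < A) (hη : 0 ≤ η) (hAa : ∑ k, (a k * v k) ^ 2 ≤ A ^ 2) (hB : ∀ k, |a k * v k| ≤ B)
    (hB0 : 0 ≤ B) :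
    (Measure.pi fun k => gaussianReal 0 (v k)).real
      {x | 2 * A * √η + 2 * B * η < |∑ k, a k * (x k ^ 2 - v k)|} ≤ 2 * Real.exp (-η) := by
  have h1 := pi_gaussianReal_upper_tail v a hA hη hAa hB hB0
  have h2 := pi_gaussianReal_upper_tail v (fun k => -a k) hA hη (by simpa using hAa)
    (by simpa using hB) hB0
  rw [two_mul (Real.exp _)]
  refine le_trans ?_ (add_le_add h1 h2)
  refine le_trans (measureReal_mono ?_) (measureReal_union_le _ _)
  intro x hx
  simp only [mem_ofPred_eq, mem_union, neg_mul, Finset.sum_neg_distrib] at hx ⊢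
  rcases lt_abs.1 hx with h | h
  · exact Or.inl h.le
  · exact Or.inr h.le


/-! ### Integrals over the blocks of a regular grid -/

theorem block_le (n : ℕ) (k : Fin n) : (k : ℝ) / n ≤ ((k : ℝ) + 1) / n := by
  gcongr
  linarith

theorem block_nonneg (n : ℕ) (k : Fin n) : 0 ≤ (k : ℝ) / n := by positivity

theorem block_le_one {n : ℕ} (k : Fin n) : ((k : ℝ) + 1) / n ≤ 1 :=
  div_le_one_of_le₀ (by exact_mod_cast k.2) (by positivity)

theorem block_length (n : ℕ) (k : Fin n) : ((k : ℝ) + 1) / n - (k : ℝ) / n = 1 / n := by ring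

theorem block_subset {n : ℕ} (k : Fin n) :
    Icc ((k : ℝ) / n) (((k : ℝ) + 1) / n) ⊆ Icc 0 1 :=
  Icc_subset_Icc (block_nonneg n k) (block_le_one k)

theorem sum_integral_blocks {n : ℕ} (hn : 0 < n) {F : ℝ → ℝ}
    (hF : IntervalIntegrable F volume 0 1) :
    ∑ k : Fin n, ∫ s in ((k : ℝ) / n)..(((k : ℝ) + 1) / n), F s = ∫ s in (0 : ℝ)..1, F s := by
  have h1 := intervalIntegral.sum_integral_adjacent_intervals (μ := volume) (f := F)
    (a := fun k : ℕ => (k : ℝ) / n) (n := n) fun k hk => by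
      refine hF.mono_set ?_
      rw [uIcc_of_le zero_le_one, uIcc_of_le (by gcongr; simp)]
      have := block_subset (⟨k, hk⟩ : Fin n)
      simpa using this
  have hn' : (n : ℝ) ≠ 0 := by positivity
  rw [← Fin.sum_univ_eq_sum_range
    (fun k : ℕ => ∫ s in ((k : ℝ) / n)..(((k + 1 : ℕ) : ℝ) / n), F s) n] at h1
  simpa [hn'] using h1

/-- Expand `∫ (g - n I)² ≥ 0`, where `n I` is the mean of `g` over a block of length `1/n`. -/
theorem mul_sq_integral_le {g : ℝ → ℝ} (hg : Continuous g) {n : ℕ} (hn : 0 < n) (k : Fin n) :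
    n * (∫ s in ((k : ℝ) / n)..(((k : ℝ) + 1) / n), g s) ^ 2
      ≤ ∫ s in ((k : ℝ) / n)..(((k : ℝ) + 1) / n), g s ^ 2 := by
  set I := ∫ s in ((k : ℝ) / n)..(((k : ℝ) + 1) / n), g s with hI
  have hn' : (n : ℝ) ≠ 0 := by positivity
  have h0 : 0 ≤ ∫ s in ((k : ℝ) / n)..(((k : ℝ) + 1) / n), (g s - n * I) ^ 2 :=
    intervalIntegral.integral_nonneg (block_le n k) fun _ _ => sq_nonneg _
  have h1 : ∀ s, (g s - n * I) ^ 2 = g s ^ 2 - (2 * n * I) * g s + n ^ 2 * I ^ 2 :=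
    fun s => by ring
  simp_rw [h1] at h0
  rw [intervalIntegral.integral_add (Continuous.intervalIntegrable (by fun_prop) _ _)
      (by simp), intervalIntegral.integral_sub
      (Continuous.intervalIntegrable (by fun_prop) _ _)
      (Continuous.intervalIntegrable (by fun_prop) _ _), intervalIntegral.integral_const_mul,
    intervalIntegral.integral_const, block_length, ← hI, smul_eq_mul] at h0
  have h2 : 1 / (n : ℝ) * (n ^ 2 * I ^ 2) = n * I ^ 2 := by field_simp
  rw [h2] at h0
  linarith

theorem sum_sq_sqrt_mul_integral_le {g : ℝ → ℝ} (hg : Continuous g) {n : ℕ} (hn : 0 < n) :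
    ∑ k : Fin n, (√n * ∫ s in ((k : ℝ) / n)..(((k : ℝ) + 1) / n), g s) ^ 2
      ≤ ∫ s in (0 : ℝ)..1, g s ^ 2 := by
  rw [← sum_integral_blocks hn (Continuous.intervalIntegrable (by fun_prop) _ _)]
  refine Finset.sum_le_sum fun k _ => ?_
  rw [mul_pow, Real.sq_sqrt (Nat.cast_nonneg n)]
  exact mul_sq_integral_le hg hn k

theorem abs_sqrt_mul_integral_le {g : ℝ → ℝ} {n : ℕ} {S : ℝ}
    (hS : ∀ s, |g s| ≤ S) (k : Fin n) :
    |√n * ∫ s in ((k : ℝ) / n)..(((k : ℝ) + 1) / n), g s| ≤ S / √n := by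
  have h1 := intervalIntegral.norm_integral_le_of_norm_le_const (f := g)
    (a := (k : ℝ) / n) (b := ((k : ℝ) + 1) / n) fun s _ => hS s
  rw [block_length, abs_of_nonneg (by positivity), Real.norm_eq_abs] at h1
  rw [abs_mul, abs_of_nonneg (Real.sqrt_nonneg _)]
  have hn : 0 < n := k.pos
  have hsq : √(n : ℝ) * √n = n := Real.mul_self_sqrt (Nat.cast_nonneg n)
  have hpos : 0 < √(n : ℝ) := by positivity
  calc √n * |∫ s in ((k : ℝ) / n)..(((k : ℝ) + 1) / n), g s| ≤ √n * (S * (1 / n)) := by gcongr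
    _ = S / √n := by
      field_simp
      rw [Real.sq_sqrt (Nat.cast_nonneg n)]
      ring

theorem integral_zero_one_indicator_Icc_le {a b : ℝ} (hab : a ≤ b) :
    ∫ s in (0 : ℝ)..1, (Icc a b).indicator (fun _ => (1 : ℝ)) s ≤ b - a := by
  rw [intervalIntegral.integral_of_le zero_le_one, setIntegral_indicator measurableSet_Icc]
  simp only [integral_const, smul_eq_mul, mul_one, measureReal_restrict_apply MeasurableSet.univ,
    univ_inter]
  refine (measureReal_mono inter_subset_right (by simp)).trans ?_
  simp [Real.volume_real_Icc_of_le hab]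

/-- Two intervals are allowed because the difference of two rescaled kernels lives on the union of
their windows; an overlap is counted twice. -/
theorem integral_zero_one_le_of_support {F : ℝ → ℝ} (hF : Continuous F) {S a b a' b' : ℝ}
    (hS : ∀ s, F s ≤ S) (hS0 : 0 ≤ S) (hab : a ≤ b) (hab' : a' ≤ b')
    (h0 : ∀ s, s ∉ Icc a b → s ∉ Icc a' b' → F s = 0) :
    ∫ s in (0 : ℝ)..1, F s ≤ S * ((b - a) + (b' - a')) := by
  have hi : ∀ c d : ℝ, IntervalIntegrable ((Icc c d).indicator fun _ => (1 : ℝ)) volume 0 1 :=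
    fun c d => by
      rw [intervalIntegrable_iff, uIoc_of_le zero_le_one]
      exact ((integrable_const (1 : ℝ)).indicator measurableSet_Icc)
  calc ∫ s in (0 : ℝ)..1, F s
      ≤ ∫ s in (0 : ℝ)..1, S * ((Icc a b).indicator (fun _ => (1 : ℝ)) s
          + (Icc a' b').indicator (fun _ => (1 : ℝ)) s) := by
        refine intervalIntegral.integral_mono_on zero_le_one (hF.intervalIntegrable _ _)
          (((hi a b).add (hi a' b')).const_mul S) fun s _ => ?_
        by_cases h1 : s ∈ Icc a b
        · by_cases h2 : s ∈ Icc a' b' <;> simp only [h1, h2, indicator_of_mem,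
            indicator_of_notMem, not_false_eq_true] <;> nlinarith [hS s]
        · by_cases h2 : s ∈ Icc a' b'
          · simp only [h1, h2, indicator_of_mem, indicator_of_notMem, not_false_eq_true]
            linarith [hS s]
          · simp [h1, h2, h0 s h1 h2]
    _ ≤ S * ((b - a) + (b' - a')) := by
        rw [intervalIntegral.integral_const_mul,
          intervalIntegral.integral_add (hi a b) (hi a' b')]
        gcongr
        · exact integral_zero_one_indicator_Icc_le hab
        · exact integral_zero_one_indicator_Icc_le hab'

/-! ### Kernels and their weights -/

variable {ψ : ℝ → ℝ}

theorem continuous_of_holder {γ : ℝ} (hγ : 0 < γ) (h : ∀ x y, |ψ x - ψ y| ≤ |x - y| ^ γ) :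
    Continuous ψ := by
  rw [continuous_iff_continuousAt]
  intro x
  rw [ContinuousAt, tendsto_iff_dist_tendsto_zero]
  have h1 : Tendsto (fun y => |y - x| ^ γ) (𝓝 x) (𝓝 0) := by
    have : Continuous fun y => |y - x| ^ γ :=
      Continuous.rpow_const (by fun_prop) fun _ => Or.inr hγ.le
    simpa [hγ.ne'] using this.tendsto x
  exact squeeze_zero (fun _ => dist_nonneg) (fun y => h y x) h1

theorem IsKernel.continuous (hψ : IsKernel ψ) : Continuous ψ := by
  obtain ⟨γ, h0, -, h⟩ := hψ.holder
  exact continuous_of_holder h0 h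

/-- The support of a continuous function is open, hence inside the interior of `[-1,1]`. -/
theorem IsKernel.support_subset_Ioo (hψ : IsKernel ψ) : Function.support ψ ⊆ Ioo (-1) 1 := by
  rw [← interior_Icc]
  exact hψ.continuous.isOpen_support.subset_interior_iff.2 hψ.support

theorem IsKernel.hasCompactSupport (hψ : IsKernel ψ) : HasCompactSupport ψ :=
  HasCompactSupport.intro (isCompact_Icc (a := (-1 : ℝ)) (b := 1)) fun x hx => by
    by_contra h
    exact hx (hψ.support h)

theorem IsKernel.hasCompactSupport_sq (hψ : IsKernel ψ) : HasCompactSupport fun x => ψ x ^ 2 :=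
  HasCompactSupport.intro (isCompact_Icc (a := (-1 : ℝ)) (b := 1)) fun x hx => by
    have : ψ x = 0 := by
      by_contra h
      exact hx (hψ.support h)
    simp [this]

theorem IsKernel.integrable (hψ : IsKernel ψ) : Integrable ψ :=
  hψ.continuous.integrable_of_hasCompactSupport hψ.hasCompactSupport

theorem IsKernel.integrable_sq (hψ : IsKernel ψ) : Integrable fun x => ψ x ^ 2 :=
  (hψ.continuous.pow 2).integrable_of_hasCompactSupport
    hψ.hasCompactSupport_sq

theorem IsKernel.integral_sq_pos (hψ : IsKernel ψ) : 0 < ∫ x, ψ x ^ 2 :=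
  (hψ.continuous.pow 2).integral_pos_of_hasCompactSupport_nonneg_nonzero
    hψ.hasCompactSupport_sq
    (fun _ => sq_nonneg _) (x := 0) (by simp [hψ.at_zero])

theorem IsKernel.integral_pos (hψ : IsKernel ψ) : 0 < ∫ x, ψ x :=
  hψ.continuous.integral_pos_of_hasCompactSupport_nonneg_nonzero hψ.hasCompactSupport
    hψ.nonneg (x := 0) (by simp [hψ.at_zero])

theorem IsKernel.eq_zero_of_lt (hψ : IsKernel ψ) {s t h : ℝ} (hh : 0 < h)
    (hs : s ∉ Icc (t - h) (t + h)) : ψ ((s - t) / h) = 0 := by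
  by_contra h0
  have := hψ.support h0
  rw [mem_Icc, le_div_iff₀ hh, div_le_iff₀ hh] at this
  exact hs ⟨by linarith [this.1], by linarith [this.2]⟩

theorem integral_zero_one_rescale {F : ℝ → ℝ} (hF : Function.support F ⊆ Ioo (-1) 1) {t h : ℝ}
    (hh : 0 < h) (ht : t ∈ Icc h (1 - h)) :
    ∫ s in (0 : ℝ)..1, F ((s - t) / h) = h * ∫ x, F x := by
  have h1 : ∀ s, (s - t) / h = s / h - t / h := fun s => by ring
  simp_rw [h1]
  rw [intervalIntegral.integral_comp_div_sub (f := F) hh.ne', smul_eq_mul,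
    intervalIntegral.integral_eq_integral_of_support_subset]
  refine hF.trans fun x hx => ⟨lt_of_le_of_lt ?_ hx.1, hx.2.le.trans ?_⟩
  · rw [zero_div, zero_sub, neg_le_neg_iff, one_le_div₀ hh]
    exact ht.1
  · rw [← sub_div, one_le_div₀ hh]
    linarith [ht.2]

/-! ### Size of the weights and their continuity in location and scale -/

theorem IsKernel.weight_nonneg (hψ : IsKernel ψ) (n : ℕ) (t h : ℝ) (k : Fin n) :
    0 ≤ weight ψ n t h k :=
  mul_nonneg (Real.sqrt_nonneg _)
    (intervalIntegral.integral_nonneg (block_le n k) fun _ _ => hψ.nonneg _)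

theorem IsKernel.weight_le (hψ : IsKernel ψ) (n : ℕ) (t h : ℝ) (k : Fin n) :
    weight ψ n t h k ≤ 1 / √n :=
  (le_abs_self _).trans <| abs_sqrt_mul_integral_le (g := fun s => ψ ((s - t) / h))
    (fun s => by rw [abs_of_nonneg (hψ.nonneg _)]; exact hψ.le_one _) k

theorem weightNorm_nonneg (ψ : ℝ → ℝ) (n : ℕ) (t h : ℝ) : 0 ≤ weightNorm ψ n t h :=
  Real.sqrt_nonneg _

theorem weightNorm_sq (ψ : ℝ → ℝ) (n : ℕ) (t h : ℝ) :
    weightNorm ψ n t h ^ 2 = ∑ k, weight ψ n t h k ^ 2 :=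
  Real.sq_sqrt (Finset.sum_nonneg fun _ _ => sq_nonneg _)

theorem abs_weight_le_weightNorm (ψ : ℝ → ℝ) (n : ℕ) (t h : ℝ) (k : Fin n) :
    |weight ψ n t h k| ≤ weightNorm ψ n t h := by
  refine abs_le_of_sq_le_sq ?_ (weightNorm_nonneg _ _ _ _)
  rw [weightNorm_sq]
  exact Finset.single_le_sum (f := fun k => weight ψ n t h k ^ 2) (fun _ _ => sq_nonneg _)
    (Finset.mem_univ k)

theorem sum_weight_le (ψ : ℝ → ℝ) (n : ℕ) (t h : ℝ) :
    |∑ k, weight ψ n t h k| ≤ √n * weightNorm ψ n t h := by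
  refine abs_le_of_sq_le_sq ?_ (mul_nonneg (Real.sqrt_nonneg _) (weightNorm_nonneg _ _ _ _))
  rw [mul_pow, weightNorm_sq, Real.sq_sqrt (Nat.cast_nonneg n)]
  have := sq_sum_le_card_mul_sum_sq (s := (Finset.univ : Finset (Fin n)))
    (f := fun k => weight ψ n t h k)
  simpa using this

theorem IsKernel.weightNorm_le_one (hψ : IsKernel ψ) (n : ℕ) (t h : ℝ) :
    weightNorm ψ n t h ≤ 1 := by
  refine abs_le_of_sq_le_sq' ?_ zero_le_one |>.2
  rw [weightNorm_sq]
  calc ∑ k, weight ψ n t h k ^ 2 ≤ ∑ _k : Fin n, (1 / √(n : ℝ)) ^ 2 := by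
        refine Finset.sum_le_sum fun k _ => ?_
        exact pow_le_pow_left₀ (hψ.weight_nonneg n t h k) (hψ.weight_le n t h k) 2
    _ ≤ 1 ^ 2 := by
        rw [Finset.sum_const, Finset.card_univ, Fintype.card_fin, nsmul_eq_mul, div_pow,
          Real.sq_sqrt (Nat.cast_nonneg n)]
        rcases Nat.eq_zero_or_pos n with rfl | hn
        · simp
        · have : (n : ℝ) ≠ 0 := by positivity
          field_simp
          simp

theorem IsKernel.weightNorm_sq_le_integral (hψ : IsKernel ψ) {n : ℕ} (hn : 0 < n) (t h : ℝ) :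
    weightNorm ψ n t h ^ 2 ≤ ∫ s in (0 : ℝ)..1, ψ ((s - t) / h) ^ 2 := by
  rw [weightNorm_sq]
  have hc := hψ.continuous
  exact sum_sq_sqrt_mul_integral_le (g := fun s => ψ ((s - t) / h)) (by fun_prop) hn

theorem IsKernel.weightNorm_sq_le (hψ : IsKernel ψ) {n : ℕ} (hn : 0 < n) {t h : ℝ} (hh : 0 < h)
    (ht : t ∈ Icc h (1 - h)) : weightNorm ψ n t h ^ 2 ≤ h * ∫ x, ψ x ^ 2 := by
  refine (hψ.weightNorm_sq_le_integral hn t h).trans (integral_zero_one_rescale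
    (F := fun x => ψ x ^ 2) ?_ hh ht).le
  exact fun x hx => hψ.support_subset_Ioo (fun h0 => hx (by simp [h0]))

theorem IsKernel.weightNorm_sq_le_two_mul (hψ : IsKernel ψ) {n : ℕ} (hn : 0 < n) (t : ℝ) {h : ℝ}
    (hh : 0 < h) : weightNorm ψ n t h ^ 2 ≤ 2 * h := by
  refine (hψ.weightNorm_sq_le_integral hn t h).trans ?_
  have hc := hψ.continuous
  have := integral_zero_one_le_of_support (F := fun s => ψ ((s - t) / h) ^ 2) (by fun_prop)
    (S := 1) (a := t - h) (b := t + h) (a' := t) (b' := t)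
    (fun s => pow_le_one₀ (hψ.nonneg _) (hψ.le_one _)) zero_le_one (by linarith) le_rfl
    fun s hs _ => by simp [hψ.eq_zero_of_lt hh hs]
  linarith

/-- If `s` lies in one window, its rescaled coordinate there is at most 1 in modulus, so a change of
scale moves the argument by at most `|h - h'|/μ`. By symmetry either window will do, and outside
both windows the two terms vanish. -/
theorem IsKernel.abs_sub_rescale_le (hψ : IsKernel ψ) {γ : ℝ} (hγ : 0 < γ)
    (hH : ∀ x y, |ψ x - ψ y| ≤ |x - y| ^ γ) {t h t' h' μ : ℝ} (hμ : 0 < μ) (hh : μ ≤ h)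
    (hh' : μ ≤ h') (s : ℝ) :
    |ψ ((s - t) / h) - ψ ((s - t') / h')| ≤ ((|t - t'| + |h - h'|) / μ) ^ γ := by
  have key : ∀ {t h t' h' : ℝ}, μ ≤ h → μ ≤ h' → s ∈ Icc (t - h) (t + h) →
      |ψ ((s - t) / h) - ψ ((s - t') / h')| ≤ ((|t - t'| + |h - h'|) / μ) ^ γ := by
    intro t h t' h' hh hh' hs
    refine (hH _ _).trans (Real.rpow_le_rpow (abs_nonneg _) ?_ hγ.le)
    have h0 : 0 < h := hμ.trans_le hh
    have h0' : 0 < h' := hμ.trans_le hh'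
    have e : (s - t) / h - (s - t') / h' = ((t' - t) + (s - t) / h * (h' - h)) / h' := by
      field_simp
      ring
    rw [e, abs_div, abs_of_pos h0']
    have h1 : |(s - t) / h| ≤ 1 := by
      rw [abs_div, abs_of_pos h0, div_le_one h0, abs_le]
      exact ⟨by linarith [hs.1], by linarith [hs.2]⟩
    have h2 : |(t' - t) + (s - t) / h * (h' - h)| ≤ |t - t'| + |h - h'| := by
      refine (abs_add_le _ _).trans ?_
      rw [abs_mul, abs_sub_comm t', abs_sub_comm h']
      nlinarith [abs_nonneg (h - h')]
    exact div_le_div₀ (by positivity) h2 hμ hh'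
  by_cases hs : s ∈ Icc (t - h) (t + h)
  · exact key hh hh' hs
  · by_cases hs' : s ∈ Icc (t' - h') (t' + h')
    · rw [abs_sub_comm, abs_sub_comm t, abs_sub_comm h]
      exact key hh' hh hs'
    · rw [hψ.eq_zero_of_lt (hμ.trans_le hh) hs, hψ.eq_zero_of_lt (hμ.trans_le hh') hs']
      simp only [sub_self, abs_zero]
      positivity

theorem IsKernel.weight_sub (hψ : IsKernel ψ) (n : ℕ) (t h t' h' : ℝ) (k : Fin n) :
    weight ψ n t h k - weight ψ n t' h' k
      = √n * ∫ s in ((k : ℝ) / n)..(((k : ℝ) + 1) / n),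
          (ψ ((s - t) / h) - ψ ((s - t') / h')) := by
  have hc := hψ.continuous
  rw [weight, weight, intervalIntegral.integral_sub
    (Continuous.intervalIntegrable (by fun_prop) _ _)
    (Continuous.intervalIntegrable (by fun_prop) _ _)]
  ring

theorem IsKernel.abs_weight_sub_le (hψ : IsKernel ψ) {γ : ℝ} (hγ : 0 < γ)
    (hH : ∀ x y, |ψ x - ψ y| ≤ |x - y| ^ γ) (n : ℕ) {t h t' h' μ : ℝ} (hμ : 0 < μ) (hh : μ ≤ h)
    (hh' : μ ≤ h') (k : Fin n) :
    |weight ψ n t h k - weight ψ n t' h' k| ≤ ((|t - t'| + |h - h'|) / μ) ^ γ / √n := by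
  rw [hψ.weight_sub]
  exact abs_sqrt_mul_integral_le (fun s => hψ.abs_sub_rescale_le hγ hH hμ hh hh' s) k

theorem IsKernel.sum_sq_weight_sub_le (hψ : IsKernel ψ) {γ : ℝ} (hγ : 0 < γ)
    (hH : ∀ x y, |ψ x - ψ y| ≤ |x - y| ^ γ) {n : ℕ} (hn : 0 < n) {t h t' h' μ : ℝ} (hμ : 0 < μ)
    (hh : μ ≤ h) (hh' : μ ≤ h') :
    ∑ k, (weight ψ n t h k - weight ψ n t' h' k) ^ 2
      ≤ (((|t - t'| + |h - h'|) / μ) ^ γ) ^ 2 * (2 * h + 2 * h') := by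
  simp_rw [hψ.weight_sub]
  have hc := hψ.continuous
  refine (sum_sq_sqrt_mul_integral_le (g := fun s => ψ ((s - t) / h) - ψ ((s - t') / h'))
    (by fun_prop) hn).trans ?_
  have h1 : 0 < h := hμ.trans_le hh
  have h1' : 0 < h' := hμ.trans_le hh'
  have := integral_zero_one_le_of_support
    (F := fun s => (ψ ((s - t) / h) - ψ ((s - t') / h')) ^ 2) (by fun_prop)
    (S := (((|t - t'| + |h - h'|) / μ) ^ γ) ^ 2) (a := t - h) (b := t + h) (a' := t' - h')
    (b' := t' + h')
    (fun s => by
      rw [← sq_abs]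
      exact pow_le_pow_left₀ (abs_nonneg _) (hψ.abs_sub_rescale_le hγ hH hμ hh hh' s) 2)
    (sq_nonneg _) (by linarith) (by linarith)
    fun s hs hs' => by simp [hψ.eq_zero_of_lt h1 hs, hψ.eq_zero_of_lt h1' hs']
  refine this.trans (le_of_eq ?_)
  ring

/-- `ω` bounds the oscillation of the rescaled kernel on a block, so the block mean is at least `ψ -
ω`. Its square is then at least `ψ² - 2ωψ`: by squaring where `ψ ≥ ω`, and because `ψ² - 2ωψ ≤ 0`
where `ψ ≤ ω`. -/
theorem IsKernel.le_weightNorm_sq (hψ : IsKernel ψ) {γ : ℝ} (hγ : 0 < γ)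
    (hH : ∀ x y, |ψ x - ψ y| ≤ |x - y| ^ γ) {n : ℕ} (hn : 0 < n) {t h : ℝ} (hh : 0 < h)
    (ht : t ∈ Icc h (1 - h)) :
    h * ((∫ x, ψ x ^ 2) - 2 * (1 / (n * h)) ^ γ * ∫ x, ψ x) ≤ weightNorm ψ n t h ^ 2 := by
  have hc := hψ.continuous
  set ω := (1 / (n * h)) ^ γ with hω
  have hn' : (0 : ℝ) < n := by positivity
  have e1 := integral_zero_one_rescale hψ.support_subset_Ioo hh ht
  have e2 := integral_zero_one_rescale (F := fun x => ψ x ^ 2)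
    (fun x hx => hψ.support_subset_Ioo (fun h0 => hx (by simp [h0]))) hh ht
  have e3 : h * ((∫ x, ψ x ^ 2) - 2 * ω * ∫ x, ψ x)
      = ∫ s in (0 : ℝ)..1, (ψ ((s - t) / h) ^ 2 - 2 * ω * ψ ((s - t) / h)) := by
    rw [intervalIntegral.integral_sub (Continuous.intervalIntegrable (by fun_prop) _ _)
      (Continuous.intervalIntegrable (by fun_prop) _ _), intervalIntegral.integral_const_mul,
      e1, e2]
    ring
  rw [e3, weightNorm_sq,
    ← sum_integral_blocks hn (Continuous.intervalIntegrable (by fun_prop) _ _)]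
  refine Finset.sum_le_sum fun k _ => ?_
  set I := ∫ s in ((k : ℝ) / n)..(((k : ℝ) + 1) / n), ψ ((s - t) / h) with hI
  have hI0 : 0 ≤ I := intervalIntegral.integral_nonneg (block_le n k) fun _ _ => hψ.nonneg _
  have e4 : weight ψ n t h k ^ 2
      = ∫ s in ((k : ℝ) / n)..(((k : ℝ) + 1) / n), (n * I) ^ 2 := by
    rw [intervalIntegral.integral_const, block_length, weight, mul_pow,
      Real.sq_sqrt (Nat.cast_nonneg n), smul_eq_mul, ← hI]
    field_simp
  rw [e4]
  refine intervalIntegral.integral_mono_on (block_le n k)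
    (Continuous.intervalIntegrable (by fun_prop) _ _)
    (Continuous.intervalIntegrable (by fun_prop) _ _) fun s hs => ?_
  have h1 : ψ ((s - t) / h) - ω ≤ n * I := by
    have h2 : ∫ _r in ((k : ℝ) / n)..(((k : ℝ) + 1) / n), (ψ ((s - t) / h) - ω) ≤ I := by
      refine intervalIntegral.integral_mono_on (block_le n k) (by simp)
        (Continuous.intervalIntegrable (by fun_prop) _ _) fun r hr => ?_
      have h3 := (le_abs_self _).trans (hH ((s - t) / h) ((r - t) / h))
      have h4 : |(s - t) / h - (r - t) / h| ^ γ ≤ ω := by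
        refine Real.rpow_le_rpow (abs_nonneg _) ?_ hγ.le
        rw [← sub_div, abs_div, abs_of_pos hh, ← div_div]
        gcongr
        rw [abs_le, ← block_length n k]
        constructor <;> linarith [hs.1, hs.2, hr.1, hr.2]
      linarith
    rw [intervalIntegral.integral_const, block_length, smul_eq_mul, one_div,
      inv_mul_le_iff₀ hn'] at h2
    exact h2
  have hω0 : 0 ≤ ω := by positivity
  have h5 := hψ.nonneg ((s - t) / h)
  have h6 : 0 ≤ n * I := by positivity
  rcases le_total ω (ψ ((s - t) / h)) with h7 | h7
  · nlinarith [mul_self_le_mul_self (sub_nonneg.2 h7) h1]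
  · nlinarith [sq_nonneg (n * I)]

theorem IsKernel.exists_lower_bound (hψ : IsKernel ψ) :
    ∃ K₁ : ℝ, 0 < K₁ ∧ ∀ n : ℕ, 0 < n → ∀ t h : ℝ, K₁ / n ≤ h → t ∈ Icc h (1 - h) →
      h * ((∫ x, ψ x ^ 2) / 2) ≤ weightNorm ψ n t h ^ 2 := by
  obtain ⟨γ, hγ, -, hH⟩ := hψ.holder
  have hI := hψ.integral_sq_pos
  have hlim : Tendsto (fun K : ℝ => 2 * (1 / K) ^ γ * ∫ x, ψ x) atTop (𝓝 0) := by
    have h1 : Tendsto (fun K : ℝ => K ^ (-γ)) atTop (𝓝 0) := tendsto_rpow_neg_atTop hγ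
    have h2 := (h1.const_mul 2).mul_const (∫ x, ψ x)
    simp only [mul_zero, zero_mul] at h2
    refine h2.congr' ?_
    filter_upwards [eventually_gt_atTop 0] with K hK
    rw [one_div, Real.inv_rpow hK.le, Real.rpow_neg hK.le]
  obtain ⟨K₁, hK₁, hK0⟩ := ((hlim.eventually (gt_mem_nhds (half_pos hI))).and
    (eventually_gt_atTop 0)).exists
  refine ⟨K₁, hK0, fun n hn t h hh ht => ?_⟩
  have hn' : (0 : ℝ) < n := by positivity
  have h0 : 0 < h := lt_of_lt_of_le (by positivity) hh
  refine le_trans ?_ (hψ.le_weightNorm_sq hγ hH hn h0 ht)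
  gcongr
  rw [div_le_iff₀ hn'] at hh
  have h1 : 2 * (1 / (n * h)) ^ γ * ∫ x, ψ x ≤ 2 * (1 / K₁) ^ γ * ∫ x, ψ x := by
    have := hψ.integral_pos
    gcongr
    linarith
  linarith

theorem IsKernel.exists_isCalibrationConstant (hψ : IsKernel ψ) :
    ∃ K, IsCalibrationConstant ψ K := by
  obtain ⟨K₁, hK₁, h⟩ := hψ.exists_lower_bound
  have hI := hψ.integral_sq_pos
  refine ⟨max K₁ (2 / ∫ x, ψ x ^ 2), lt_max_of_lt_left hK₁, fun n hn p hp => ?_⟩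
  have hn' : (0 : ℝ) < n := by positivity
  refine le_trans ?_ (h n hn p.1 p.2 (le_trans (by gcongr; exact le_max_left _ _) hp.1.1) hp.2)
  have h1 : 2 / (∫ x, ψ x ^ 2) / n ≤ p.2 := le_trans (by gcongr; exact le_max_right _ _) hp.1.1
  rw [div_div, div_le_iff₀ (by positivity)] at h1
  rw [div_le_iff₀ hn']
  linarith

/-- On the index set of the multiscale statistic the squared weight norm is at least of order `h`. -/
theorem IsKernel.exists_le_weightNorm_sq (hψ : IsKernel ψ) {K : ℝ}
    (hK : IsCalibrationConstant ψ K) :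
    ∃ c : ℝ, 0 < c ∧ c ≤ 1 ∧ ∀ n : ℕ, 0 < n → ∀ p ∈ scaleSet n K,
      c * p.2 ≤ weightNorm ψ n p.1 p.2 ^ 2 := by
  obtain ⟨K₁, hK₁, h⟩ := hψ.exists_lower_bound
  have hI := hψ.integral_sq_pos
  refine ⟨min 1 (min ((∫ x, ψ x ^ 2) / 2) (1 / K₁)), by positivity, min_le_left _ _,
    fun n hn p hp => ?_⟩
  have hn' : (0 : ℝ) < n := by positivity
  have hp0 : 0 ≤ p.2 := le_trans (div_nonneg hK.1.le hn'.le) hp.1.1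
  rcases le_total (K₁ / n) p.2 with h1 | h1
  · refine le_trans ?_ (h n hn p.1 p.2 h1 hp.2)
    rw [mul_comm]
    gcongr
    exact (min_le_right _ _).trans (min_le_left _ _)
  -- Here `h ≤ K₁/n`, so the admissibility bound `1/n` is itself at least `h/K₁`. This is what
  -- allows an arbitrary admissible `K`, even below `K₁`.
  · refine le_trans ?_ (hK.2 n hn p hp)
    calc min 1 (min ((∫ x, ψ x ^ 2) / 2) (1 / K₁)) * p.2 ≤ 1 / K₁ * (K₁ / n) := by
          gcongr
          exact (min_le_right _ _).trans (min_le_right _ _)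
      _ = 1 / n := by field_simp


/-! ### The noise process under constant volatility -/

/-- The centred and standardized quadratic noise `∑ aₖ (n xₖ² - 1) / √2`. -/
noncomputable def noise {n : ℕ} (a x : Fin n → ℝ) : ℝ := (√2)⁻¹ * ∑ k, a k * (n * x k ^ 2 - 1)

theorem noise_sub {n : ℕ} (a b x : Fin n → ℝ) :
    noise (fun k => a k - b k) x = noise a x - noise b x := by
  simp only [noise, sub_mul, Finset.sum_sub_distrib]
  ring

instance (σ : ℝ → ℝ) (n : ℕ) : IsProbabilityMeasure (incrementLaw σ n) := by
  unfold incrementLaw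
  infer_instance

theorem quadVar_one (n : ℕ) (k : Fin n) :
    ((quadVar (fun _ => 1) ((k : ℝ) / n) (((k : ℝ) + 1) / n) : ℝ≥0) : ℝ) = 1 / n := by
  rw [quadVar, Real.coe_toNNReal']
  simp only [one_pow, intervalIntegral.integral_const, block_length, smul_eq_mul, mul_one]
  exact max_eq_left (by positivity)

theorem incrementLaw_one_noise_tail {n : ℕ} (hn : 0 < n) (a : Fin n → ℝ) {A B η : ℝ}
    (hA : 0 ≤ A) (hη : 0 ≤ η) (hAa : ∑ k, a k ^ 2 ≤ A ^ 2) (hB : ∀ k, |a k| ≤ B) (hB0 : 0 ≤ B) :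
    (incrementLaw (fun _ => 1) n).real {x | √2 * A * √η + √2 * B * η < |noise a x|}
      ≤ 2 * Real.exp (-η) := by
  have hn' : (0 : ℝ) < n := by positivity
  -- The tail bound needs `A > 0`; when `A = 0` all coefficients vanish and the event is empty.
  rcases hA.eq_or_lt with rfl | hA
  · have h0 : ∀ k, a k = 0 := fun k => by
      have := (Finset.single_le_sum (f := fun k => a k ^ 2) (fun _ _ => sq_nonneg _)
        (Finset.mem_univ k)).trans hAa
      simpa using le_antisymm (by simpa using this) (sq_nonneg (a k))
    have : {x : Fin n → ℝ | √2 * 0 * √η + √2 * B * η < |noise a x|} = ∅ := by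
      ext x
      simp only [noise, h0, zero_mul, Finset.sum_const_zero, mul_zero, zero_add, abs_zero,
        mem_ofPred_eq, mem_empty_iff_false, iff_false, not_lt]
      positivity
    rw [this]
    simp only [measureReal_empty]
    positivity
  have h2 : √2 * √2 = (2 : ℝ) := Real.mul_self_sqrt (by norm_num)
  have hs : (0 : ℝ) < √2 := by positivity
  have hv := quadVar_one n
  have e1 : ∀ k : Fin n, (√2)⁻¹ * (n * a k)
      * (quadVar (fun _ => 1) ((k : ℝ) / n) (((k : ℝ) + 1) / n) : ℝ≥0) = a k / √2 := fun k => by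
    rw [hv]
    field_simp
  have key := pi_gaussianReal_tail
    (fun k : Fin n => quadVar (fun _ => 1) ((k : ℝ) / n) (((k : ℝ) + 1) / n))
    (fun k => (√2)⁻¹ * (n * a k)) (A := A / √2) (B := B / √2) (η := η) (by positivity) hη
    (by
      simp_rw [e1, div_pow]
      rw [← Finset.sum_div]
      gcongr)
    (fun k => by
      rw [e1, abs_div, abs_of_pos hs]
      gcongr
      exact hB k) (by positivity)
  refine le_trans (le_of_eq ?_) key
  rw [incrementLaw]
  congr 1
  ext x
  have e2 : ∑ k, (√2)⁻¹ * (n * a k) * (x k ^ 2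
      - (quadVar (fun _ => 1) ((k : ℝ) / n) (((k : ℝ) + 1) / n) : ℝ≥0)) = noise a x := by
    rw [noise, Finset.mul_sum]
    refine Finset.sum_congr rfl fun k _ => ?_
    rw [hv]
    field_simp
  have e3 : ∀ y : ℝ, 2 * (y / √2) = √2 * y := fun y => by
    field_simp
    rw [Real.sq_sqrt (by norm_num), mul_comm]
  rw [mem_ofPred_eq, mem_ofPred_eq, e2, e3, e3]

/-! ### The union bound over the dyadic nets -/

/-- The first refinement level of the dyadic net used at scale `2⁻ʲ`. -/
def startLevel (p j : ℕ) : ℕ := p * (Nat.log 2 j + 1)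

/-- The starting level must be high enough that `2^(-level)` is polynomially small in `j`: this
gives summability over the scales and short links. -/
theorem pow_le_two_pow_startLevel (p j : ℕ) : (j + 1) ^ p ≤ 2 ^ startLevel p j := by
  rw [startLevel, mul_comm, pow_mul]
  exact Nat.pow_le_pow_left (Nat.lt_pow_succ_log_self (by norm_num) j) p

theorem succ_sq_le_four_mul_two_pow (L : ℕ) : (L + 1) ^ 2 ≤ 4 * 2 ^ L := by
  rcases Nat.lt_or_ge L 2 with h | h
  · interval_cases L <;> norm_num
  · induction L, h using Nat.le_induction with
    | base => norm_num
    | succ L hL ih =>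
      rw [pow_succ 2 L]
      nlinarith

/-- The starting level must also be low: as it is `O(√j)`, the square root of the exponent `j + 3d`
exceeds `√j` by `O(1)` only, so the leading constant is not affected. -/
theorem startLevel_le (p j : ℕ) : (startLevel p j : ℝ) ≤ p * (2 * √(j + 1)) := by
  rw [startLevel, Nat.cast_mul]
  gcongr
  refine abs_le_of_sq_le_sq' ?_ (by positivity) |>.2
  rw [mul_pow, Real.sq_sqrt (by positivity)]
  have h1 := succ_sq_le_four_mul_two_pow (Nat.log 2 j)
  have h2 : 2 ^ Nat.log 2 j ≤ j + 1 := by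
    rcases Nat.eq_zero_or_pos j with rfl | hj
    · simp
    · exact (Nat.pow_log_le_self 2 hj.ne').trans (Nat.le_succ j)
  have h3 : (Nat.log 2 j + 1) ^ 2 ≤ 4 * (j + 1) := by omega
  norm_num
  exact_mod_cast h3

/-- The exponents in the union bound. -/
noncomputable def netExponent (C : ℝ) (j d : ℕ) : ℝ := Real.log 2 * (j + 3 * d) + C

theorem exp_neg_netExponent (C : ℝ) (j d : ℕ) :
    Real.exp (-netExponent C j d) = Real.exp (-C) * (1 / 2) ^ (j + 3 * d) := by
  rw [netExponent, neg_add, Real.exp_add, mul_comm, ← mul_neg, Real.exp_mul,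
    Real.exp_log (by norm_num), Real.rpow_neg (by norm_num), one_div, inv_pow]
  congr 2
  exact_mod_cast Real.rpow_natCast 2 (j + 3 * d)

/-- Level `d` has `16 · 2^(j+2d)` points against a probability `2 exp(-C) 2^(-(j+3d))` each, in
total `32 exp(-C) 2^(-d)`. With `d = startLevel p j + e` this is at most a constant times `(j+1)⁻²
2^(-e)`. The additional 2 in the ranges makes room for indices one level finer, where the fine ends
of the links sit. -/
theorem measure_iUnion_net_le {Ω : Type*} [MeasurableSpace Ω] (μ : Measure Ω) {p : ℕ} (hp : 2 ≤ p)
    (C : ℝ) (B : ℕ → ℕ → ℕ → ℕ → Set Ω)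
    (hB : ∀ j e i l, i < 2 ^ (j + (startLevel p j + e) + 2) → l < 2 ^ (startLevel p j + e + 2) →
      μ (B j e i l) ≤ ENNReal.ofReal (2 * Real.exp (-netExponent C j (startLevel p j + e)))) :
    μ (⋃ j, ⋃ e, ⋃ i ∈ Finset.range (2 ^ (j + (startLevel p j + e) + 2)),
        ⋃ l ∈ Finset.range (2 ^ (startLevel p j + e + 2)), B j e i l)
      ≤ ENNReal.ofReal (64 * Real.exp (-C) * ∑' j : ℕ, 1 / ((j : ℝ) + 1) ^ 2) := by
  have hsum : Summable fun j : ℕ => 1 / ((j : ℝ) + 1) ^ 2 := by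
    have := (summable_nat_add_iff 1).2 (Real.summable_one_div_nat_pow (p := 2) |>.2 one_lt_two)
    simpa using this
  have h1 : ∀ j e, μ (⋃ i ∈ Finset.range (2 ^ (j + (startLevel p j + e) + 2)),
        ⋃ l ∈ Finset.range (2 ^ (startLevel p j + e + 2)), B j e i l)
      ≤ ENNReal.ofReal (32 * Real.exp (-C) * (1 / ((j : ℝ) + 1) ^ 2) * (1 / 2) ^ e) := by
    intro j e
    set d := startLevel p j + e with hd
    calc μ (⋃ i ∈ Finset.range (2 ^ (j + d + 2)), ⋃ l ∈ Finset.range (2 ^ (d + 2)), B j e i l)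
        ≤ ∑ i ∈ Finset.range (2 ^ (j + d + 2)), ∑ l ∈ Finset.range (2 ^ (d + 2)),
            μ (B j e i l) :=
          (measure_biUnion_finset_le _ _).trans
            (Finset.sum_le_sum fun i _ => measure_biUnion_finset_le _ _)
      _ ≤ ∑ i ∈ Finset.range (2 ^ (j + d + 2)), ∑ l ∈ Finset.range (2 ^ (d + 2)),
            ENNReal.ofReal (2 * Real.exp (-netExponent C j d)) :=
          Finset.sum_le_sum fun i hi => Finset.sum_le_sum fun l hl =>
            hB j e i l (Finset.mem_range.1 hi) (Finset.mem_range.1 hl)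
      _ = ENNReal.ofReal (32 * Real.exp (-C) * (1 / 2) ^ d) := by
          simp only [Finset.sum_const, Finset.card_range, nsmul_eq_mul]
          rw [← ENNReal.ofReal_natCast, ← ENNReal.ofReal_natCast,
            ← ENNReal.ofReal_mul (by positivity), ← ENNReal.ofReal_mul (by positivity),
            exp_neg_netExponent]
          congr 1
          push_cast
          have : ((1 : ℝ) / 2) ^ (j + 3 * d) = (1 / 2) ^ j * ((1 / 2) ^ d * (1 / 2) ^ d * (1 / 2) ^ d) := by
            rw [pow_add, mul_comm 3 d, pow_mul]
            ring
          rw [this, pow_add, pow_add, pow_add]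
          have h2 : ∀ m : ℕ, (2 : ℝ) ^ m * (1 / 2) ^ m = 1 := fun m => by
            rw [← mul_pow]
            norm_num
          linear_combination (32 * Real.exp (-C) * (1 / 2) ^ d * (2 ^ d * (1 / 2) ^ d) ^ 2) * h2 j
            + (32 * Real.exp (-C) * (1 / 2) ^ d) * (2 ^ d * (1 / 2) ^ d + 1) * h2 d
      _ ≤ _ := by
          refine ENNReal.ofReal_le_ofReal ?_
          rw [hd, pow_add, mul_assoc _ (1 / ((j : ℝ) + 1) ^ 2)]
          gcongr
          rw [one_div, inv_pow, one_div]
          have h3 : ((j : ℝ) + 1) ^ 2 ≤ 2 ^ startLevel p j := by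
            have := (Nat.pow_le_pow_right (Nat.succ_pos j) hp).trans
              (pow_le_two_pow_startLevel p j)
            exact_mod_cast this
          exact inv_anti₀ (by positivity) h3
  have h2 : ∀ j, μ (⋃ e, ⋃ i ∈ Finset.range (2 ^ (j + (startLevel p j + e) + 2)),
        ⋃ l ∈ Finset.range (2 ^ (startLevel p j + e + 2)), B j e i l)
      ≤ ENNReal.ofReal (64 * Real.exp (-C) * (1 / ((j : ℝ) + 1) ^ 2)) := by
    intro j
    refine (measure_iUnion_le _).trans ((ENNReal.tsum_le_tsum (h1 j)).trans ?_)
    rw [← ENNReal.ofReal_tsum_of_nonneg (fun e => by positivity)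
      (summable_geometric_two.mul_left _), tsum_mul_left, tsum_geometric_two]
    refine ENNReal.ofReal_le_ofReal (le_of_eq (by ring))
  refine (measure_iUnion_le _).trans ((ENNReal.tsum_le_tsum h2).trans ?_)
  rw [← ENNReal.ofReal_tsum_of_nonneg (fun e => by positivity) (hsum.mul_left _), tsum_mul_left]


/-! ### The chaining event -/

/-- The weights at a point of the dyadic net of mesh `2⁻ᵐ`. -/
noncomputable def netWeight (ψ : ℝ → ℝ) (n m i l : ℕ) : Fin n → ℝ :=
  weight ψ n ((i : ℝ) / 2 ^ m) ((l : ℝ) / 2 ^ m)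

/-- The modulus of continuity of the kernel at relative distance `4 / 2ᵈ`. -/
noncomputable def netModulus (γ : ℝ) (d : ℕ) : ℝ := (4 / 2 ^ d) ^ γ

theorem netModulus_nonneg (γ : ℝ) (d : ℕ) : 0 ≤ netModulus γ d := by
  unfold netModulus
  positivity

/-- The event that the noise is controlled at the coarsest points and along all links of the
dyadic nets. -/
structure IsControlled (ψ : ℝ → ℝ) (γ : ℝ) (p : ℕ) (C : ℝ) {n : ℕ} (x : Fin n → ℝ) : Prop where
  coarse : ∀ j i l, i ≤ 2 ^ (j + startLevel p j) → l ≤ 2 ^ startLevel p j →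
    |noise (netWeight ψ n (j + startLevel p j) i l) x|
      ≤ √2 * weightNorm ψ n ((i : ℝ) / 2 ^ (j + startLevel p j)) ((l : ℝ) / 2 ^ (j + startLevel p j))
          * √(netExponent C j (startLevel p j))
        + √2 * (1 / √n) * netExponent C j (startLevel p j)
  link : ∀ j e i l, i ≤ 2 ^ (j + (startLevel p j + e) + 1) → 2 ^ (startLevel p j + e) ≤ l →
    l ≤ 2 ^ (startLevel p j + e + 1) →
    |noise (netWeight ψ n (j + (startLevel p j + e) + 1) i l) x
        - noise (netWeight ψ n (j + (startLevel p j + e)) (i / 2) (l / 2)) x|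
      ≤ √2 * (netModulus γ (startLevel p j + e) * (2 * √((1 / 2) ^ j)))
          * √(netExponent C j (startLevel p j + e))
        + √2 * (netModulus γ (startLevel p j + e) / √n) * netExponent C j (startLevel p j + e)

theorem netExponent_nonneg {C : ℝ} (hC : 0 ≤ C) (j d : ℕ) : 0 ≤ netExponent C j d := by
  have := Real.log_nonneg (one_le_two (α := ℝ))
  unfold netExponent
  positivity

theorem abs_div_two_pow_sub_le (m i : ℕ) :
    |(i : ℝ) / 2 ^ (m + 1) - ((i / 2 : ℕ) : ℝ) / 2 ^ m| ≤ 1 / 2 ^ (m + 1) := by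
  have h1 : i = 2 * (i / 2) + i % 2 := (Nat.div_add_mod i 2).symm
  have h2 : (i : ℝ) = 2 * ((i / 2 : ℕ) : ℝ) + ((i % 2 : ℕ) : ℝ) := by exact_mod_cast h1
  have h3 : (i : ℝ) / 2 ^ (m + 1) - ((i / 2 : ℕ) : ℝ) / 2 ^ m = ((i % 2 : ℕ) : ℝ) / 2 ^ (m + 1) := by
    rw [h2, pow_succ]
    field_simp
    ring
  rw [h3, abs_of_nonneg (by positivity)]
  gcongr
  have : i % 2 ≤ 1 := by omega
  exact_mod_cast this

theorem link_distance_le {j d i l : ℕ} :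
    (|(i : ℝ) / 2 ^ (j + d + 1) - ((i / 2 : ℕ) : ℝ) / 2 ^ (j + d)|
      + |(l : ℝ) / 2 ^ (j + d + 1) - ((l / 2 : ℕ) : ℝ) / 2 ^ (j + d)|) / (1 / 2) ^ (j + 1)
      ≤ 4 / 2 ^ d := by
  rw [div_le_iff₀ (by positivity)]
  refine (add_le_add (abs_div_two_pow_sub_le _ _) (abs_div_two_pow_sub_le _ _)).trans ?_
  rw [one_div_pow, pow_succ, pow_add, pow_succ]
  have : (0 : ℝ) < 2 ^ d := by positivity
  have : (0 : ℝ) < 2 ^ j := by positivity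
  field_simp
  norm_num

/-- The slack `2 * l + 1` absorbs the parity lost when an index is halved. -/
theorem half_pow_le_div {j d l : ℕ} (hl : 2 ^ d ≤ 2 * l + 1) (hd : 1 ≤ d) :
    ((1 : ℝ) / 2) ^ (j + 1) ≤ (l : ℝ) / 2 ^ (j + d) := by
  obtain ⟨d, rfl⟩ := Nat.exists_eq_add_of_le' hd
  have h1 : 2 ^ d ≤ l := by
    rw [pow_succ] at hl
    omega
  have h2 : (2 : ℝ) ^ d ≤ l := by exact_mod_cast h1
  rw [le_div_iff₀ (by positivity), one_div_pow, show j + (d + 1) = j + 1 + d by ring,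
    pow_add (2 : ℝ) (j + 1) d, ← mul_assoc, one_div, inv_mul_cancel₀ (by positivity), one_mul]
  exact h2

theorem one_le_startLevel {p : ℕ} (hp : 1 ≤ p) (j : ℕ) : 1 ≤ startLevel p j :=
  Nat.mul_pos hp (Nat.succ_pos _)

theorem IsKernel.prob_isControlled (hψ : IsKernel ψ) {γ : ℝ} (hγ : 0 < γ)
    (hH : ∀ x y, |ψ x - ψ y| ≤ |x - y| ^ γ) {p : ℕ} (hp : 2 ≤ p) {n : ℕ} (hn : 0 < n) {C : ℝ}
    (hC : 0 ≤ C) :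
    1 - 128 * Real.exp (-C) * ∑' j : ℕ, 1 / ((j : ℝ) + 1) ^ 2
      ≤ (incrementLaw (fun _ => 1) n).real {x | IsControlled ψ γ p C x} := by
  set μ := incrementLaw (fun _ => 1) n with hμ
  set S := ∑' j : ℕ, 1 / ((j : ℝ) + 1) ^ 2 with hS
  have hS0 : 0 ≤ S := tsum_nonneg fun j => by positivity
  have toENN : ∀ {s : Set (Fin n → ℝ)} {r : ℝ}, μ.real s ≤ r → μ s ≤ ENNReal.ofReal r :=
    fun {s r} h => by
      rw [← ofReal_measureReal (measure_ne_top _ _)]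
      exact ENNReal.ofReal_le_ofReal h
  -- Only `e = 0` is needed for the coarse points; keeping all `e` lets one union bound serve both
  -- families.
  let B₁ : ℕ → ℕ → ℕ → ℕ → Set (Fin n → ℝ) := fun j e i l =>
    {x | √2 * weightNorm ψ n ((i : ℝ) / 2 ^ (j + (startLevel p j + e)))
            ((l : ℝ) / 2 ^ (j + (startLevel p j + e)))
          * √(netExponent C j (startLevel p j + e))
        + √2 * (1 / √n) * netExponent C j (startLevel p j + e)
      < |noise (netWeight ψ n (j + (startLevel p j + e)) i l) x|}
  -- The restriction on `l` confines the scale to `[2⁻ʲ⁻¹, 2⁻ʲ]`, where the modulus estimates hold;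
  -- for other `l` the event is empty.
  let B₂ : ℕ → ℕ → ℕ → ℕ → Set (Fin n → ℝ) := fun j e i l =>
    {x | 2 ^ (startLevel p j + e) ≤ l ∧ l ≤ 2 ^ (startLevel p j + e + 1) ∧
      √2 * (netModulus γ (startLevel p j + e) * (2 * √((1 / 2) ^ j)))
          * √(netExponent C j (startLevel p j + e))
        + √2 * (netModulus γ (startLevel p j + e) / √n) * netExponent C j (startLevel p j + e)
      < |noise (fun k => netWeight ψ n (j + (startLevel p j + e) + 1) i l k
          - netWeight ψ n (j + (startLevel p j + e)) (i / 2) (l / 2) k) x|}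
  have h₁ := measure_iUnion_net_le μ hp C B₁ fun j e i l _ _ => toENN <|
    incrementLaw_one_noise_tail hn _ (weightNorm_nonneg _ _ _ _) (netExponent_nonneg hC _ _)
      (weightNorm_sq _ _ _ _).ge
      (fun k => by
        rw [netWeight, abs_of_nonneg (hψ.weight_nonneg _ _ _ _)]
        exact hψ.weight_le _ _ _ _) (by positivity)
  have h₂ := measure_iUnion_net_le μ hp C B₂ fun j e i l _ _ => toENN <| by
    set d := startLevel p j + e with hd
    have hd1 : 1 ≤ d := (one_le_startLevel (by omega) j).trans (Nat.le_add_right _ _)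
    by_cases hl : 2 ^ d ≤ l ∧ l ≤ 2 ^ (d + 1)
    · have hl1 : ((1 : ℝ) / 2) ^ (j + 1) ≤ (l : ℝ) / 2 ^ (j + d + 1) :=
        half_pow_le_div (d := d + 1) (by rw [pow_succ]; omega) (by omega)
      have hl2 : ((1 : ℝ) / 2) ^ (j + 1) ≤ ((l / 2 : ℕ) : ℝ) / 2 ^ (j + d) :=
        half_pow_le_div (d := d) (by omega) hd1
      have hu1 : (l : ℝ) / 2 ^ (j + d + 1) ≤ (1 / 2) ^ j := by
        rw [div_le_iff₀ (by positivity), one_div_pow, add_assoc, pow_add, ← mul_assoc, one_div,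
          inv_mul_cancel₀ (by positivity), one_mul]
        exact_mod_cast hl.2
      have hu2 : ((l / 2 : ℕ) : ℝ) / 2 ^ (j + d) ≤ (1 / 2) ^ j := by
        rw [div_le_iff₀ (by positivity), one_div_pow, pow_add, ← mul_assoc, one_div,
          inv_mul_cancel₀ (by positivity), one_mul]
        have : l / 2 ≤ 2 ^ d := by
          have := hl.2
          rw [pow_succ] at this
          omega
        exact_mod_cast this
      have hdist := link_distance_le (j := j) (d := d) (i := i) (l := l)
      refine le_trans (measureReal_mono fun x hx => hx.2.2) (incrementLaw_one_noise_tail hn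
        (fun k => netWeight ψ n (j + d + 1) i l k - netWeight ψ n (j + d) (i / 2) (l / 2) k)
        (mul_nonneg (netModulus_nonneg _ _) (by positivity)) (netExponent_nonneg hC _ _) ?_ ?_
        (div_nonneg (netModulus_nonneg _ _) (by positivity)))
      · refine (hψ.sum_sq_weight_sub_le hγ hH hn (by positivity) hl1 hl2).trans ?_
        rw [mul_pow, mul_pow, Real.sq_sqrt (by positivity), netModulus]
        gcongr
        linarith
      · intro k
        refine (hψ.abs_weight_sub_le hγ hH n (by positivity) hl1 hl2 k).trans ?_
        rw [netModulus]
        gcongr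
    · have : B₂ j e i l = ∅ := by
        ext x
        simp only [B₂, mem_ofPred_eq, mem_empty_iff_false, iff_false, ← hd]
        exact fun h => hl ⟨h.1, h.2.1⟩
      rw [this, measureReal_empty]
      positivity
  have toReal : ∀ {s : Set (Fin n → ℝ)} {r : ℝ}, 0 ≤ r → μ s ≤ ENNReal.ofReal r → μ.real s ≤ r :=
    fun hr h => ENNReal.toReal_le_of_le_ofReal hr h
  have h₁' := toReal (by positivity) h₁
  have h₂' := toReal (by positivity) h₂
  have hcompl : {x | IsControlled ψ γ p C x}ᶜ ⊆
      (⋃ j, ⋃ e, ⋃ i ∈ Finset.range (2 ^ (j + (startLevel p j + e) + 2)),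
        ⋃ l ∈ Finset.range (2 ^ (startLevel p j + e + 2)), B₁ j e i l) ∪
      (⋃ j, ⋃ e, ⋃ i ∈ Finset.range (2 ^ (j + (startLevel p j + e) + 2)),
        ⋃ l ∈ Finset.range (2 ^ (startLevel p j + e + 2)), B₂ j e i l) := by
    intro x hx
    by_contra hx'
    rw [mem_union, not_or] at hx'
    simp only [mem_iUnion, not_exists, Finset.mem_range] at hx'
    refine hx ⟨fun j i l hi hl => ?_, fun j e i l hi hl hl' => ?_⟩
    · have := hx'.1 j 0 i (hi.trans_lt (Nat.pow_lt_pow_right (by norm_num) (by omega))) l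
        (hl.trans_lt (Nat.pow_lt_pow_right (by norm_num) (by omega)))
      simpa [B₁] using this
    · have := hx'.2 j e i (hi.trans_lt (Nat.pow_lt_pow_right (by norm_num) (by omega))) l
        (hl'.trans_lt (Nat.pow_lt_pow_right (by norm_num) (by omega)))
      simp only [B₂, mem_ofPred_eq, hl, hl', true_and, not_lt] at this
      rw [← noise_sub]
      exact this
  have h3 := (measureReal_mono (μ := μ) hcompl).trans (measureReal_union_le _ _)
  -- Subadditivity suffices, so measurability of the event is not needed.
  have h4 : 1 ≤ μ.real {x | IsControlled ψ γ p C x} + μ.real {x | IsControlled ψ γ p C x}ᶜ := by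
    have := measureReal_union_le (μ := μ) {x | IsControlled ψ γ p C x}
      {x | IsControlled ψ γ p C x}ᶜ
    rwa [union_compl_self, probReal_univ] at this
  linarith


/-! ### Chaining -/

theorem sqrt_le_one_add {y : ℝ} (hy : 0 ≤ y) : √y ≤ 1 + y := by
  nlinarith [Real.sq_sqrt hy, Real.sqrt_nonneg y, sq_nonneg (√y - 1)]

theorem netExponent_le {C a : ℝ} (hC : 0 ≤ C) (ha : 0 ≤ a) {j d e : ℕ}
    (hd : (d : ℝ) ≤ a * √(j + 1)) :
    netExponent C j (d + e) ≤ (j + 1) * (1 + 3 * a + C + 3 * e) := by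
  have h1 : √((j : ℝ) + 1) ≤ j + 1 := by
    rw [Real.sqrt_le_left (by positivity)]
    nlinarith [(Nat.cast_nonneg j : (0 : ℝ) ≤ j)]
  have h2 : Real.log 2 ≤ 1 := by linarith [Real.log_two_lt_d9]
  have h3 : (0 : ℝ) ≤ j := Nat.cast_nonneg j
  have h4 : a * √((j : ℝ) + 1) ≤ a * (j + 1) := by gcongr
  have h5 : Real.log 2 * ((j : ℝ) + 3 * ((d + e : ℕ) : ℝ)) ≤ 1 * ((j : ℝ) + 3 * ((d + e : ℕ) : ℝ)) := by
    gcongr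
  have h6 : (0 : ℝ) ≤ e := Nat.cast_nonneg e
  rw [netExponent]
  push_cast at h5 ⊢
  nlinarith [mul_nonneg h3 hC, mul_nonneg h3 h6]

/-- Comparison of the deviation at the coarsest net point with the correction term. -/
theorem coarse_bound_le {η₀ C a C₁ N : ℝ} (hη₀ : 0 ≤ η₀) (hC : 0 ≤ C) (ha : 0 ≤ a) (hC₁ : 0 ≤ C₁)
    (hN : 1 ≤ N) {j d : ℕ} (hj : Real.log 2 * (j - 1) ≤ η₀) (hd : (d : ℝ) ≤ a * √(j + 1)) :
    √2 * (1 + C₁ / (j + 1)) * √(netExponent C j d) + √2 * netExponent C j d / N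
      ≤ √(2 * η₀) + 2 * η₀ / N
        + (2 * (2 + 6 * a + C) + 2 * C₁ * (2 + 3 * a + C) + 1 / 2 + (1 + 6 * a + C) ^ 2) := by
  set η := netExponent C j d with hη
  have hη0 : 0 ≤ η := netExponent_nonneg hC j d
  set R := 1 + 6 * a + C with hR
  have hR0 : 0 ≤ R := by positivity
  set y := √(η₀ + 1) with hy
  have hy2 : y ^ 2 = η₀ + 1 := Real.sq_sqrt (by linarith)
  have hy1 : 1 ≤ y := Real.one_le_sqrt.2 (by linarith)
  have hl2 : Real.log 2 ≤ 1 := by linarith [Real.log_two_lt_d9]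
  have hl1 : 1 / 2 ≤ Real.log 2 := by linarith [Real.log_two_gt_d9]
  have hj0 : (0 : ℝ) ≤ j := Nat.cast_nonneg j
  have hJ : (j : ℝ) + 1 ≤ 2 * η₀ + 2 := by
    by_contra h
    push Not at h
    nlinarith
  have hJy : √((j : ℝ) + 1) ≤ 2 * y := by
    rw [Real.sqrt_le_left (by positivity)]
    nlinarith
  -- Since `j + 1 ≤ 2η₀ + 2` and `d = O(√(j+1))`, the exponent exceeds `η₀` by `O(√(η₀ + 1))`, which
  -- becomes `O(1)` after taking square roots.
  have hηR : η ≤ η₀ + R * y := by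
    have h1 : (d : ℝ) ≤ a * (2 * y) := hd.trans (by gcongr)
    have h2 : Real.log 2 * (3 * (d : ℝ)) ≤ 1 * (3 * (d : ℝ)) := by gcongr
    rw [hη, netExponent, hR]
    nlinarith
  have hs2 : √2 ≤ (2 : ℝ) := by
    rw [Real.sqrt_le_left (by norm_num)]
    norm_num
  have hs2' : √2 ≤ (3 / 2 : ℝ) := by
    rw [Real.sqrt_le_left (by norm_num)]
    norm_num
  have hsq : √η ≤ √η₀ + (R + 1) := by
    have h0 := Real.sqrt_nonneg η₀
    have h1 := Real.sq_sqrt hη₀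
    have h2 : y ≤ √η₀ + 1 := by
      rw [hy, Real.sqrt_le_left (by positivity)]
      nlinarith
    rw [Real.sqrt_le_left (by positivity)]
    nlinarith
  have hfirst : √2 * √η ≤ √(2 * η₀) + 2 * (R + 1) := by
    rw [Real.sqrt_mul (by norm_num)]
    have h0 := Real.sqrt_nonneg (2 : ℝ)
    calc √2 * √η ≤ √2 * (√η₀ + (R + 1)) := by gcongr
      _ = √2 * √η₀ + √2 * (R + 1) := by ring
      _ ≤ √2 * √η₀ + 2 * (R + 1) := by gcongr
  have hsecond : √2 * (C₁ / (j + 1)) * √η ≤ 2 * C₁ * (2 + 3 * a + C) := by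
    have h1 := netExponent_le (e := 0) hC ha hd
    simp only [add_zero, Nat.cast_zero, mul_zero] at h1
    have h2 : √η ≤ (j + 1) * (2 + 3 * a + C) := by
      refine (sqrt_le_one_add hη0).trans ?_
      nlinarith
    calc √2 * (C₁ / (j + 1)) * √η ≤ 2 * (C₁ / (j + 1)) * ((j + 1) * (2 + 3 * a + C)) := by gcongr
      _ = 2 * C₁ * (2 + 3 * a + C) := by field_simp
  -- The gap between `√2` and the factor 2 in the correction absorbs the term of order `√(η₀ + 1)`.
  have hthird : √2 * η / N ≤ 2 * η₀ / N + (1 / 2 + R ^ 2) := by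
    have h1 : √2 * η ≤ 2 * η₀ + (1 / 2 + R ^ 2) := by
      have h2 : √2 * η ≤ √2 * η₀ + √2 * (R * y) := by
        rw [← mul_add]
        gcongr
      have h3 : √2 * η₀ ≤ 3 / 2 * η₀ := by gcongr
      have h4 : √2 * (R * y) ≤ y ^ 2 / 2 + R ^ 2 := by
        have := sq_nonneg (y - √2 * R)
        nlinarith [Real.sq_sqrt (by norm_num : (0 : ℝ) ≤ 2)]
      nlinarith
    calc √2 * η / N ≤ (2 * η₀ + (1 / 2 + R ^ 2)) / N := by gcongr
      _ = 2 * η₀ / N + (1 / 2 + R ^ 2) / N := by ring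
      _ ≤ _ := by
          gcongr
          exact div_le_self (by positivity) hN
  calc √2 * (1 + C₁ / (j + 1)) * √η + √2 * η / N
      = √2 * √η + √2 * (C₁ / (j + 1)) * √η + √2 * η / N := by ring
    _ ≤ _ := by
        rw [hR] at hfirst hthird
        linarith

/-- As `p γ ≥ 1`, the Hölder modulus at the starting level is `O(1/(j+1))`. This cancels the growth
of the exponent, which is linear in `j + 1`. -/
theorem netModulus_startLevel_le {γ : ℝ} (hγ : 0 < γ) (hγ1 : γ ≤ 1) {p : ℕ} (hp : 1 ≤ p * γ)
    (j e : ℕ) :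
    netModulus γ (startLevel p j + e) ≤ 4 / (j + 1) * ((1 / 2 : ℝ) ^ γ) ^ e := by
  have h1 : (4 : ℝ) / 2 ^ (startLevel p j + e) = 4 * (1 / 2 ^ startLevel p j) * (1 / 2) ^ e := by
    rw [pow_add, one_div_pow]
    field_simp
  rw [netModulus, h1, Real.mul_rpow (by positivity) (by positivity),
    Real.mul_rpow (by positivity) (by positivity), ← Real.rpow_natCast_mul (by norm_num),
    mul_comm (e : ℝ) γ, Real.rpow_mul_natCast (by norm_num)]
  gcongr
  rw [div_eq_mul_inv (4 : ℝ)]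
  gcongr
  · calc (4 : ℝ) ^ γ ≤ 4 ^ (1 : ℝ) := Real.rpow_le_rpow_of_exponent_le (by norm_num) hγ1
      _ = 4 := Real.rpow_one 4
  · rw [one_div, Real.inv_rpow (by positivity)]
    refine inv_anti₀ (by positivity) ?_
    have h2 : ((j : ℝ) + 1) ^ p ≤ 2 ^ startLevel p j := by
      exact_mod_cast pow_le_two_pow_startLevel p j
    calc (j : ℝ) + 1 = ((j : ℝ) + 1) ^ (1 : ℝ) := (Real.rpow_one _).symm
      _ ≤ ((j : ℝ) + 1) ^ (p * γ) :=
          Real.rpow_le_rpow_of_exponent_le (by linarith [(Nat.cast_nonneg j : (0 : ℝ) ≤ j)]) hp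
      _ = (((j : ℝ) + 1) ^ p) ^ γ := by rw [Real.rpow_natCast_mul (by positivity)]
      _ ≤ _ := Real.rpow_le_rpow (by positivity) h2 hγ.le

/-- The halved index of the net point below `(t,h)` is the index at the next coarser level, so the
links telescope. -/
theorem floor_mul_two_pow_succ_div_two (t : ℝ) (m : ℕ) :
    ⌊t * 2 ^ (m + 1)⌋₊ / 2 = ⌊t * 2 ^ m⌋₊ := by
  have := Nat.floor_div_natCast (t * 2 ^ (m + 1)) 2
  rw [← this, pow_succ]
  congr 1
  push_cast
  ring

theorem abs_sub_floor_div_le {t : ℝ} (ht : 0 ≤ t) (m : ℕ) :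
    |t - (⌊t * 2 ^ m⌋₊ : ℝ) / 2 ^ m| ≤ 1 / 2 ^ m := by
  have h0 : (0 : ℝ) < 2 ^ m := by positivity
  have h1 := Nat.floor_le (a := t * 2 ^ m) (by positivity)
  have h2 := Nat.lt_floor_add_one (t * 2 ^ m)
  have h3 : t - (⌊t * 2 ^ m⌋₊ : ℝ) / 2 ^ m = (t * 2 ^ m - ⌊t * 2 ^ m⌋₊) / 2 ^ m := by
    field_simp
  rw [h3, abs_div, abs_of_pos h0, abs_of_nonneg (by linarith)]
  gcongr
  linarith

/-- Triangle inequality in Euclidean space. -/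
theorem weightNorm_le_add {n : ℕ} {t h t' h' r : ℝ} (hr : 0 ≤ r)
    (hs : ∑ k, (weight ψ n t h k - weight ψ n t' h' k) ^ 2 ≤ r ^ 2) :
    weightNorm ψ n t h ≤ weightNorm ψ n t' h' + r := by
  have e : ∀ a : Fin n → ℝ, √(∑ k, a k ^ 2) = ‖(WithLp.toLp 2 a : EuclideanSpace ℝ (Fin n))‖ :=
    fun a => by simp [EuclideanSpace.norm_eq]
  have h1 : √(∑ k, (weight ψ n t h k - weight ψ n t' h' k) ^ 2) ≤ r := by
    rw [Real.sqrt_le_left hr]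
    exact hs
  rw [e] at h1
  rw [weightNorm, weightNorm, e, e]
  have h2 := norm_le_norm_add_norm_sub
    (WithLp.toLp 2 (weight ψ n t' h') : EuclideanSpace ℝ (Fin n)) (WithLp.toLp 2 (weight ψ n t h))
  rw [norm_sub_rev] at h2
  refine h2.trans (add_le_add le_rfl (le_trans (le_of_eq ?_) h1))
  congr 1

/-! ### Net points approximating a given location and scale -/

section NetPoints

variable {t h : ℝ} {j : ℕ}

theorem floor_scale_mem (hh : (1 / 2 : ℝ) ^ (j + 1) < h) (hh' : h ≤ (1 / 2) ^ j) {d : ℕ}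
    (hd : 1 ≤ d) : 2 ^ (d - 1) ≤ ⌊h * 2 ^ (j + d)⌋₊ ∧ ⌊h * 2 ^ (j + d)⌋₊ ≤ 2 ^ d := by
  obtain ⟨d, rfl⟩ := Nat.exists_eq_add_of_le' hd
  have e1 : ((1 : ℝ) / 2) ^ (j + 1) * 2 ^ (j + (d + 1)) = 2 ^ d := by
    rw [show j + (d + 1) = j + 1 + d by ring, pow_add 2 (j + 1) d, ← mul_assoc, ← mul_pow]
    norm_num
  have e2 : ((1 : ℝ) / 2) ^ j * 2 ^ (j + (d + 1)) = 2 ^ (d + 1) := by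
    rw [pow_add 2 j, ← mul_assoc, ← mul_pow]
    norm_num
  constructor
  · refine Nat.le_floor ?_
    push_cast
    rw [← e1]
    gcongr
  · refine Nat.floor_le_of_le ?_
    push_cast
    rw [← e2]
    gcongr

theorem half_pow_le_net (hh : (1 / 2 : ℝ) ^ (j + 1) < h) (hh' : h ≤ (1 / 2) ^ j) {d : ℕ}
    (hd : 1 ≤ d) : (1 / 2 : ℝ) ^ (j + 1) ≤ (⌊h * 2 ^ (j + d)⌋₊ : ℝ) / 2 ^ (j + d) := by
  refine half_pow_le_div ?_ hd
  have := (floor_scale_mem hh hh' hd).1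
  obtain ⟨d, rfl⟩ := Nat.exists_eq_add_of_le' hd
  rw [Nat.add_sub_cancel] at this
  rw [pow_succ]
  omega

theorem net_distance_le (ht : 0 ≤ t) (h0 : 0 ≤ h) (d : ℕ) :
    (|t - (⌊t * 2 ^ (j + d)⌋₊ : ℝ) / 2 ^ (j + d)| + |h - (⌊h * 2 ^ (j + d)⌋₊ : ℝ) / 2 ^ (j + d)|)
      / (1 / 2) ^ (j + 1) ≤ 4 / 2 ^ d := by
  rw [div_le_iff₀ (by positivity)]
  refine (add_le_add (abs_sub_floor_div_le ht _) (abs_sub_floor_div_le h0 _)).trans ?_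
  rw [one_div_pow, pow_succ, pow_add]
  have : (0 : ℝ) < 2 ^ d := by positivity
  have : (0 : ℝ) < 2 ^ j := by positivity
  field_simp
  norm_num

theorem floor_le_two_pow (ht1 : t ≤ 1) (m : ℕ) : ⌊t * 2 ^ m⌋₊ ≤ 2 ^ m := by
  refine Nat.floor_le_of_le ?_
  push_cast
  have : (0 : ℝ) < 2 ^ m := by positivity
  nlinarith

/-- The noise at a general point is bounded by the noise at the coarsest net point and the
bounds along the links. -/
theorem IsControlled.abs_noise_le (hψ : IsKernel ψ) {γ : ℝ} (hγ : 0 < γ)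
    (hH : ∀ x y, |ψ x - ψ y| ≤ |x - y| ^ γ) {p : ℕ} (hp : 1 ≤ p) {C : ℝ} {n : ℕ}
    {x : Fin n → ℝ} (hx : IsControlled ψ γ p C x) (ht : t ∈ Icc (0 : ℝ) 1)
    (hh : (1 / 2 : ℝ) ^ (j + 1) < h) (hh' : h ≤ (1 / 2) ^ j) {T : ℝ}
    (hT : ∀ E, ∑ e ∈ Finset.range E,
      (√2 * (netModulus γ (startLevel p j + e) * (2 * √((1 / 2) ^ j)))
          * √(netExponent C j (startLevel p j + e))
        + √2 * (netModulus γ (startLevel p j + e) / √n)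
          * netExponent C j (startLevel p j + e)) ≤ T) :
    |noise (weight ψ n t h) x|
      ≤ |noise (netWeight ψ n (j + startLevel p j) ⌊t * 2 ^ (j + startLevel p j)⌋₊
          ⌊h * 2 ^ (j + startLevel p j)⌋₊) x| + T := by
  set D := startLevel p j with hD
  have hD1 : 1 ≤ D := one_le_startLevel hp j
  have h0 : 0 < h := lt_trans (by positivity) hh
  let w : ℕ → Fin n → ℝ := fun e =>
    netWeight ψ n (j + (D + e)) ⌊t * 2 ^ (j + (D + e))⌋₊ ⌊h * 2 ^ (j + (D + e))⌋₊
  have hchain : ∀ E, |noise (w E) x| ≤ |noise (w 0) x| + ∑ e ∈ Finset.range E,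
      (√2 * (netModulus γ (D + e) * (2 * √((1 / 2) ^ j))) * √(netExponent C j (D + e))
        + √2 * (netModulus γ (D + e) / √n) * netExponent C j (D + e)) := by
    intro E
    induction E with
    | zero => simp
    | succ E ih =>
      rw [Finset.sum_range_succ]
      have hfl := floor_scale_mem hh hh' (d := D + E + 1) (by omega)
      have h1 := hx.link j E ⌊t * 2 ^ (j + (D + E) + 1)⌋₊ ⌊h * 2 ^ (j + (D + E) + 1)⌋₊
        (floor_le_two_pow ht.2 _) hfl.1 hfl.2
      rw [floor_mul_two_pow_succ_div_two, floor_mul_two_pow_succ_div_two] at h1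
      have h2 : |noise (w (E + 1)) x| ≤ |noise (w E) x| + |noise (w (E + 1)) x - noise (w E) x| := by
        have := abs_add_le (noise (w E) x) (noise (w (E + 1)) x - noise (w E) x)
        rwa [add_sub_cancel] at this
      have h3 : |noise (w (E + 1)) x - noise (w E) x| ≤ _ := h1
      linarith
  -- For fixed `x` the noise is a finite sum that is affine in each weight, so convergence of the
  -- weights along the net points is enough.
  have hlim : Tendsto (fun E => |noise (w E) x|) atTop (𝓝 |noise (weight ψ n t h) x|) := by
    refine Tendsto.abs ?_
    refine Tendsto.const_mul _ (tendsto_finsetSum _ fun k _ => Tendsto.mul_const _ ?_)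
    rw [tendsto_iff_dist_tendsto_zero]
    have h4 : Tendsto (fun E : ℕ => (4 * (1 / 2 : ℝ) ^ E) ^ γ / √n) atTop (𝓝 0) := by
      have h5 : Tendsto (fun E : ℕ => 4 * (1 / 2 : ℝ) ^ E) atTop (𝓝 0) := by
        simpa using (tendsto_pow_atTop_nhds_zero_of_lt_one (r := (1 / 2 : ℝ)) (by norm_num)
          (by norm_num)).const_mul 4
      have h6 := (h5.rpow_const (p := γ) (Or.inr hγ.le)).div_const √n
      simpa [hγ.ne'] using h6
    refine squeeze_zero (fun _ => dist_nonneg) (fun E => ?_) h4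
    rw [dist_comm, Real.dist_eq]
    refine (hψ.abs_weight_sub_le hγ hH n (by positivity) hh.le
      (half_pow_le_net hh hh' (d := D + E) (by omega)) k).trans ?_
    gcongr
    refine (net_distance_le ht.1 h0.le (D + E)).trans ?_
    rw [one_div_pow, mul_one_div]
    gcongr
    · norm_num
    · omega
  refine le_of_tendsto hlim (Eventually.of_forall fun E => (hchain E).trans ?_)
  have : w 0 = netWeight ψ n (j + D) ⌊t * 2 ^ (j + D)⌋₊ ⌊h * 2 ^ (j + D)⌋₊ := rfl
  rw [this]
  linarith [hT E]

end NetPoints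


/-- This is where the chaining is summed: the coarse point yields the correction plus `O(1)`, the
links a convergent series, both multiplied by `Λ`. The constant depends on neither `n` nor `(t,h)`.
-/
theorem IsControlled.exists_bound (hψ : IsKernel ψ) {γ : ℝ} (hγ : 0 < γ) (hγ1 : γ ≤ 1)
    (hH : ∀ x y, |ψ x - ψ y| ≤ |x - y| ^ γ) {p : ℕ} (hp : 2 ≤ p) (hpγ : 1 ≤ p * γ) {C : ℝ}
    (hC : 0 ≤ C) {c : ℝ} (hc : 0 < c) :
    ∃ C', 0 ≤ C' ∧ ∀ n : ℕ, 0 < n → ∀ x : Fin n → ℝ, IsControlled ψ γ p C x →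
      ∀ t h : ℝ, t ∈ Icc (0 : ℝ) 1 → 0 < h → h ≤ 1 → c * h ≤ weightNorm ψ n t h ^ 2 →
        1 / (n : ℝ) ≤ weightNorm ψ n t h ^ 2 →
        |noise (weight ψ n t h) x| ≤ weightNorm ψ n t h *
          (corr n (2 * Real.log (1 / weightNorm ψ n t h)) (weightNorm ψ n t h) + C') := by
  set q : ℝ := (1 / 2 : ℝ) ^ γ with hq
  have hq0 : 0 ≤ q := by positivity
  have hq1 : q < 1 := Real.rpow_lt_one (by norm_num) (by norm_num) hγ
  set a : ℝ := p * 2 with ha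
  have ha0 : 0 ≤ a := by positivity
  set r := √(2 / c) with hr
  have hr0 : 0 ≤ r := Real.sqrt_nonneg _
  have hsum : Summable fun e : ℕ => 8 * (2 * r + 1) * (q ^ e * (2 + 3 * a + C + 3 * e)) := by
    have h1 : Summable fun e : ℕ => q ^ e := summable_geometric_of_lt_one hq0 hq1
    have h2 : Summable fun e : ℕ => (e : ℝ) ^ 1 * q ^ e :=
      summable_pow_mul_geometric_of_norm_lt_one 1 (by rwa [Real.norm_eq_abs, abs_of_nonneg hq0])
    refine Summable.mul_left _ (((h1.mul_left (2 + 3 * a + C)).add (h2.mul_left 3)).congr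
      fun e => ?_)
    ring
  set T := ∑' e : ℕ, 8 * (2 * r + 1) * (q ^ e * (2 + 3 * a + C + 3 * e)) with hT
  have hT0 : 0 ≤ T := tsum_nonneg fun e => by positivity
  set C₀ := 2 * (2 + 6 * a + C) + 2 * (8 * r) * (2 + 3 * a + C) + 1 / 2 + (1 + 6 * a + C) ^ 2
    with hC₀
  refine ⟨C₀ + T, by positivity, fun n hn x hx t h ht h0 h1 hch hnΛ => ?_⟩
  set Λ := weightNorm ψ n t h with hΛ
  have hn' : (0 : ℝ) < n := by positivity
  have hsn : 0 < √(n : ℝ) := by positivity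
  have hΛ0 : 0 < Λ := by
    have : 0 < Λ ^ 2 := lt_of_lt_of_le (by positivity) hnΛ
    exact lt_of_le_of_ne (weightNorm_nonneg _ _ _ _) fun h => by simp [← h] at this
  have hΛ1 : Λ ≤ 1 := hψ.weightNorm_le_one n t h
  have hinv : 1 / √(n : ℝ) ≤ Λ := by
    refine abs_le_of_sq_le_sq' ?_ hΛ0.le |>.2
    rwa [div_pow, one_pow, Real.sq_sqrt hn'.le]
  have hN : 1 ≤ √n * Λ := by
    rwa [div_le_iff₀' hsn] at hinv
  obtain ⟨j, hj, hj'⟩ := exists_nat_pow_near_of_lt_one h0 h1 (by norm_num : (0 : ℝ) < 1 / 2)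
    (by norm_num)
  -- From `2⁻ʲ < 2h ≤ (2/c) Λ²`; thus link bounds in terms of the dyadic scale become multiples of
  -- `Λ`.
  have hs : √((1 / 2 : ℝ) ^ j) ≤ r * Λ := by
    rw [Real.sqrt_le_left (by positivity), mul_pow, hr, Real.sq_sqrt (by positivity),
      div_mul_eq_mul_div, le_div_iff₀ hc]
    rw [pow_succ] at hj
    nlinarith
  set D := startLevel p j with hD
  have hDa : (D : ℝ) ≤ a * √(j + 1) := by
    have := startLevel_le p j
    rw [ha]
    linarith
  have hterm : ∀ e, √2 * (netModulus γ (D + e) * (2 * √((1 / 2) ^ j))) * √(netExponent C j (D + e))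
        + √2 * (netModulus γ (D + e) / √n) * netExponent C j (D + e)
      ≤ Λ * (8 * (2 * r + 1) * (q ^ e * (2 + 3 * a + C + 3 * e))) := by
    intro e
    set η := netExponent C j (D + e) with hη
    have hη0 : 0 ≤ η := netExponent_nonneg hC _ _
    set ω := netModulus γ (D + e) with hω
    have hω0 : 0 ≤ ω := netModulus_nonneg _ _
    have hs2 : √2 ≤ (2 : ℝ) := by
      rw [Real.sqrt_le_left (by norm_num)]
      norm_num
    have hω1 : ω ≤ 4 / (j + 1) * q ^ e := netModulus_startLevel_le hγ hγ1 hpγ j e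
    have hη1 : 1 + η ≤ (j + 1) * (2 + 3 * a + C + 3 * e) := by
      have h2 := netExponent_le (e := e) hC ha0 hDa
      have : (0 : ℝ) ≤ j := Nat.cast_nonneg j
      linarith
    calc √2 * (ω * (2 * √((1 / 2) ^ j))) * √η + √2 * (ω / √n) * η
        ≤ 2 * (ω * (2 * (r * Λ))) * (1 + η) + 2 * (ω * Λ) * (1 + η) := by
          have := sqrt_le_one_add hη0
          have hdiv : ω / √n ≤ ω * Λ := by
            rw [div_eq_mul_one_div]
            gcongr
          gcongr
          linarith
      _ = Λ * (2 * (2 * r + 1) * (ω * (1 + η))) := by ring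
      _ ≤ Λ * (2 * (2 * r + 1) * ((4 / (j + 1) * q ^ e) * ((j + 1) * (2 + 3 * a + C + 3 * e)))) := by
          gcongr
      _ = _ := by
          field_simp
          ring
  have hchain := hx.abs_noise_le hψ hγ hH (by omega) ht hj hj' (T := Λ * T) fun E => by
    refine (Finset.sum_le_sum fun e _ => hterm e).trans ?_
    rw [← Finset.mul_sum]
    gcongr
    exact hsum.sum_le_tsum _ fun e _ => by positivity
  have hD1 : 1 ≤ D := one_le_startLevel (by omega) j
  have hcoarse := hx.coarse j ⌊t * 2 ^ (j + D)⌋₊ ⌊h * 2 ^ (j + D)⌋₊ (floor_le_two_pow ht.2 _)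
    (floor_scale_mem hj hj' hD1).2
  set η := netExponent C j D with hη
  have hη0 : 0 ≤ η := netExponent_nonneg hC _ _
  have hnorm : weightNorm ψ n ((⌊t * 2 ^ (j + D)⌋₊ : ℝ) / 2 ^ (j + D))
      ((⌊h * 2 ^ (j + D)⌋₊ : ℝ) / 2 ^ (j + D)) ≤ Λ * (1 + 8 * r / (j + 1)) := by
    have hω1 := netModulus_startLevel_le hγ hγ1 hpγ j 0
    simp only [add_zero, pow_zero, mul_one] at hω1
    have h2 : weightNorm ψ n ((⌊t * 2 ^ (j + D)⌋₊ : ℝ) / 2 ^ (j + D))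
      ((⌊h * 2 ^ (j + D)⌋₊ : ℝ) / 2 ^ (j + D)) ≤ Λ + netModulus γ D * (2 * √((1 / 2) ^ j)) := by
      refine weightNorm_le_add (mul_nonneg (netModulus_nonneg _ _) (by positivity)) ?_
      refine (hψ.sum_sq_weight_sub_le hγ hH hn (by positivity) (half_pow_le_net hj hj' hD1)
        hj.le).trans ?_
      rw [mul_pow, mul_pow, Real.sq_sqrt (by positivity), netModulus, abs_sub_comm _ t,
        abs_sub_comm _ h]
      have h3 := net_distance_le (j := j) ht.1 h0.le D
      have h4 : (⌊h * 2 ^ (j + D)⌋₊ : ℝ) / 2 ^ (j + D) ≤ h := by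
        rw [div_le_iff₀ (by positivity)]
        exact Nat.floor_le (by positivity)
      gcongr
      linarith
    refine h2.trans ?_
    calc Λ + netModulus γ D * (2 * √((1 / 2) ^ j)) ≤ Λ + 4 / (j + 1) * (2 * (r * Λ)) := by gcongr
      _ = Λ * (1 + 8 * r / (j + 1)) := by ring
  -- From `Λ² ≤ 2h ≤ 2 · 2⁻ʲ`: the dyadic index is controlled by the logarithm in the correction.
  have hlog : Real.log 2 * ((j : ℝ) - 1) ≤ 2 * Real.log (1 / Λ) := by
    have h2 : Λ ^ 2 ≤ 2 * (1 / 2) ^ j :=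
      (hψ.weightNorm_sq_le_two_mul hn t h0).trans (by gcongr)
    have h3 := Real.log_le_log (by positivity) h2
    rw [Real.log_pow, Real.log_mul (by norm_num) (by positivity), Real.log_pow, one_div,
      Real.log_inv] at h3
    rw [one_div, Real.log_inv]
    push_cast at h3
    linarith
  have hbound := coarse_bound_le (η₀ := 2 * Real.log (1 / Λ)) (C := C) (a := a) (C₁ := 8 * r)
    (N := √n * Λ) (by
      have : 0 ≤ Real.log (1 / Λ) := Real.log_nonneg (by rwa [one_le_div₀ hΛ0])
      positivity) hC ha0 (by positivity) hN hlog hDa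
  rw [corr, max_eq_right hN]
  calc |noise (weight ψ n t h) x|
      ≤ √2 * (Λ * (1 + 8 * r / (j + 1))) * √η + √2 * (1 / √n) * η + Λ * T := by
        refine hchain.trans (add_le_add (hcoarse.trans ?_) le_rfl)
        gcongr
    _ = Λ * (√2 * (1 + 8 * r / (j + 1)) * √η + √2 * η / (√n * Λ)) + Λ * T := by
        field_simp
    _ ≤ Λ * (√(2 * (2 * Real.log (1 / Λ))) + 2 * (2 * Real.log (1 / Λ)) / (√n * Λ) + C₀)
          + Λ * T := by gcongr
    _ = _ := by ring

/-! ### The critical value is bounded -/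

theorem incr_cumsum (z₀ : ℝ) {n : ℕ} (x : Fin n → ℝ) :
    incr (fun j : Fin (n + 1) => z₀ + ∑ k : Fin n with k.castSucc < j, x k) = x := by
  funext i
  have h : (Finset.univ.filter fun k : Fin n => k.castSucc < i.succ)
      = insert i (Finset.univ.filter fun k : Fin n => k.castSucc < i.castSucc) := by
    ext k
    simp only [Finset.mem_filter, Finset.mem_univ, true_and, Finset.mem_insert, Fin.lt_def,
      Fin.ext_iff, Fin.val_castSucc, Fin.val_succ]
    omega
  rw [incr, h, Finset.sum_insert (by simp)]
  ring

/-- A pushforward dominates the measure of the preimage for every set, so measurability of the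
supremum over `(t,h)` never enters. -/
theorem measureReal_incrementLaw_le_obsLaw (z₀ : ℝ) (σ : ℝ → ℝ) (n : ℕ)
    (S : Set (Fin (n + 1) → ℝ)) (A : Set (Fin n → ℝ)) (hA : ∀ z, incr z ∈ A → z ∈ S) :
    (incrementLaw σ n).real A ≤ (obsLaw z₀ σ n).real S := by
  have hm : Measurable fun (x : Fin n → ℝ) (j : Fin (n + 1)) =>
      z₀ + ∑ k : Fin n with k.castSucc < j, x k := by fun_prop
  have h1 := Measure.le_map_apply (μ := incrementLaw σ n) hm.aemeasurable S
  have h2 : A ⊆ (fun (x : Fin n → ℝ) (j : Fin (n + 1)) =>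
      z₀ + ∑ k : Fin n with k.castSucc < j, x k) ⁻¹' S := fun x hx =>
    hA _ (by rwa [incr_cumsum])
  have : IsProbabilityMeasure (obsLaw z₀ σ n) := Measure.isProbabilityMeasure_map hm.aemeasurable
  exact ENNReal.toReal_mono (measure_ne_top _ _) ((measure_mono h2).trans h1)

/-- Deliberately crude: it is used only after multiplication by a relative error of order `1/√n`. -/
theorem corr_le {n : ℕ} {Λ : ℝ} (hn : 0 < n) (h0 : 0 < Λ) (h1 : Λ ≤ 1)
    (hn1 : 1 / (n : ℝ) ≤ Λ ^ 2) : corr n (2 * Real.log (1 / Λ)) Λ ≤ 9 * √n := by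
  have hn' : (0 : ℝ) < n := by positivity
  set η := 2 * Real.log (1 / Λ) with hη
  have hη0 : 0 ≤ η := by
    have : 0 ≤ Real.log (1 / Λ) := Real.log_nonneg (by rwa [one_le_div₀ h0])
    positivity
  have hlog : η ≤ 2 * √n := by
    have h2 := Real.log_le_log (by positivity) hn1
    rw [Real.log_pow, one_div, Real.log_inv] at h2
    have h3 := Real.log_le_self (Real.sqrt_nonneg (n : ℝ))
    rw [Real.log_sqrt hn'.le] at h3
    rw [hη, one_div, Real.log_inv]
    push_cast at h2
    linarith
  have hsn : 1 ≤ √(n : ℝ) := Real.one_le_sqrt.2 (by exact_mod_cast hn)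
  have h4 : 2 * η / max 1 (√n * Λ) ≤ 2 * η := div_le_self (by positivity) (le_max_left _ _)
  have h5 := sqrt_le_one_add (by positivity : 0 ≤ 2 * η)
  rw [corr]
  linarith

/-- Splits off the cost of estimating the variance. By `sum_weight_le` the second term is at most
`|1 - csq| √n Λ`, hence `O(Λ)` when the estimator is accurate to order `1/√n`. -/
theorem localStat_numerator {n : ℕ} (t h csq : ℝ) (x : Fin n → ℝ) :
    1 / √2 * ∑ k, weight ψ n t h k * (n * x k ^ 2 - csq)
      = noise (weight ψ n t h) x + (1 - csq) * ((√2)⁻¹ * ∑ k, weight ψ n t h k) := by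
  have : ∀ k, weight ψ n t h k * (n * x k ^ 2 - csq)
      = weight ψ n t h k * (n * x k ^ 2 - 1) + (1 - csq) * weight ψ n t h k := fun k => by ring
  simp_rw [this]
  rw [Finset.sum_add_distrib, ← Finset.mul_sum, noise]
  ring

theorem IsCalibrationConstant.weightNorm_pos {K : ℝ} (hK : IsCalibrationConstant ψ K) {n : ℕ}
    (hn : 0 < n) {p : ℝ × ℝ} (hp : p ∈ scaleSet n K) : 0 < weightNorm ψ n p.1 p.2 := by
  have hn' : (0 : ℝ) < n := by positivity
  have : 0 < weightNorm ψ n p.1 p.2 ^ 2 := lt_of_lt_of_le (by positivity) (hK.2 n hn p hp)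
  exact lt_of_le_of_ne (weightNorm_nonneg _ _ _ _) fun h => by simp [← h] at this

theorem inv_sqrt_two_le_one : (√2)⁻¹ ≤ (1 : ℝ) :=
  inv_le_one_of_one_le₀ (Real.one_le_sqrt.2 one_le_two)

theorem multiscaleStat_le (hψ : IsKernel ψ) {K : ℝ} (hK : IsCalibrationConstant ψ K) {n : ℕ}
    (hn : 0 < n) {z : Fin (n + 1) → ℝ} {C' C₄ : ℝ} (hC' : 0 ≤ C') (hC₄ : 0 ≤ C₄)
    (hnoise : ∀ p ∈ scaleSet n K, |noise (weight ψ n p.1 p.2) (incr z)| ≤ weightNorm ψ n p.1 p.2 *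
      (corr n (2 * Real.log (1 / weightNorm ψ n p.1 p.2)) (weightNorm ψ n p.1 p.2) + C'))
    (hc : |cHatSq z - 1| ≤ C₄ / √n) (hsmall : C₄ / √n ≤ 1 / 2) :
    multiscaleStat ψ K z ≤ 2 * (C' + C₄) + 18 * C₄ := by
  -- Nonnegativity of the bound takes care of an empty index set, whose real supremum is 0.
  refine Real.iSup_le (fun ⟨p, hp⟩ => ?_) (by positivity)
  have hsn : 0 < √(n : ℝ) := by positivity
  have hΛ0 := hK.weightNorm_pos hn hp
  have hΛ1 := hψ.weightNorm_le_one n p.1 p.2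
  have hcorr := corr_le hn hΛ0 hΛ1 (hK.2 n hn p hp)
  have hno := hnoise p hp
  have hsw := sum_weight_le ψ n p.1 p.2
  simp only
  set Λ := weightNorm ψ n p.1 p.2
  set G := corr n (2 * Real.log (1 / Λ)) Λ
  set δ := C₄ / √n with hδ
  have hδ0 : 0 ≤ δ := by positivity
  set c := cHatSq z
  have hc1 : 1 - δ ≤ c := by linarith [(abs_le.1 hc).1]
  have hc0 : 0 < c := by linarith
  have hG0 : 0 ≤ G + C' := by
    have := (abs_nonneg _).trans hno
    exact nonneg_of_mul_nonneg_right this hΛ0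
  have hnum : |1 / √2 * ∑ k, weight ψ n p.1 p.2 k * (n * incr z k ^ 2 - c)|
      ≤ Λ * (G + C' + C₄) := by
    rw [localStat_numerator]
    refine (abs_add_le _ _).trans ?_
    have h1 : |(1 - c) * ((√2)⁻¹ * ∑ k, weight ψ n p.1 p.2 k)| ≤ δ * (1 * (√n * Λ)) := by
      rw [abs_mul, abs_mul, abs_sub_comm, abs_of_nonneg (by positivity : 0 ≤ (√2 : ℝ)⁻¹)]
      gcongr
      exact inv_sqrt_two_le_one
    have h2 : δ * (1 * (√n * Λ)) = Λ * C₄ := by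
      rw [hδ]
      field_simp
    linarith
  have hstat : |localStat ψ p.1 p.2 c z| ≤ (G + C' + C₄) * (1 + 2 * δ) := by
    rw [localStat, abs_div, abs_of_pos (by positivity : 0 < c * Λ), div_le_iff₀ (by positivity)]
    refine hnum.trans ?_
    have h3 : 1 ≤ (1 + 2 * δ) * c := by nlinarith
    calc Λ * (G + C' + C₄) = Λ * (G + C' + C₄) * 1 := by ring
      _ ≤ Λ * (G + C' + C₄) * ((1 + 2 * δ) * c) := by gcongr
      _ = _ := by ring
  have h4 : G * δ ≤ 9 * C₄ := by
    calc G * δ ≤ 9 * √n * δ := by gcongr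
      _ = 9 * C₄ := by
        rw [hδ]
        field_simp
  nlinarith

theorem tail_cHatSq_one {n : ℕ} (hn : 0 < n) {η : ℝ} (hη : 0 ≤ η) :
    (incrementLaw (fun _ => 1) n).real
      {x | (2 * √η + 2 * η) / √n < |(∑ k, x k ^ 2) - 1|} ≤ 2 * Real.exp (-η) := by
  have hn' : (0 : ℝ) < n := by positivity
  have hsn : 1 ≤ √(n : ℝ) := Real.one_le_sqrt.2 (by exact_mod_cast hn)
  have hv := quadVar_one n
  have key := pi_gaussianReal_tail
    (fun k : Fin n => quadVar (fun _ => 1) ((k : ℝ) / n) (((k : ℝ) + 1) / n))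
    (fun _ => 1) (A := 1 / √n) (B := 1 / √n) (η := η) (by positivity) hη
    (by
      simp_rw [hv]
      simp only [one_mul, Finset.sum_const, Finset.card_univ, Fintype.card_fin, nsmul_eq_mul,
        div_pow, Real.sq_sqrt hn'.le]
      apply le_of_eq
      field_simp)
    (fun k => by
      rw [hv, one_mul, abs_of_nonneg (by positivity)]
      gcongr
      rw [Real.sqrt_le_left hn'.le]
      have : (1 : ℝ) ≤ n := by exact_mod_cast hn
      nlinarith) (by positivity)
  refine le_trans (measureReal_mono fun x hx => ?_) key
  simp only [mem_ofPred_eq, hv, one_mul] at hx ⊢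
  have e : ∑ k : Fin n, (x k ^ 2 - 1 / (n : ℝ)) = (∑ k, x k ^ 2) - 1 := by
    rw [Finset.sum_sub_distrib]
    simp [hn'.ne']
  rw [e]
  refine lt_of_eq_of_lt ?_ hx
  ring

theorem exists_two_mul_exp_neg_le (A : ℝ) {δ : ℝ} (hδ : 0 < δ) :
    ∃ η : ℝ, 0 ≤ η ∧ A * Real.exp (-η) ≤ δ := by
  have h1 : Tendsto (fun η : ℝ => A * Real.exp (-η)) atTop (𝓝 (A * 0)) :=
    (Real.tendsto_exp_neg_atTop_nhds_zero).const_mul A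
  rw [mul_zero] at h1
  obtain ⟨η, h2, h3⟩ := ((h1.eventually (gt_mem_nhds hδ)).and (eventually_ge_atTop 0)).exists
  exact ⟨η, h3, h2.le⟩

theorem one_sub_add_le_measureReal_diff {Ω : Type*} [MeasurableSpace Ω] (μ : Measure Ω)
    [IsProbabilityMeasure μ] {A B : Set Ω} {a b : ℝ} (hA : 1 - a ≤ μ.real A)
    (hB : μ.real B ≤ b) : 1 - (a + b) ≤ μ.real (A \ B) := by
  have h1 : μ.real A ≤ μ.real (A \ B) + μ.real B := by
    refine (measureReal_mono fun x hx => ?_).trans (measureReal_union_le _ _)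
    by_cases h : x ∈ B
    · exact Or.inr h
    · exact Or.inl ⟨hx, h⟩
  linarith

/-- Half of `α` is spent on the chaining event, the other half on the accuracy of the variance
estimator; both constants are fixed before `n`. -/
theorem exists_critValue_le (hψ : IsKernel ψ) {K : ℝ} (hK : IsCalibrationConstant ψ K) {α : ℝ}
    (hα : 0 < α) : ∃ κ : ℝ, 0 ≤ κ ∧ ∀ᶠ n : ℕ in atTop, ∀ z₀, critValue ψ K z₀ α n ≤ κ := by
  obtain ⟨γ, hγ, hγ1, hH⟩ := hψ.holder
  obtain ⟨c, hc, -, hcΛ⟩ := hψ.exists_le_weightNorm_sq hK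
  obtain ⟨p, hp⟩ := exists_nat_ge (max 2 (1 / γ))
  have hp2 : 2 ≤ p := by exact_mod_cast (le_max_left _ _).trans hp
  have hpγ : 1 ≤ p * γ := by
    have := (le_max_right _ _).trans hp
    rwa [div_le_iff₀ hγ] at this
  obtain ⟨C, hC, hCα⟩ := exists_two_mul_exp_neg_le (128 * ∑' j : ℕ, 1 / ((j : ℝ) + 1) ^ 2)
    (half_pos hα)
  obtain ⟨η, hη, hηα⟩ := exists_two_mul_exp_neg_le 2 (half_pos hα)
  obtain ⟨C', hC', hbound⟩ := IsControlled.exists_bound hψ hγ hγ1 hH hp2 hpγ hC hc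
  set C₄ := 2 * √η + 2 * η with hC₄
  have hC₄0 : 0 ≤ C₄ := by positivity
  refine ⟨2 * (C' + C₄) + 18 * C₄, by positivity, ?_⟩
  have hlim : Tendsto (fun n : ℕ => C₄ / √(n : ℝ)) atTop (𝓝 0) :=
    tendsto_const_nhds.div_atTop (Real.tendsto_sqrt_atTop.comp tendsto_natCast_atTop_atTop)
  filter_upwards [hlim.eventually (ge_mem_nhds (by norm_num : (0 : ℝ) < 1 / 2)),
    eventually_gt_atTop 0] with n hsmall hn z₀
  have hmem : 1 - α ≤ (obsLaw z₀ (fun _ => 1) n).real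
      {z | multiscaleStat ψ K z ≤ 2 * (C' + C₄) + 18 * C₄} := by
    have h1 := one_sub_add_le_measureReal_diff (incrementLaw (fun _ => 1) n)
      (hψ.prob_isControlled hγ hH hp2 hn hC) (tail_cHatSq_one hn hη)
    refine le_trans ?_ (h1.trans (measureReal_incrementLaw_le_obsLaw z₀ _ n _ _ fun z hz => ?_))
    · linarith
    · refine multiscaleStat_le hψ hK hn hC' hC₄0 (fun q hq => ?_) (not_lt.1 hz.2) hsmall
      have hq0 : 0 < q.2 := lt_of_lt_of_le (div_pos hK.1 (by positivity)) hq.1.1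
      exact hbound n hn _ hz.1 q.1 q.2
        ⟨hq0.le.trans hq.2.1, hq.2.2.trans (by linarith)⟩ hq0 (by linarith [hq.1.2])
        (hcΛ n hn q hq) (hK.2 n hn q hq)
  rw [critValue]
  by_cases hb : BddBelow {r : ℝ | 1 - α ≤ (obsLaw z₀ (fun _ => 1) n).real
      {z | multiscaleStat ψ K z ≤ r}}
  · exact csInf_le hb hmem
  -- The real infimum of a set unbounded below is 0 by convention, which is still at most the
  -- nonnegative bound.
  · rw [Real.sInf_of_not_bddBelow hb]
    positivity


/-! ### Power of the test -/

theorem cHatSq_nonneg {n : ℕ} (z : Fin (n + 1) → ℝ) : 0 ≤ cHatSq z :=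
  Finset.sum_nonneg fun _ _ => sq_nonneg _

theorem corr_nonneg {n : ℕ} {η δ : ℝ} (hη : 0 ≤ η) : 0 ≤ corr n η δ := by
  have : 0 < max 1 (√n * δ) := lt_of_lt_of_le one_pos (le_max_left _ _)
  unfold corr
  positivity

theorem two_mul_log_one_div_nonneg {Λ : ℝ} (h0 : 0 < Λ) (h1 : Λ ≤ 1) :
    0 ≤ 2 * Real.log (1 / Λ) := by
  have : 0 ≤ Real.log (1 / Λ) := Real.log_nonneg (by rwa [one_le_div₀ h0])
  positivity

/-- An unbounded real supremum would be 0 by convention, so boundedness is needed before a single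
term can bound the statistic from below. It follows from `|λ_k| ≤ Λ`; if `cHatSq z = 0`, both
quotients are 0. -/
theorem bddAbove_multiscale (hψ : IsKernel ψ) {K : ℝ} (hK : IsCalibrationConstant ψ K) {n : ℕ}
    (hn : 0 < n) (z : Fin (n + 1) → ℝ) :
    BddAbove (range fun p : scaleSet n K => |localStat ψ p.1.1 p.1.2 (cHatSq z) z|
      - corr n (2 * Real.log (1 / weightNorm ψ n p.1.1 p.1.2)) (weightNorm ψ n p.1.1 p.1.2)) := by
  have hn' : (0 : ℝ) < n := by positivity
  have hsn : 0 < √(n : ℝ) := by positivity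
  refine ⟨(∑ k, |n * incr z k ^ 2 - cHatSq z|) / cHatSq z, ?_⟩
  rintro _ ⟨⟨p, hp⟩, rfl⟩
  have hΛ0 := hK.weightNorm_pos hn hp
  have hc := corr_nonneg (n := n) (δ := weightNorm ψ n p.1 p.2)
    (two_mul_log_one_div_nonneg hΛ0 (hψ.weightNorm_le_one n p.1 p.2))
  simp only
  refine (sub_le_self _ hc).trans ?_
  rw [localStat, abs_div, abs_mul, abs_of_nonneg (mul_nonneg (cHatSq_nonneg z) hΛ0.le),
    mul_comm (cHatSq z), ← div_div]
  refine div_le_div_of_nonneg_right ?_ (cHatSq_nonneg z)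
  rw [div_le_iff₀ hΛ0]
  calc |1 / √2| * |∑ k, weight ψ n p.1 p.2 k * (n * incr z k ^ 2 - cHatSq z)|
      ≤ 1 * ∑ k, |weight ψ n p.1 p.2 k * (n * incr z k ^ 2 - cHatSq z)| := by
        gcongr
        · rw [one_div, abs_of_nonneg (by positivity)]
          exact inv_sqrt_two_le_one
        · exact Finset.abs_sum_le_sum_abs _ _
    _ ≤ (∑ k, |n * incr z k ^ 2 - cHatSq z|) * weightNorm ψ n p.1 p.2 := by
        rw [one_mul, Finset.sum_mul]
        refine Finset.sum_le_sum fun k _ => ?_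
        rw [abs_mul, mul_comm]
        gcongr
        exact abs_weight_le_weightNorm _ _ _ _ _

/-- The numerator is noise plus `c` times the signal plus an error from estimating `c`. The last is
at most `c δ √n Λ`, and the estimate in the denominator is at most `c (1 + δ)`. -/
theorem le_abs_localStat {n : ℕ} {z : Fin (n + 1) → ℝ} {t h c X A δ : ℝ} {V : Fin n → ℝ}
    (hc : 0 < c) (hΛ : 0 < weightNorm ψ n t h)
    (hX : X * weightNorm ψ n t h
      ≤ |(√2)⁻¹ * ∑ k, weight ψ n t h k * (n * V k / c - 1)|)
    (hA : |∑ k, weight ψ n t h k * (n * (incr z k ^ 2 - V k))| ≤ c * (weightNorm ψ n t h * A))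
    (hδ : |cHatSq z - c| ≤ c * δ) (hδ1 : δ ≤ 1 / 2) :
    X - A - √n * δ ≤ |localStat ψ t h (cHatSq z) z| * (1 + δ) := by
  set Λ := weightNorm ψ n t h
  set e := cHatSq z
  have hδ0 : 0 ≤ δ := nonneg_of_mul_nonneg_right ((abs_nonneg _).trans hδ) hc
  have he := abs_le.1 hδ
  have he0 : 0 < e := by nlinarith
  have hdecomp : 1 / √2 * ∑ k, weight ψ n t h k * (n * incr z k ^ 2 - e)
      = (√2)⁻¹ * (∑ k, weight ψ n t h k * (n * (incr z k ^ 2 - V k)))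
        + c * ((√2)⁻¹ * ∑ k, weight ψ n t h k * (n * V k / c - 1))
        + (c - e) * ((√2)⁻¹ * ∑ k, weight ψ n t h k) := by
    simp only [Finset.mul_sum, ← Finset.sum_add_distrib]
    refine Finset.sum_congr rfl fun k _ => ?_
    field_simp
    ring
  have h1 : |(√2)⁻¹ * (∑ k, weight ψ n t h k * (n * (incr z k ^ 2 - V k)))| ≤ c * (Λ * A) := by
    rw [abs_mul, abs_of_nonneg (by positivity : 0 ≤ (√2 : ℝ)⁻¹)]
    exact (mul_le_of_le_one_left (abs_nonneg _) inv_sqrt_two_le_one).trans hA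
  have h2 : |(c - e) * ((√2)⁻¹ * ∑ k, weight ψ n t h k)| ≤ c * δ * (√n * Λ) := by
    rw [abs_mul, abs_mul, abs_sub_comm, abs_of_nonneg (by positivity : 0 ≤ (√2 : ℝ)⁻¹)]
    exact mul_le_mul hδ ((mul_le_of_le_one_left (abs_nonneg _) inv_sqrt_two_le_one).trans
      (sum_weight_le _ _ _ _)) (by positivity) (by positivity)
  have h3 : c * (X * Λ) ≤ |c * ((√2)⁻¹ * ∑ k, weight ψ n t h k * (n * V k / c - 1))| := by
    rw [abs_mul, abs_of_pos hc]
    gcongr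
  have h4 : c * (X * Λ) - c * (Λ * A) - c * δ * (√n * Λ)
      ≤ |1 / √2 * ∑ k, weight ψ n t h k * (n * incr z k ^ 2 - e)| := by
    rw [hdecomp]
    set u := (√2)⁻¹ * (∑ k, weight ψ n t h k * (n * (incr z k ^ 2 - V k)))
    set w := (c - e) * ((√2)⁻¹ * ∑ k, weight ψ n t h k)
    set v := c * ((√2)⁻¹ * ∑ k, weight ψ n t h k * (n * V k / c - 1))
    have h5 : |v| ≤ |u + v + w| + |u| + |w| := by
      have := abs_sub (u + v + w) (u + w)
      have h6 := abs_add_le u w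
      rw [show u + v + w - (u + w) = v by ring] at this
      linarith
    linarith
  have h7 : |localStat ψ t h e z| * (e * Λ)
      = |1 / √2 * ∑ k, weight ψ n t h k * (n * incr z k ^ 2 - e)| := by
    rw [localStat, abs_div, abs_of_pos (by positivity : 0 < e * Λ), div_mul_cancel₀]
    positivity
  rw [← h7] at h4
  have h8 : |localStat ψ t h e z| * (e * Λ) ≤ |localStat ψ t h e z| * (c * (1 + δ) * Λ) := by
    gcongr
    linarith [he.2]
  have h9 : (c * Λ) * (X - A - √n * δ) ≤ (c * Λ) * (|localStat ψ t h e z| * (1 + δ)) := by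
    calc (c * Λ) * (X - A - √n * δ) = c * (X * Λ) - c * (Λ * A) - c * δ * (√n * Λ) := by ring
      _ ≤ _ := h4.trans h8
      _ = _ := by ring
  exact le_of_mul_le_mul_left h9 (by positivity)

/-! ### Deviation bounds under a bounded volatility and the power at one scale -/

theorem IsVolatility.intervalIntegrable {σ : ℝ → ℝ} (hσ : IsVolatility σ) :
    IntervalIntegrable (fun s => σ s ^ 2) volume 0 1 := by
  rw [intervalIntegrable_iff_integrableOn_Icc_of_le zero_le_one]
  exact hσ.integrable

theorem IsVolatility.l2NormSq_pos {σ : ℝ → ℝ} (hσ : IsVolatility σ) : 0 < l2NormSq σ :=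
  intervalIntegral.intervalIntegral_pos_of_pos_on hσ.intervalIntegrable
    (fun s hs => pow_pos (hσ.pos s (Ioo_subset_Icc_self hs)) 2) zero_lt_one

theorem coe_quadVar_block (σ : ℝ → ℝ) (n : ℕ) (k : Fin n) :
    ((quadVar σ ((k : ℝ) / n) (((k : ℝ) + 1) / n) : ℝ≥0) : ℝ)
      = ∫ s in ((k : ℝ) / n)..(((k : ℝ) + 1) / n), σ s ^ 2 := by
  rw [quadVar, Real.coe_toNNReal]
  exact intervalIntegral.integral_nonneg (block_le n k) fun _ _ => sq_nonneg _

theorem IsVolatility.integral_block_le {σ : ℝ → ℝ} (hσ : IsVolatility σ) {B : ℝ}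
    (hB : ∀ s ∈ Icc (0 : ℝ) 1, σ s ^ 2 ≤ B) {n : ℕ} (k : Fin n) :
    ∫ s in ((k : ℝ) / n)..(((k : ℝ) + 1) / n), σ s ^ 2 ≤ B / n := by
  have h1 : IntervalIntegrable (fun s => σ s ^ 2) volume ((k : ℝ) / n) (((k : ℝ) + 1) / n) := by
    refine hσ.intervalIntegrable.mono_set ?_
    rw [uIcc_of_le zero_le_one, uIcc_of_le (block_le n k)]
    exact block_subset k
  have h2 := intervalIntegral.integral_mono_on (block_le n k) h1
    (intervalIntegrable_const (c := B)) fun s hs => hB s (block_subset k hs)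
  rw [intervalIntegral.integral_const, block_length, smul_eq_mul] at h2
  refine h2.trans (le_of_eq ?_)
  ring

/-- Deviation of linear functionals of the squared increments under a bounded volatility. -/
theorem IsVolatility.tail {σ : ℝ → ℝ} (hσ : IsVolatility σ) {B : ℝ} (hB0 : 0 < B)
    (hB : ∀ s ∈ Icc (0 : ℝ) 1, σ s ^ 2 ≤ B) {n : ℕ} (hn : 0 < n) (a : Fin n → ℝ) {A η : ℝ}
    (hA : 0 < A) (hη : 0 ≤ η) (hAa : ∑ k, a k ^ 2 ≤ A ^ 2) :
    (incrementLaw σ n).real {x | A * B * (2 * √η + 2 * η) / n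
      < |∑ k, a k * (x k ^ 2 - ∫ s in ((k : ℝ) / n)..(((k : ℝ) + 1) / n), σ s ^ 2)|}
      ≤ 2 * Real.exp (-η) := by
  have hn' : (0 : ℝ) < n := by positivity
  have hak : ∀ k, |a k| ≤ A := fun k => abs_le_of_sq_le_sq
    ((Finset.single_le_sum (f := fun k => a k ^ 2) (fun _ _ => sq_nonneg _)
      (Finset.mem_univ k)).trans hAa) hA.le
  have hv0 : ∀ k : Fin n, 0 ≤ ∫ s in ((k : ℝ) / n)..(((k : ℝ) + 1) / n), σ s ^ 2 := fun k =>
    intervalIntegral.integral_nonneg (block_le n k) fun _ _ => sq_nonneg _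
  have key := pi_gaussianReal_tail
    (fun k : Fin n => quadVar σ ((k : ℝ) / n) (((k : ℝ) + 1) / n)) a (A := A * (B / n))
    (B := A * (B / n)) (η := η) (by positivity) hη
    (by
      simp_rw [coe_quadVar_block, mul_pow]
      refine le_trans (Finset.sum_le_sum fun k _ => mul_le_mul_of_nonneg_left
        (pow_le_pow_left₀ (hv0 k) (hσ.integral_block_le hB k) 2) (sq_nonneg _)) ?_
      rw [← Finset.sum_mul]
      gcongr)
    (fun k => by
      rw [coe_quadVar_block, abs_mul, abs_of_nonneg (hv0 k)]
      exact mul_le_mul (hak k) (hσ.integral_block_le hB k) (hv0 k) hA.le) (by positivity)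
  refine le_trans (measureReal_mono fun x hx => ?_) key
  simp only [mem_ofPred_eq, coe_quadVar_block] at hx ⊢
  refine lt_of_eq_of_lt ?_ hx
  ring

/-- `Λ² ≥ c h` replaces `Λ²` by `h` at the price of a constant, and `hlarge` brings the second term
of the correction below 1. -/
theorem corr_le_sqrt_log {n : ℕ} {Λ c h : ℝ} (hn : 0 < n) (h0 : 0 < Λ) (h1 : Λ ≤ 1)
    (hn1 : 1 / (n : ℝ) ≤ Λ ^ 2) (hc : 0 < c) (hc1 : c ≤ 1) (hh : 0 < h) (hh1 : h ≤ 1)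
    (hch : c * h ≤ Λ ^ 2)
    (hlarge : 4 * Real.log n ^ 2 ≤ c * (n * h)) :
    corr n (2 * Real.log (1 / Λ)) Λ
      ≤ √(2 * Real.log (1 / h)) + (√(2 * Real.log (1 / c)) + 1) := by
  have hn' : (0 : ℝ) < n := by positivity
  have hη0 := two_mul_log_one_div_nonneg h0 h1
  set η := 2 * Real.log (1 / Λ) with hη
  have hη' : η = -Real.log (Λ ^ 2) := by
    rw [hη, one_div, Real.log_inv, Real.log_pow]
    push_cast
    ring
  have hlog1 : η ≤ Real.log (1 / h) + Real.log (1 / c) := by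
    have h2 := Real.log_le_log (by positivity) hch
    rw [Real.log_mul hc.ne' hh.ne'] at h2
    rw [hη', one_div, one_div, Real.log_inv, Real.log_inv]
    linarith
  have hlog2 : η ≤ Real.log n := by
    have h2 := Real.log_le_log (by positivity) hn1
    rw [one_div, Real.log_inv] at h2
    linarith
  have hlh : 0 ≤ Real.log (1 / h) := Real.log_nonneg (by rwa [one_le_div₀ hh])
  have hlc : 0 ≤ Real.log (1 / c) := Real.log_nonneg (by rwa [one_le_div₀ hc])
  have hln : 0 ≤ Real.log n := hη0.trans hlog2
  rw [corr, ← add_assoc]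
  refine add_le_add ?_ ?_
  · refine (Real.sqrt_le_sqrt (by linarith : 2 * η
      ≤ 2 * Real.log (1 / h) + 2 * Real.log (1 / c))).trans ?_
    have e1 := Real.sqrt_nonneg (2 * Real.log (1 / h))
    have e2 := Real.sqrt_nonneg (2 * Real.log (1 / c))
    rw [Real.sqrt_le_left (by positivity)]
    nlinarith [Real.sq_sqrt (by positivity : 0 ≤ 2 * Real.log (1 / h)),
      Real.sq_sqrt (by positivity : 0 ≤ 2 * Real.log (1 / c))]
  · have hpos : 0 < max 1 (√n * Λ) := lt_of_lt_of_le one_pos (le_max_left _ _)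
    rw [div_le_one hpos]
    refine le_trans ?_ (le_max_right _ _)
    refine abs_le_of_sq_le_sq' ?_ (by positivity) |>.2
    rw [mul_pow (√(n : ℝ)), Real.sq_sqrt hn'.le]
    nlinarith [pow_le_pow_left₀ hη0 hlog2 2]

theorem isProbabilityMeasure_obsLaw (z₀ : ℝ) (σ : ℝ → ℝ) (n : ℕ) :
    IsProbabilityMeasure (obsLaw z₀ σ n) := by
  have hm : Measurable fun (x : Fin n → ℝ) (j : Fin (n + 1)) =>
      z₀ + ∑ k : Fin n with k.castSucc < j, x k := by fun_prop
  exact Measure.isProbabilityMeasure_map hm.aemeasurable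

theorem power_le_one (ψ : ℝ → ℝ) (K z₀ α : ℝ) (n : ℕ) (σ : ℝ → ℝ) : power ψ K z₀ α n σ ≤ 1 := by
  have := isProbabilityMeasure_obsLaw z₀ σ n
  exact measureReal_le_one

/-- The standardized signal at `(t,h)`. -/
noncomputable def signal (ψ : ℝ → ℝ) (n : ℕ) (t h : ℝ) (σ : ℝ → ℝ) : ℝ :=
  (√2)⁻¹ * ∑ k : Fin n, weight ψ n t h k *
    (n * (∫ s in ((k : ℝ) / n)..(((k : ℝ) + 1) / n), σ s ^ 2) / l2NormSq σ - 1)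

theorem le_multiscaleStat (hψ : IsKernel ψ) {K : ℝ} (hK : IsCalibrationConstant ψ K)
    {n : ℕ} (hn : 0 < n) (z : Fin (n + 1) → ℝ) {t h : ℝ} (hth : (t, h) ∈ scaleSet n K) :
    |localStat ψ t h (cHatSq z) z|
      - corr n (2 * Real.log (1 / weightNorm ψ n t h)) (weightNorm ψ n t h)
      ≤ multiscaleStat ψ K z :=
  le_ciSup (bddAbove_multiscale hψ hK hn z) ⟨(t, h), hth⟩

/-- In `11 * A`, two units are the noise and the estimation error, and nine come from the correction
multiplied by `A / √n`, through `corr_le`. -/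
theorem critValue_lt_multiscaleStat (hψ : IsKernel ψ) {K : ℝ} (hK : IsCalibrationConstant ψ K)
    {n : ℕ} (hn : 0 < n) {z : Fin (n + 1) → ℝ} {z₀ α κ t h X A : ℝ} (hA0 : 0 ≤ A)
    (hκ : critValue ψ K z₀ α n ≤ κ) (hκ0 : 0 ≤ κ) (hth : (t, h) ∈ scaleSet n K)
    (hsmall : A / √n ≤ 1 / 2)
    (hlarge : corr n (2 * Real.log (1 / weightNorm ψ n t h)) (weightNorm ψ n t h)
      + (2 * κ + 11 * A) < X)
    (hstat : X - A - A ≤ |localStat ψ t h (cHatSq z) z| * (1 + A / √n)) :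
    critValue ψ K z₀ α n < multiscaleStat ψ K z := by
  have hsn : 0 < √(n : ℝ) := Real.sqrt_pos.2 (Nat.cast_pos.2 hn)
  have hΛ0 : 0 < weightNorm ψ n t h := hK.weightNorm_pos hn (p := (t, h)) hth
  have hΛ1 := hψ.weightNorm_le_one n t h
  have hcorr := corr_le hn hΛ0 hΛ1 (hK.2 n hn (t, h) hth)
  have hcorr0 := corr_nonneg (n := n) (δ := weightNorm ψ n t h)
    (two_mul_log_one_div_nonneg hΛ0 hΛ1)
  refine lt_of_lt_of_le (hκ.trans_lt ?_) (le_multiscaleStat hψ hK hn z hth)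
  generalize corr n (2 * Real.log (1 / weightNorm ψ n t h)) (weightNorm ψ n t h) = G at *
  have hGA : G * (A / √n) ≤ 9 * A := by
    calc G * (A / √n) ≤ 9 * √n * (A / √n) := by gcongr
      _ = 9 * A := by field_simp
  have hκA : κ * (A / √n) ≤ κ * (1 / 2) := by gcongr
  by_contra hcon
  have h3 : |localStat ψ t h (cHatSq z) z| * (1 + A / √n) ≤ (κ + G) * (1 + A / √n) := by
    gcongr
    linarith
  nlinarith

theorem IsVolatility.le_abs_localStat {n : ℕ} (hn : 0 < n)
    {σ : ℝ → ℝ} (hσ : IsVolatility σ) {z : Fin (n + 1) → ℝ} {t h X A : ℝ}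
    (hΛ0 : 0 < weightNorm ψ n t h) (hsmall : A / √n ≤ 1 / 2)
    (hX : X * weightNorm ψ n t h ≤ |signal ψ n t h σ|)
    (hz₁ : |∑ k, weight ψ n t h k *
        (incr z k ^ 2 - ∫ s in ((k : ℝ) / n)..(((k : ℝ) + 1) / n), σ s ^ 2)|
      ≤ weightNorm ψ n t h * A * l2NormSq σ / n)
    (hz₂ : |∑ k : Fin n, (1 : ℝ) *
        (incr z k ^ 2 - ∫ s in ((k : ℝ) / n)..(((k : ℝ) + 1) / n), σ s ^ 2)|
      ≤ √n * A * l2NormSq σ / n) :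
    X - A - A ≤ |localStat ψ t h (cHatSq z) z| * (1 + A / √n) := by
  have hn' : (0 : ℝ) < n := by positivity
  have hsn : 0 < √(n : ℝ) := by positivity
  have hsqn : √(n : ℝ) * √n = n := Real.mul_self_sqrt hn'.le
  have hstat := ConstVol.le_abs_localStat (ψ := ψ) (z := z) (t := t) (h := h) (c := l2NormSq σ)
    (X := X) (A := A) (δ := A / √n)
    (V := fun k => ∫ s in ((k : ℝ) / n)..(((k : ℝ) + 1) / n), σ s ^ 2) hσ.l2NormSq_pos hΛ0 hX
    (by
      have e : ∑ k, weight ψ n t h k * (n *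
            (incr z k ^ 2 - ∫ s in ((k : ℝ) / n)..(((k : ℝ) + 1) / n), σ s ^ 2))
          = n * ∑ k, weight ψ n t h k *
            (incr z k ^ 2 - ∫ s in ((k : ℝ) / n)..(((k : ℝ) + 1) / n), σ s ^ 2) := by
        rw [Finset.mul_sum]
        exact Finset.sum_congr rfl fun k _ => by ring
      rw [e, abs_mul, abs_of_pos hn']
      refine (mul_le_mul_of_nonneg_left hz₁ hn'.le).trans (le_of_eq ?_)
      field_simp)
    (by
      have e : cHatSq z - l2NormSq σ = ∑ k : Fin n, (1 : ℝ) *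
          (incr z k ^ 2 - ∫ s in ((k : ℝ) / n)..(((k : ℝ) + 1) / n), σ s ^ 2) := by
        simp only [one_mul, Finset.sum_sub_distrib,
          sum_integral_blocks hn hσ.intervalIntegrable, cHatSq, l2NormSq]
      rw [e]
      refine hz₂.trans (le_of_eq ?_)
      nth_rewrite 2 [← hsqn]
      field_simp)
    hsmall
  rwa [mul_div_cancel₀ _ hsn.ne'] at hstat

/-- Two exceptional events of probability `2 exp(-η)` each: one for the local functional at `(t,h)`,
one for the total quadratic variation, which has unit weights and `A = √n`. -/
theorem le_power (hψ : IsKernel ψ) {K : ℝ} (hK : IsCalibrationConstant ψ K) {n : ℕ} (hn : 0 < n)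
    {σ : ℝ → ℝ} (hσ : IsVolatility σ) {M : ℝ} (hM0 : 0 < M)
    (hM : ∀ s ∈ Icc (0 : ℝ) 1, σ s ^ 2 ≤ M * l2NormSq σ) {z₀ α κ η t h X : ℝ} (hη : 0 ≤ η)
    (hκ : critValue ψ K z₀ α n ≤ κ) (hκ0 : 0 ≤ κ) (hth : (t, h) ∈ scaleSet n K)
    (hsmall : M * (2 * √η + 2 * η) / √n ≤ 1 / 2)
    (hX : X * weightNorm ψ n t h ≤ |signal ψ n t h σ|)
    (hlarge : corr n (2 * Real.log (1 / weightNorm ψ n t h)) (weightNorm ψ n t h)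
      + (2 * κ + 11 * (M * (2 * √η + 2 * η))) < X) :
    1 - 4 * Real.exp (-η) ≤ power ψ K z₀ α n σ := by
  have hc0 : 0 < l2NormSq σ := hσ.l2NormSq_pos
  have hΛ0 : 0 < weightNorm ψ n t h := hK.weightNorm_pos hn (p := (t, h)) hth
  have hB0 : 0 < M * l2NormSq σ := mul_pos hM0 hc0
  have hA0 : 0 ≤ M * (2 * √η + 2 * η) :=
    mul_nonneg hM0.le (add_nonneg (mul_nonneg zero_le_two (Real.sqrt_nonneg _))
      (mul_nonneg zero_le_two hη))
  have t₁ := hσ.tail hB0 hM hn (weight ψ n t h) hΛ0 hη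
    (weightNorm_sq _ _ _ _).ge
  have t₂ := hσ.tail hB0 hM hn (fun _ => 1) (A := √n)
    (Real.sqrt_pos.2 (Nat.cast_pos.2 hn)) hη (by simp)
  have hE := one_sub_add_le_measureReal_diff (incrementLaw σ n)
    (one_sub_add_le_measureReal_diff (incrementLaw σ n) (A := univ) (a := 0) (by simp) t₁) t₂
  rw [power]
  refine le_trans (by linarith) (hE.trans (measureReal_incrementLaw_le_obsLaw z₀ σ n _ _ ?_))
  rintro z ⟨⟨-, hz₁⟩, hz₂⟩
  simp only [mem_ofPred_eq, not_lt] at hz₁ hz₂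
  have hfin := critValue_lt_multiscaleStat (z := z) hψ hK hn hA0 hκ hκ0 hth hsmall
    hlarge (hσ.le_abs_localStat hn hΛ0 hsmall hX
      (hz₁.trans (le_of_eq (by ring))) (hz₂.trans (le_of_eq (by ring))))
  simp [test, hfin]

/-- The power tends to one uniformly over families whose standardized signal at a suitable
location on the scale `h n` exceeds `√(2 log (1 / h n))` by an amount tending to infinity. -/
theorem tendsto_iInf_power (hψ : IsKernel ψ) {K : ℝ} (hK : IsCalibrationConstant ψ K)
    (z₀ : ℝ) {α : ℝ} (hα : 0 < α) {M : ℝ} (hM0 : 0 < M) (𝒜 : ℕ → Set (ℝ → ℝ)) (h X : ℕ → ℝ)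
    (hne : ∀ᶠ n in atTop, (𝒜 n).Nonempty)
    (h𝒜 : ∀ᶠ n in atTop, ∀ σ ∈ 𝒜 n, IsVolatility σ ∧
      (∀ s ∈ Icc (0 : ℝ) 1, σ s ^ 2 ≤ M * l2NormSq σ) ∧
      ∃ t, (t, h n) ∈ scaleSet n K ∧ X n * weightNorm ψ n t (h n) ≤ |signal ψ n t (h n) σ|)
    (hX : Tendsto (fun n => X n - √(2 * Real.log (1 / h n))) atTop atTop)
    (hh : ∀ B : ℝ, ∀ᶠ n : ℕ in atTop, B * Real.log n ^ 2 ≤ n * h n) :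
    Tendsto (fun n => ⨅ σ : 𝒜 n, power ψ K z₀ α n σ) atTop (𝓝 1) := by
  obtain ⟨κ, hκ0, hκ⟩ := exists_critValue_le hψ hK hα
  obtain ⟨c, hc, hc1, hcΛ⟩ := hψ.exists_le_weightNorm_sq hK
  have hpow0 : ∀ n σ, 0 ≤ power ψ K z₀ α n σ := fun n σ => measureReal_nonneg
  have hbdd : ∀ n, BddBelow (range fun σ : 𝒜 n => power ψ K z₀ α n σ) := fun n =>
    ⟨0, by rintro _ ⟨σ, rfl⟩; exact hpow0 n σ⟩
  rw [tendsto_order]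
  constructor
  · intro r hr
    obtain ⟨η, hη, hηδ⟩ := exists_two_mul_exp_neg_le 4 (half_pos (sub_pos.2 hr))
    set A := M * (2 * √η + 2 * η) with hA
    have hlim : Tendsto (fun n : ℕ => A / √(n : ℝ)) atTop (𝓝 0) :=
      tendsto_const_nhds.div_atTop (Real.tendsto_sqrt_atTop.comp tendsto_natCast_atTop_atTop)
    filter_upwards [hκ, hne, h𝒜, hh (4 / c), eventually_gt_atTop 0,
      hlim.eventually (ge_mem_nhds (by norm_num : (0 : ℝ) < 1 / 2)),
      hX.eventually_gt_atTop (√(2 * Real.log (1 / c)) + 1 + (2 * κ + 11 * A))]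
      with n hκn hnen h𝒜n hhn hn hsmall hXn
    -- The real infimum over an empty family is 0, so the limit 1 requires nonempty families.
    have : Nonempty (𝒜 n) := hnen.to_subtype
    refine lt_of_lt_of_le (b := 1 - 4 * Real.exp (-η)) (by linarith) (le_ciInf fun ⟨σ, hσ⟩ => ?_)
    obtain ⟨hvol, hMσ, t, hth, hsig⟩ := h𝒜n σ hσ
    have hh0 : 0 < h n := lt_of_lt_of_le (div_pos hK.1 (by positivity)) hth.1.1
    refine le_power hψ hK hn hvol hM0 hMσ hη (hκn z₀) hκ0 hth hsmall hsig ?_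
    have hG := corr_le_sqrt_log hn (hK.weightNorm_pos hn (p := (t, h n)) hth) (hψ.weightNorm_le_one n t (h n))
      (hK.2 n hn (t, h n) hth) hc hc1 hh0 (by linarith [hth.1.2]) (hcΛ n hn (t, h n) hth) (by
        rw [div_mul_eq_mul_div, div_le_iff₀ hc] at hhn
        linarith)
    simp only at hG
    linarith
  · intro r hr
    filter_upwards [hne] with n hnen
    obtain ⟨σ, hσ⟩ := hnen
    exact (ciInf_le (hbdd n) ⟨σ, hσ⟩).trans_lt ((power_le_one _ _ _ _ _ _).trans_lt hr)


/-! ### Hölder functions and polynomials -/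

/-- The polynomial with coefficients `c`. -/
def polyVal {m : ℕ} (c : Fin (m + 1) → ℝ) (u : ℝ) : ℝ := ∑ i, c i * u ^ (i : ℕ)

theorem continuous_polyVal {m : ℕ} (c : Fin (m + 1) → ℝ) : Continuous (polyVal c) := by
  unfold polyVal
  fun_prop

/-- Coefficients are recovered from the values at `m + 1` distinct nodes by inverting a Vandermonde
matrix. -/
theorem exists_coeff_bound (m : ℕ) : ∃ C : ℝ, 0 ≤ C ∧ ∀ (c : Fin (m + 1) → ℝ) (N : ℝ),
    (∀ w ∈ Icc (0 : ℝ) 1, |polyVal c w| ≤ N) → ∀ k, |c k| ≤ C * N := by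
  set v : Fin (m + 1) → ℝ := fun i => (i : ℝ) / (m + 1) with hv
  have hm : (0 : ℝ) < (m : ℝ) + 1 := by positivity
  have hinj : Function.Injective v := fun i j hij => by
    simp only [hv] at hij
    rw [div_left_inj' hm.ne'] at hij
    exact Fin.ext (by exact_mod_cast hij)
  have hv01 : ∀ i, v i ∈ Icc (0 : ℝ) 1 := fun i => by
    refine ⟨by positivity, ?_⟩
    simp only [hv]
    rw [div_le_one hm]
    exact_mod_cast i.2.le
  set V := Matrix.vandermonde v with hV
  have hdet : IsUnit V.det := isUnit_iff_ne_zero.2 (Matrix.det_vandermonde_ne_zero_iff.2 hinj)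
  refine ⟨∑ k, ∑ i, |V⁻¹ k i|, by positivity, fun c N hN k => ?_⟩
  have h1 : V.mulVec c = fun i => polyVal c (v i) := by
    funext i
    simp only [Matrix.mulVec, dotProduct, polyVal, hV, Matrix.vandermonde_apply]
    exact Finset.sum_congr rfl fun j _ => mul_comm _ _
  have h2 : c = V⁻¹.mulVec fun i => polyVal c (v i) := by
    rw [← h1, Matrix.mulVec_mulVec, Matrix.nonsing_inv_mul _ hdet, Matrix.one_mulVec]
  have hN0 : 0 ≤ N := (abs_nonneg _).trans (hN 0 (by simp))
  calc |c k| = |∑ i, V⁻¹ k i * polyVal c (v i)| := by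
        conv_lhs => rw [h2]
        rfl
    _ ≤ ∑ i, |V⁻¹ k i * polyVal c (v i)| := Finset.abs_sum_le_sum_abs _ _
    _ ≤ ∑ i, |V⁻¹ k i| * N := by
        refine Finset.sum_le_sum fun i _ => ?_
        rw [abs_mul]
        exact mul_le_mul_of_nonneg_left (hN _ (hv01 i)) (abs_nonneg _)
    _ = (∑ i, |V⁻¹ k i|) * N := by rw [Finset.sum_mul]
    _ ≤ (∑ k, ∑ i, |V⁻¹ k i|) * N := by
        refine mul_le_mul_of_nonneg_right ?_ hN0
        exact Finset.single_le_sum (f := fun k => ∑ i, |V⁻¹ k i|)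
          (fun _ _ => Finset.sum_nonneg fun _ _ => abs_nonneg _) (Finset.mem_univ k)

theorem abs_pow_sub_pow_le_mul {u w : ℝ} (hu : u ∈ Icc (0 : ℝ) 1) (hw : w ∈ Icc (0 : ℝ) 1)
    (i : ℕ) : |u ^ i - w ^ i| ≤ i * |u - w| := by
  refine (abs_pow_sub_pow_le (a := u) (b := w) (n := i)).trans ?_
  have : max |u| |w| ^ (i - 1) ≤ 1 := by
    refine pow_le_one₀ (le_max_of_le_left (abs_nonneg _)) (max_le ?_ ?_)
    · rw [abs_of_nonneg hu.1]; exact hu.2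
    · rw [abs_of_nonneg hw.1]; exact hw.2
  calc |u - w| * i * max |u| |w| ^ (i - 1) ≤ |u - w| * i * 1 := by gcongr
    _ = i * |u - w| := by ring

theorem exists_polyVal_lipschitz (m : ℕ) : ∃ D : ℝ, 0 ≤ D ∧ ∀ (c : Fin (m + 1) → ℝ) (N : ℝ),
    (∀ w ∈ Icc (0 : ℝ) 1, |polyVal c w| ≤ N) → ∀ u ∈ Icc (0 : ℝ) 1, ∀ w ∈ Icc (0 : ℝ) 1,
      |polyVal c u - polyVal c w| ≤ D * N * |u - w| := by
  obtain ⟨C, hC, h⟩ := exists_coeff_bound m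
  refine ⟨∑ i : Fin (m + 1), C * (i : ℕ), by positivity, fun c N hN u hu w hw => ?_⟩
  have hN0 : 0 ≤ N := (abs_nonneg _).trans (hN 0 (by simp))
  rw [polyVal, polyVal, ← Finset.sum_sub_distrib, Finset.sum_mul, Finset.sum_mul]
  refine (Finset.abs_sum_le_sum_abs _ _).trans (Finset.sum_le_sum fun i _ => ?_)
  rw [← mul_sub, abs_mul]
  calc |c i| * |u ^ (i : ℕ) - w ^ (i : ℕ)| ≤ (C * N) * ((i : ℕ) * |u - w|) :=
        mul_le_mul (h c N hN i) (abs_pow_sub_pow_le_mul hu hw _) (abs_nonneg _) (by positivity)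
    _ = _ := by ring

/-- A polynomial of bounded degree is comparable to its maximum over `[0,1]`, with a constant sign,
on a subinterval whose length depends on the degree only. -/
theorem exists_interval_polyVal_large (m : ℕ) : ∃ τ : ℝ, 0 < τ ∧ τ ≤ 1 / 2 ∧
    ∀ c : Fin (m + 1) → ℝ, ∃ v s : ℝ, |s| = 1 ∧ v ∈ Icc τ (1 - τ) ∧
      ∀ u ∈ Icc (v - τ) (v + τ), ∀ w ∈ Icc (0 : ℝ) 1,
        3 / 4 * |polyVal c w| ≤ s * polyVal c u := by
  obtain ⟨D, hD, h⟩ := exists_polyVal_lipschitz m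
  set τ := min (1 / 2) (1 / (8 * (D + 1))) with hτ
  have hτ0 : 0 < τ := by positivity
  have hτ2 : τ ≤ 1 / 2 := min_le_left _ _
  have hτD : D * (2 * τ) ≤ 1 / 4 := by
    have h1 : τ ≤ 1 / (8 * (D + 1)) := min_le_right _ _
    rw [le_div_iff₀ (by positivity)] at h1
    nlinarith
  refine ⟨τ, hτ0, hτ2, fun c => ?_⟩
  obtain ⟨u₀, hu₀, hmax⟩ := isCompact_Icc.exists_isMaxOn (nonempty_Icc.2 (zero_le_one (α := ℝ)))
    (continuous_polyVal c).abs.continuousOn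
  have hN : ∀ w ∈ Icc (0 : ℝ) 1, |polyVal c w| ≤ |polyVal c u₀| := fun w hw => hmax hw
  obtain ⟨s, hs, hs'⟩ : ∃ s : ℝ, |s| = 1 ∧ s * polyVal c u₀ = |polyVal c u₀| := by
    rcases le_total 0 (polyVal c u₀) with h0 | h0
    · exact ⟨1, by simp, by rw [abs_of_nonneg h0, one_mul]⟩
    · exact ⟨-1, by simp, by rw [abs_of_nonpos h0]; ring⟩
  -- The centre is the maximizer clipped into `[τ, 1 - τ]`. Clipping moves it by at most `τ`, so the
  -- whole subinterval is within `2τ` of the maximizer, where the polynomial changes by at most a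
  -- quarter of its maximum.
  refine ⟨max τ (min u₀ (1 - τ)), s, hs,
    ⟨le_max_left _ _, max_le (by linarith) (min_le_right _ _)⟩, fun u hu w hw => ?_⟩
  have hv1 : τ ≤ max τ (min u₀ (1 - τ)) := le_max_left _ _
  have hv2 : max τ (min u₀ (1 - τ)) ≤ 1 - τ := max_le (by linarith) (min_le_right _ _)
  have hv3 : |max τ (min u₀ (1 - τ)) - u₀| ≤ τ := by
    rw [abs_le]
    rcases le_total u₀ (1 - τ) with h1 | h1
    · rw [min_eq_left h1]
      rcases le_total τ u₀ with h2 | h2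
      · rw [max_eq_right h2]
        constructor <;> linarith
      · rw [max_eq_left h2]
        constructor <;> linarith [hu₀.1]
    · rw [min_eq_right h1, max_eq_right (by linarith)]
      constructor <;> linarith [hu₀.2]
  have hu01 : u ∈ Icc (0 : ℝ) 1 := ⟨by linarith [hu.1], by linarith [hu.2]⟩
  have hdist : |u - u₀| ≤ 2 * τ := by
    have := abs_le.1 hv3
    rw [abs_le]
    constructor <;> linarith [hu.1, hu.2, this.1, this.2]
  have hlip := h c _ hN u hu01 u₀ hu₀
  have h3 : |s * polyVal c u - s * polyVal c u₀| ≤ 1 / 4 * |polyVal c u₀| := by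
    rw [← mul_sub, abs_mul, hs, one_mul]
    refine hlip.trans ?_
    calc D * |polyVal c u₀| * |u - u₀| ≤ D * |polyVal c u₀| * (2 * τ) := by gcongr
      _ = D * (2 * τ) * |polyVal c u₀| := by ring
      _ ≤ _ := by gcongr
  have h4 := (abs_le.1 h3).1
  have h5 := hN w hw
  rw [hs'] at h4
  linarith

/-! ### Local approximation of Hölder functions by polynomials of fixed degree -/

theorem natCeil_pred_lt {β : ℝ} (hβ : 0 < β) : ((⌈β⌉₊ - 1 : ℕ) : ℝ) < β := by
  have h1 : 1 ≤ ⌈β⌉₊ := Nat.one_le_ceil_iff.2 hβ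
  rw [Nat.cast_sub h1]
  have := Nat.ceil_lt_add_one hβ.le
  push_cast
  linarith

theorem le_natCeil_pred_add_one {β : ℝ} (hβ : 0 < β) : β ≤ ((⌈β⌉₊ - 1 : ℕ) : ℝ) + 1 := by
  have h1 : 1 ≤ ⌈β⌉₊ := Nat.one_le_ceil_iff.2 hβ
  rw [Nat.cast_sub h1]
  have := Nat.le_ceil β
  push_cast
  linarith

/-- The Lagrange remainder carries the derivative of order `m` at an intermediate point; the Hölder
condition moves it back to `t`. -/
theorem abs_sub_taylor_le {β L : ℝ} (hβ : 0 < β) (hL : 0 ≤ L) {F : ℝ → ℝ}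
    (hF : F ∈ holderClass β L) (t : ℝ) {y : ℝ} (hy : 0 ≤ y) :
    |F (t + y) - ∑ i ∈ Finset.range (⌈β⌉₊ - 1 + 1),
      ((i.factorial : ℝ)⁻¹ * y ^ i) * iteratedDeriv i F t| ≤ L * y ^ β := by
  have hmβ := natCeil_pred_lt hβ
  obtain ⟨hcd, hhol⟩ := hF
  generalize ⌈β⌉₊ - 1 = m at *
  rcases hy.eq_or_lt with rfl | hy
  · rw [Finset.sum_range_succ']
    simp [Real.zero_rpow hβ.ne']
  rw [Finset.sum_range_succ]
  obtain ⟨ξ, hξ, hξy, he⟩ : ∃ ξ, t ≤ ξ ∧ ξ ≤ t + y ∧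
      F (t + y) - ∑ i ∈ Finset.range m, ((i.factorial : ℝ)⁻¹ * y ^ i) * iteratedDeriv i F t
        = ((m.factorial : ℝ)⁻¹ * y ^ m) * iteratedDeriv m F ξ := by
    cases m with
    | zero => exact ⟨t + y, by linarith, le_rfl, by simp⟩
    | succ n =>
      have hne : t ≠ t + y := by linarith
      obtain ⟨ξ, hξ, h1⟩ := taylor_mean_remainder_lagrange_iteratedDeriv (n := n) hne
        (f := F) (by exact_mod_cast hcd.contDiffOn)
      rw [uIoo_of_lt (by linarith)] at hξ
      refine ⟨ξ, hξ.1.le, hξ.2.le, ?_⟩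
      have h2 : ∀ i ∈ Finset.range (n + 1),
          ((i.factorial : ℝ)⁻¹ * (t + y - t) ^ i) • iteratedDerivWithin i F (uIcc t (t + y)) t
            = ((i.factorial : ℝ)⁻¹ * y ^ i) * iteratedDeriv i F t := fun i hi => by
        rw [iteratedDerivWithin_eq_iteratedDeriv (uniqueDiffOn_uIcc hne) ?_ left_mem_uIcc,
          smul_eq_mul, add_sub_cancel_left]
        refine (hcd.of_le ?_).contDiffAt
        exact_mod_cast (Finset.mem_range.1 hi).le
      rw [taylor_within_apply, Finset.sum_congr rfl h2, add_sub_cancel_left] at h1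
      rw [h1]
      ring
  rw [← sub_sub, he, ← mul_sub, abs_mul]
  have h3 : |((m.factorial : ℝ)⁻¹ * y ^ m)| ≤ y ^ (m : ℝ) := by
    rw [abs_of_nonneg (by positivity), Real.rpow_natCast]
    refine mul_le_of_le_one_left (by positivity) (inv_le_one_of_one_le₀ ?_)
    exact_mod_cast m.factorial_pos
  calc |((m.factorial : ℝ)⁻¹ * y ^ m)| * |iteratedDeriv m F ξ - iteratedDeriv m F t|
      ≤ y ^ (m : ℝ) * (L * y ^ (β - m)) := by
        refine mul_le_mul h3 ((hhol ξ t).trans ?_) (abs_nonneg _) (by positivity)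
        refine mul_le_mul_of_nonneg_left (Real.rpow_le_rpow (abs_nonneg _) ?_ (by linarith)) hL
        rw [abs_of_nonneg (by linarith)]
        linarith
    _ = L * y ^ β := by
        rw [mul_left_comm, ← Real.rpow_add hy]
        ring_nf

theorem exists_polyVal_approx {β L : ℝ} (hβ : 0 < β) (hL : 0 ≤ L) {F : ℝ → ℝ}
    (hF : F ∈ holderClass β L) (t b : ℝ) {H : ℝ} (hH : 0 ≤ H) :
    ∃ c : Fin (⌈β⌉₊ - 1 + 1) → ℝ, ∀ u ∈ Icc (0 : ℝ) 1,
      |F (t + H * u) - b - polyVal c u| ≤ L * H ^ β := by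
  refine ⟨fun i => (((i : ℕ).factorial : ℝ)⁻¹ * H ^ (i : ℕ)) * iteratedDeriv i F t
    - if (i : ℕ) = 0 then b else 0, fun u hu => ?_⟩
  have h1 := abs_sub_taylor_le hβ hL hF t (mul_nonneg hH hu.1)
  have h2 : polyVal (fun i : Fin (⌈β⌉₊ - 1 + 1) => (((i : ℕ).factorial : ℝ)⁻¹ * H ^ (i : ℕ))
      * iteratedDeriv i F t - if (i : ℕ) = 0 then b else 0) u
      = (∑ i ∈ Finset.range (⌈β⌉₊ - 1 + 1),
        ((i.factorial : ℝ)⁻¹ * (H * u) ^ i) * iteratedDeriv i F t) - b := by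
    rw [← Fin.sum_univ_eq_sum_range
      (fun i => ((i.factorial : ℝ)⁻¹ * (H * u) ^ i) * iteratedDeriv i F t), polyVal]
    have h3 : b = ∑ i : Fin (⌈β⌉₊ - 1 + 1), (if (i : ℕ) = 0 then b else 0) * u ^ (i : ℕ) := by
      rw [Fin.sum_univ_succ]
      simp
    conv_rhs => rw [h3]
    rw [← Finset.sum_sub_distrib]
    refine Finset.sum_congr rfl fun i _ => ?_
    ring
  rw [h2, sub_sub_sub_cancel_right]
  refine h1.trans (mul_le_mul_of_nonneg_left (Real.rpow_le_rpow (mul_nonneg hH hu.1) ?_ hβ.le) hL)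
  exact mul_le_of_le_one_right hH hu.2

theorem continuous_of_mem_holderClass {β L : ℝ} {F : ℝ → ℝ} (hF : F ∈ holderClass β L) :
    Continuous F := hF.1.continuous

/-- Probability densities on `[0,1]` in a Hölder class are uniformly bounded. -/
theorem exists_bound_of_mem_holderClass {β L : ℝ} (hβ : 0 < β) (hL : 0 ≤ L) :
    ∃ M : ℝ, 0 < M ∧ ∀ g ∈ holderClass β L, (∀ t ∈ Icc (0 : ℝ) 1, 0 ≤ g t) →
      ∫ t in (0 : ℝ)..1, g t = 1 → ∀ t ∈ Icc (0 : ℝ) 1, g t ≤ M := by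
  obtain ⟨τ, hτ0, hτ2, h⟩ := exists_interval_polyVal_large (⌈β⌉₊ - 1)
  refine ⟨4 / 3 * (1 / (2 * τ) + L) + L, by positivity, fun g hg hg0 hInt t ht => ?_⟩
  obtain ⟨c, hc⟩ := exists_polyVal_approx hβ hL hg 0 0 (zero_le_one (α := ℝ))
  simp only [zero_add, one_mul, sub_zero, Real.one_rpow, mul_one] at hc
  obtain ⟨v, s, hs, hv, hlarge⟩ := h c
  have hgt : g t ≤ |polyVal c t| + L := by
    have := (abs_le.1 (hc t ht)).2
    linarith [le_abs_self (polyVal c t)]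
  have hvmem : v ∈ Icc (v - τ) (v + τ) := ⟨by linarith, by linarith⟩
  have hsub : Icc (v - τ) (v + τ) ⊆ Icc (0 : ℝ) 1 :=
    Icc_subset_Icc (by linarith [hv.1]) (by linarith [hv.2])
  suffices |polyVal c t| ≤ 4 / 3 * (1 / (2 * τ) + L) by linarith
  -- If the polynomial is positive on the subinterval, total mass one bounds it there; if it is
  -- negative, nonnegativity of `g` does.
  rcases eq_or_eq_neg_of_abs_eq hs with rfl | rfl
  · have hcont := continuous_of_mem_holderClass hg
    have h1 : ∫ _u in (v - τ)..(v + τ), (3 / 4 * |polyVal c t| - L) ≤ ∫ u in (v - τ)..(v + τ), g u :=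
      intervalIntegral.integral_mono_on (by linarith) (by simp) (hcont.intervalIntegrable _ _)
        fun u hu => by
          have h2 := hlarge u hu t ht
          have h3 := (abs_le.1 (hc u (hsub hu))).1
          linarith
    have h4 : ∫ u in (v - τ)..(v + τ), g u ≤ ∫ u in (0 : ℝ)..1, g u := by
      refine intervalIntegral.integral_mono_interval (by linarith [hv.1]) (by linarith)
        (by linarith [hv.2]) ?_ (hcont.intervalIntegrable _ _)
      refine (ae_restrict_iff' measurableSet_Ioc).2 (ae_of_all _ fun u hu => ?_)
      exact hg0 u ⟨hu.1.le, hu.2⟩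
    rw [intervalIntegral.integral_const, smul_eq_mul] at h1
    rw [hInt] at h4
    have h5 : 3 / 4 * |polyVal c t| - L ≤ 1 / (2 * τ) := by
      rw [le_div_iff₀ (by positivity)]
      linarith
    linarith
  · have h2 := hlarge v hvmem t ht
    have h3 := (abs_le.1 (hc v (hsub hvmem))).2
    have h4 := hg0 v (hsub hvmem)
    have h5 : 0 < 1 / (2 * τ) := by positivity
    linarith

/-- A function in a Hölder class that deviates from one at `t` does so, with constant sign, on an
interval close to `t`. -/
theorem exists_interval_deviation {β : ℝ} (hβ : 0 < β) :
    ∃ τ : ℝ, 0 < τ ∧ τ ≤ 1 / 2 ∧ ∀ (L : ℝ) (g : ℝ → ℝ) (t H d : ℝ), 0 ≤ L →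
      g ∈ holderClass β L → 0 ≤ H → L * H ^ β ≤ d / 16 → d ≤ |g t - 1| →
      ∃ v s : ℝ, |s| = 1 ∧ v ∈ Icc τ (1 - τ) ∧
        ∀ u ∈ Icc (v - τ) (v + τ), d / 2 ≤ s * (g (t + H * u) - 1) := by
  obtain ⟨τ, hτ0, hτ2, h⟩ := exists_interval_polyVal_large (⌈β⌉₊ - 1)
  refine ⟨τ, hτ0, hτ2, fun L g t H d hL hg hH hLd hd => ?_⟩
  obtain ⟨c, hc⟩ := exists_polyVal_approx hβ hL hg t 1 hH
  obtain ⟨v, s, hs, hv, hlarge⟩ := h c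
  refine ⟨v, s, hs, hv, fun u hu => ?_⟩
  have hu01 : u ∈ Icc (0 : ℝ) 1 := ⟨by linarith [hu.1, hv.1], by linarith [hu.2, hv.2]⟩
  have h1 := hlarge u hu 0 (by simp)
  have h2 := hc 0 (by simp)
  rw [mul_zero, add_zero] at h2
  have h3 : |g t - 1| ≤ |g t - 1 - polyVal c 0| + |polyVal c 0| := by
    have := abs_add_le (g t - 1 - polyVal c 0) (polyVal c 0)
    rwa [sub_add_cancel] at this
  have h4 : |s * (g (t + H * u) - 1 - polyVal c u)| ≤ L * H ^ β := by
    rw [abs_mul, hs, one_mul]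
    exact hc u hu01
  have h5 := (abs_le.1 h4).1
  have h6 : 0 ≤ L * H ^ β := by positivity
  rw [mul_sub s (g (t + H * u) - 1)] at h5
  -- The constant 16 leaves `(3/4)(1 - 1/16) - 1/16 = 41/64 ≥ 1/2`.
  linarith

/-! ### The alternatives are nonempty -/

theorem iteratedDeriv_cos_affine (w φ : ℝ) (m : ℕ) :
    iteratedDeriv m (fun x => Real.cos (w * x + φ))
      = fun x => w ^ m * Real.cos (w * x + φ + m * (Real.pi / 2)) := by
  induction m with
  | zero => simp
  | succ m ih =>
    rw [iteratedDeriv_succ, ih]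
    funext x
    have h1 : HasDerivAt (fun x => w * x + φ + m * (Real.pi / 2)) w x := by
      simpa using (((hasDerivAt_id x).const_mul w).add_const φ).add_const (m * (Real.pi / 2))
    have h2 := (h1.cos.const_mul (w ^ m)).deriv
    rw [h2]
    push_cast
    rw [show w * x + φ + (m + 1) * (Real.pi / 2) = w * x + φ + m * (Real.pi / 2) + Real.pi / 2 by
      ring, Real.cos_add_pi_div_two]
    ring

/-- The Lipschitz bound is used for `|x - y| ≤ 1`, the trivial bound 2 otherwise. -/
theorem abs_cos_sub_cos_le_rpow {w s : ℝ} (hs0 : 0 < s) (hs1 : s ≤ 1) (φ x y : ℝ) :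
    |Real.cos (w * x + φ) - Real.cos (w * y + φ)| ≤ (2 + |w|) * |x - y| ^ s := by
  have hr : 0 ≤ |x - y| ^ s := by positivity
  rcases le_total |x - y| 1 with h | h
  · have h1 := Real.abs_cos_sub_cos_le (w * x + φ) (w * y + φ)
    have h2 : |x - y| ≤ |x - y| ^ s := by
      calc |x - y| = |x - y| ^ (1 : ℝ) := (Real.rpow_one _).symm
        _ ≤ |x - y| ^ s := by
          rcases (abs_nonneg (x - y)).eq_or_lt with h0 | h0
          · rw [← h0, Real.zero_rpow one_ne_zero, Real.zero_rpow hs0.ne']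
          · exact Real.rpow_le_rpow_of_exponent_ge h0 h hs1
    rw [show w * x + φ - (w * y + φ) = w * (x - y) by ring, abs_mul] at h1
    nlinarith [mul_le_mul_of_nonneg_left h2 (abs_nonneg w)]
  · have h1 : |Real.cos (w * x + φ) - Real.cos (w * y + φ)| ≤ 2 := by
      refine (abs_sub _ _).trans ?_
      linarith [Real.abs_cos_le_one (w * x + φ), Real.abs_cos_le_one (w * y + φ)]
    have h2 : 1 ≤ |x - y| ^ s := Real.one_le_rpow h hs0.le
    nlinarith [abs_nonneg w]

theorem one_add_cos_mem_holderClass {β L δ w φ : ℝ} (hβ : 0 < β) (hδ : 0 ≤ δ)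
    (hδL : δ * (|w| ^ (⌈β⌉₊ - 1) * (2 + |w|)) ≤ L) :
    (fun x => 1 + δ * Real.cos (w * x + φ)) ∈ holderClass β L := by
  refine ⟨by fun_prop, fun x y => ?_⟩
  have hm1 := natCeil_pred_lt hβ
  have hm2 := le_natCeil_pred_add_one hβ
  generalize ⌈β⌉₊ - 1 = m at *
  have h1 : ∀ x y, iteratedDeriv m (fun x => 1 + δ * Real.cos (w * x + φ)) x
      - iteratedDeriv m (fun x => 1 + δ * Real.cos (w * x + φ)) y
      = δ * (w ^ m * (Real.cos (w * x + (φ + m * (Real.pi / 2)))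
        - Real.cos (w * y + (φ + m * (Real.pi / 2))))) := by
    intro x y
    rcases Nat.eq_zero_or_pos m with rfl | hm
    · simp
      ring
    · rw [iteratedDeriv_const_add hm, iteratedDeriv_const_add hm, iteratedDeriv_const_mul_field,
        iteratedDeriv_const_mul_field, iteratedDeriv_cos_affine]
      simp only [add_assoc]
      ring
  rw [h1, abs_mul, abs_mul, abs_of_nonneg hδ, abs_pow]
  calc δ * (|w| ^ m * |_|)
      ≤ δ * (|w| ^ m * ((2 + |w|) * |x - y| ^ (β - m))) := by
        gcongr
        exact abs_cos_sub_cos_le_rpow (by linarith) (by linarith) _ _ _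
    _ = δ * (|w| ^ m * (2 + |w|)) * |x - y| ^ (β - m) := by ring
    _ ≤ _ := by gcongr

/-- The witness is `σ² = 1 + δ cos (2π (x - a))`: the cosine integrates to zero over a full period,
so `‖σ‖² = 1`, and the deviation at `a` is `δ`. -/
theorem exists_nonempty_alternatives {β L : ℝ} (hβ : 0 < β) (hL : 0 < L) {a b : ℝ}
    (hab : a ≤ b) : ∃ r₀ : ℝ, 0 < r₀ ∧ ∀ r ≤ r₀, (alternatives β L (Icc a b) r).Nonempty := by
  set w := 2 * Real.pi with hw
  have hw0 : 0 < w := by positivity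
  set B := |w| ^ (⌈β⌉₊ - 1) * (2 + |w|) with hB
  have hB0 : 0 < B := by
    have : 0 < |w| := abs_pos.2 hw0.ne'
    positivity
  set δ := min (1 / 2) (L / B) with hδ
  have hδ0 : 0 < δ := by positivity
  have hδ1 : δ ≤ 1 / 2 := min_le_left _ _
  set φ := -(w * a) with hφ
  set f : ℝ → ℝ := fun x => 1 + δ * Real.cos (w * x + φ) with hf
  have hf0 : ∀ x, 0 < f x := fun x => by
    have := Real.neg_one_le_cos (w * x + φ)
    simp only [hf]
    nlinarith
  have hfc : Continuous f := by
    simp only [hf]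
    fun_prop
  have hsq : ∀ x, √(f x) ^ 2 = f x := fun x => Real.sq_sqrt (hf0 x).le
  have hInt : ∫ x in (0 : ℝ)..1, f x = 1 := by
    simp only [hf]
    rw [intervalIntegral.integral_add (by simp) (Continuous.intervalIntegrable (by fun_prop) _ _),
      intervalIntegral.integral_const_mul, intervalIntegral.integral_comp_mul_add (f := Real.cos)
        hw0.ne', integral_cos]
    have : Real.sin (w * 1 + φ) = Real.sin (w * 0 + φ) := by
      rw [mul_one, mul_zero, zero_add, add_comm, hw, Real.sin_add_two_pi]
    rw [this]
    simp
  have hl2 : l2NormSq (fun x => √(f x)) = 1 := by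
    simp only [l2NormSq, hsq, hInt]
  refine ⟨δ, hδ0, fun r hr => ⟨fun x => √(f x), ⟨?_, fun t _ => Real.sqrt_pos.2 (hf0 t), ?_⟩,
    ⟨f, one_add_cos_mem_holderClass hβ hδ0.le ?_, fun t _ => ?_⟩, ?_⟩⟩
  · exact (Real.continuous_sqrt.comp hfc).measurable
  · simp only [hsq]
    exact hfc.continuousOn.integrableOn_Icc
  · have : δ ≤ L / B := min_le_right _ _
    rwa [le_div_iff₀ hB0] at this
  · rw [hl2, div_one, hsq]
  · have hdev : ∀ t, √(f t) ^ 2 / l2NormSq (fun x => √(f x)) - 1 = δ * Real.cos (w * t + φ) :=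
      fun t => by
        rw [hl2, div_one, hsq]
        simp only [hf]
        ring
    rw [devDist]
    simp only [hdev]
    have hbdd : BddAbove (range fun t : Icc a b => |δ * Real.cos (w * t + φ)|) := by
      refine ⟨δ, ?_⟩
      rintro _ ⟨t, rfl⟩
      simp only
      rw [abs_mul, abs_of_pos hδ0]
      exact mul_le_of_le_one_right hδ0.le (Real.abs_cos_le_one _)
    refine hr.trans (le_trans (le_of_eq ?_) (le_ciSup hbdd ⟨a, left_mem_Icc.2 hab⟩))
    rw [hφ, add_neg_cancel, Real.cos_zero, mul_one, abs_of_pos hδ0]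


/-! ### Lower bounds for the signal -/

theorem integral_block_eq {σ g : ℝ → ℝ} (hg : ∀ t ∈ Icc (0 : ℝ) 1, g t = σ t ^ 2 / l2NormSq σ)
    {n : ℕ} (k : Fin n) :
    n * (∫ s in ((k : ℝ) / n)..(((k : ℝ) + 1) / n), σ s ^ 2) / l2NormSq σ
      = n * ∫ s in ((k : ℝ) / n)..(((k : ℝ) + 1) / n), g s := by
  rw [mul_div_assoc, ← intervalIntegral.integral_div]
  congr 1
  refine intervalIntegral.integral_congr fun s hs => ?_
  rw [uIcc_of_le (block_le n k)] at hs
  exact (hg s (block_subset k hs)).symm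

/-- `φ` is a continuous minorant, where the kernel is positive, of the signed deviation of the block
means of `g`; it turns the discrete sum into an integral against the kernel. -/
theorem IsKernel.le_abs_signal (hψ : IsKernel ψ) {σ g φ : ℝ → ℝ} (hφ : Continuous φ)
    (hg : ∀ t ∈ Icc (0 : ℝ) 1, g t = σ t ^ 2 / l2NormSq σ) {n : ℕ} (hn : 0 < n) {t h s : ℝ}
    (hs : |s| = 1)
    (hφg : ∀ k : Fin n, ∀ x ∈ Icc ((k : ℝ) / n) (((k : ℝ) + 1) / n),
      ψ ((x - t) / h) * φ x ≤ ψ ((x - t) / h) *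
        (s * (n * (∫ y in ((k : ℝ) / n)..(((k : ℝ) + 1) / n), g y) - 1))) :
    (√2)⁻¹ * (√n * ∫ x in (0 : ℝ)..1, ψ ((x - t) / h) * φ x) ≤ |signal ψ n t h σ| := by
  have hc := hψ.continuous
  rw [signal, abs_mul, abs_of_nonneg (by positivity : 0 ≤ (√2 : ℝ)⁻¹)]
  refine mul_le_mul_of_nonneg_left ?_ (by positivity)
  simp_rw [integral_block_eq hg]
  have h1 : ∀ y : ℝ, s * y ≤ |y| := fun y => by
    refine (le_abs_self _).trans (le_of_eq ?_)
    rw [abs_mul, hs, one_mul]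
  refine le_trans ?_ (h1 _)
  rw [← sum_integral_blocks hn (Continuous.intervalIntegrable (by fun_prop) _ _), Finset.mul_sum,
    Finset.mul_sum]
  refine Finset.sum_le_sum fun k _ => ?_
  rw [weight, mul_left_comm s, mul_assoc]
  refine mul_le_mul_of_nonneg_left ?_ (Real.sqrt_nonneg _)
  rw [← intervalIntegral.integral_mul_const]
  exact intervalIntegral.integral_mono_on (block_le n k)
    (Continuous.intervalIntegrable (by fun_prop) _ _)
    (Continuous.intervalIntegrable (by fun_prop) _ _) (hφg k)

theorem le_mul_integral_block_sub_one {g : ℝ → ℝ} (hg : Continuous g) {n : ℕ} (hn : 0 < n)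
    (k : Fin n) {s r : ℝ}
    (h : ∀ y ∈ Icc ((k : ℝ) / n) (((k : ℝ) + 1) / n), r ≤ s * (g y - 1)) :
    r ≤ s * (n * (∫ y in ((k : ℝ) / n)..(((k : ℝ) + 1) / n), g y) - 1) := by
  have hn' : (n : ℝ) ≠ 0 := by positivity
  have h1 := intervalIntegral.integral_mono_on (μ := volume) (block_le n k)
    (intervalIntegrable_const (c := r))
    (Continuous.intervalIntegrable (u := fun y => s * (g y - 1)) (by fun_prop) _ _) h
  rw [intervalIntegral.integral_const, block_length, intervalIntegral.integral_const_mul,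
    intervalIntegral.integral_sub (hg.intervalIntegrable _ _) (by simp),
    intervalIntegral.integral_const, block_length, smul_eq_mul, smul_eq_mul] at h1
  have h2 := mul_le_mul_of_nonneg_left h1 (Nat.cast_nonneg n)
  have e1 : (n : ℝ) * (1 / n * r) = r := by field_simp
  rw [e1] at h2
  refine h2.trans (le_of_eq ?_)
  field_simp

/-- The supremum defining the distance provides points only strictly below its value, hence the
smaller `r'`. In applications the loss is covered by `ε n > 0`. -/
theorem exists_of_mem_alternatives {β L : ℝ} (hβ : 0 < β) (hL : 0 < L) :
    ∃ M : ℝ, 0 < M ∧ ∀ (a b r r' : ℝ), a ≤ b → r' < r → 0 < a → b < 1 →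
      ∀ σ ∈ alternatives β L (Icc a b) r, IsVolatility σ ∧
        (∀ s ∈ Icc (0 : ℝ) 1, σ s ^ 2 ≤ M * l2NormSq σ) ∧
        ∃ g ∈ holderClass β L, (∀ t ∈ Icc (0 : ℝ) 1, g t = σ t ^ 2 / l2NormSq σ) ∧
          ∃ t ∈ Icc a b, r' < |g t - 1| := by
  obtain ⟨M, hM, hMg⟩ := exists_bound_of_mem_holderClass hβ hL.le
  refine ⟨M, hM, fun a b r r' hab hr ha hb σ hσ => ?_⟩
  obtain ⟨hvol, ⟨g, hg, hgσ⟩, hdev⟩ := hσ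
  have hl2 := hvol.l2NormSq_pos
  have hInt : ∫ t in (0 : ℝ)..1, g t = 1 := by
    rw [intervalIntegral.integral_congr (g := fun t => σ t ^ 2 / l2NormSq σ) fun t ht => by
      rw [uIcc_of_le zero_le_one] at ht
      exact hgσ t ht, intervalIntegral.integral_div]
    exact div_self hl2.ne'
  refine ⟨hvol, fun s hs => ?_, g, hg, hgσ, ?_⟩
  · have h1 := hMg g hg (fun t ht => by rw [hgσ t ht]; positivity) hInt s hs
    rwa [hgσ s hs, div_le_iff₀ hl2] at h1
  · have : Nonempty (Icc a b) := ⟨⟨a, left_mem_Icc.2 hab⟩⟩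
    obtain ⟨⟨t, ht⟩, htr⟩ := exists_lt_of_lt_ciSup (hr.trans_le hdev)
    refine ⟨t, ht, ?_⟩
    rwa [hgσ t ⟨ha.le.trans ht.1, ht.2.trans hb.le⟩]

/-! ### Asymptotics of the scales -/

/-- The bandwidth `(log n / n)^{1/(2β+1)}`. -/
noncomputable def bandwidth (β : ℝ) (n : ℕ) : ℝ := (Real.log n / n) ^ (1 / (2 * β + 1))

theorem bandwidth_nonneg (β : ℝ) (n : ℕ) : 0 ≤ bandwidth β n :=
  Real.rpow_nonneg (div_nonneg (Real.log_natCast_nonneg n) (Nat.cast_nonneg n)) _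

theorem bandwidth_pos (β : ℝ) {n : ℕ} (hn : 2 ≤ n) : 0 < bandwidth β n := by
  have h1 : 0 < Real.log n := Real.log_pos (by exact_mod_cast hn)
  have h2 : (0 : ℝ) < n := by positivity
  exact Real.rpow_pos_of_pos (div_pos h1 h2) _

theorem bandwidth_rpow (β : ℝ) (n : ℕ) : bandwidth β n ^ β = rate β n := by
  rw [bandwidth, rate, ← Real.rpow_mul (div_nonneg (Real.log_natCast_nonneg n) (Nat.cast_nonneg n))]
  congr 1
  ring

/-- The bias-variance balance: a deviation `ρ` on a window `h` has squared signal of order `n h ρ²`,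
which here equals `log n`. -/
theorem mul_bandwidth_rpow {β : ℝ} (hβ : 0 < β) {n : ℕ} (hn : 0 < n) :
    n * (bandwidth β n * rate β n ^ 2) = Real.log n := by
  have hn' : (n : ℝ) ≠ 0 := by positivity
  have h0 : 0 ≤ Real.log n / n := div_nonneg (Real.log_natCast_nonneg n) (Nat.cast_nonneg n)
  have h1 : bandwidth β n * rate β n ^ 2 = Real.log n / n := by
    rw [bandwidth, rate, ← Real.rpow_natCast, ← Real.rpow_mul h0,
      ← Real.rpow_add_of_nonneg h0 (by positivity) (by positivity)]
    have : 1 / (2 * β + 1) + β / (2 * β + 1) * ((2 : ℕ) : ℝ) = 1 := by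
      have : 2 * β + 1 ≠ 0 := by positivity
      push_cast
      field_simp
      ring
    rw [this, Real.rpow_one]
  rw [h1]
  field_simp

theorem tendsto_log_natCast : Tendsto (fun n : ℕ => Real.log n) atTop atTop :=
  Real.tendsto_log_atTop.comp tendsto_natCast_atTop_atTop

theorem tendsto_bandwidth {β : ℝ} (hβ : 0 < β) : Tendsto (bandwidth β) atTop (𝓝 0) := by
  have h1 : Tendsto (fun x : ℝ => Real.log x / x) atTop (𝓝 0) := by
    simpa using Real.tendsto_pow_log_div_mul_add_atTop 1 0 1 one_ne_zero
  have h2 := (h1.comp tendsto_natCast_atTop_atTop (α := ℕ)).rpow_const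
    (p := 1 / (2 * β + 1)) (Or.inr (by positivity))
  rw [Real.zero_rpow (by positivity)] at h2
  exact h2

theorem eventually_log_rpow_le_mul_bandwidth {β : ℝ} (hβ : 0 < β) (r B : ℝ) :
    ∀ᶠ n : ℕ in atTop, B * Real.log n ^ r ≤ n * bandwidth β n := by
  set q := 1 / (2 * β + 1) with hq
  have hq0 : 0 < q := by positivity
  have hq1 : 0 < 1 - q := by
    rw [sub_pos, hq, div_lt_one (by positivity)]
    linarith
  have h1 := (isLittleO_log_rpow_rpow_atTop r hq1).bound
    (c := 1 / (|B| + 1)) (by positivity)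
  have h2 := tendsto_natCast_atTop_atTop (R := ℝ).eventually h1
  filter_upwards [h2, eventually_gt_atTop 0, tendsto_log_natCast.eventually_ge_atTop 1]
    with n hn h0 hlog
  have hn' : (0 : ℝ) < n := by positivity
  have hl : 0 ≤ Real.log n ^ r := by positivity
  rw [Real.norm_of_nonneg hl, Real.norm_of_nonneg (by positivity), one_div,
    le_inv_mul_iff₀ (by positivity)] at hn
  calc B * Real.log n ^ r ≤ (|B| + 1) * Real.log n ^ r := by
        gcongr
        linarith [le_abs_self B]
    _ ≤ (n : ℝ) ^ (1 - q) := hn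
    _ ≤ n * bandwidth β n := by
        rw [bandwidth, Real.div_rpow (by linarith) hn'.le, Real.rpow_sub hn', Real.rpow_one,
          mul_div_assoc']
        gcongr
        exact le_mul_of_one_le_right hn'.le (Real.one_le_rpow hlog hq0.le)

/-- The factor `(log n)^(1/(2β+1))` in the bandwidth eventually exceeds `1/b`, so the constant `b`
leaves no trace. -/
theorem eventually_log_one_div_le {β : ℝ} (hβ : 0 < β) {b : ℝ} (hb : 0 < b) :
    ∀ᶠ n : ℕ in atTop, ∀ h, b * bandwidth β n ≤ h →
      Real.log (1 / h) ≤ Real.log n / (2 * β + 1) := by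
  set q := 1 / (2 * β + 1) with hq
  have hq0 : 0 < q := by positivity
  have h1 : Tendsto (fun n : ℕ => Real.log n ^ q) atTop atTop :=
    (tendsto_rpow_atTop hq0).comp tendsto_log_natCast
  filter_upwards [h1.eventually_ge_atTop (1 / b), eventually_ge_atTop 2] with n hn h2 h hh
  have hn' : (0 : ℝ) < n := by positivity
  have hH := bandwidth_pos β h2
  have hh0 : 0 < h := lt_of_lt_of_le (by positivity) hh
  rw [div_le_iff₀' hb] at hn
  have h3 : 1 / (n : ℝ) ^ q ≤ h := by
    refine le_trans ?_ hh
    rw [bandwidth, Real.div_rpow (Real.log_natCast_nonneg n) hn'.le, mul_div_assoc']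
    gcongr
  have h4 := Real.log_le_log (by positivity) h3
  rw [one_div, Real.log_inv, Real.log_rpow hn'] at h4
  rw [one_div, Real.log_inv]
  have : Real.log n / (2 * β + 1) = q * Real.log n := by rw [hq]; ring
  linarith

theorem eventually_mem_scaleSet {β : ℝ} (hβ : 0 < β) {K b : ℝ} (hb : 0 < b)
    {h : ℕ → ℝ} (hlow : ∀ᶠ n in atTop, b * bandwidth β n ≤ h n) (hlim : Tendsto h atTop (𝓝 0))
    {a' b' : ℝ} (ha' : 0 < a') (hb' : b' < 1) :
    ∀ᶠ n in atTop, ∀ t ∈ Icc a' b', (t, h n) ∈ scaleSet n K := by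
  have hpos : 0 < min (1 / 2) (min a' (1 - b')) := by
    have : 0 < 1 - b' := by linarith
    positivity
  filter_upwards [hlow, hlim.eventually (gt_mem_nhds hpos), eventually_gt_atTop 0,
    eventually_log_rpow_le_mul_bandwidth hβ 0 (K / b)] with n h1 h2 hn h3 t ht
  have hn' : (0 : ℝ) < n := by positivity
  have h4 := lt_min_iff.1 (lt_min_iff.1 h2).2
  refine ⟨⟨?_, (lt_min_iff.1 h2).1⟩, ?_, ?_⟩
  · rw [Real.rpow_zero, mul_one, div_le_iff₀ hb] at h3
    show K / n ≤ h n
    rw [div_le_iff₀ hn']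
    nlinarith
  · exact h4.1.le.trans ht.1
  · show t ≤ 1 - h n
    linarith [ht.2, h4.2]

theorem eventually_log_sq_le {β : ℝ} (hβ : 0 < β) {b : ℝ} (hb : 0 < b)
    {h : ℕ → ℝ} (hlow : ∀ᶠ n in atTop, b * bandwidth β n ≤ h n) (B : ℝ) :
    ∀ᶠ n : ℕ in atTop, B * Real.log n ^ 2 ≤ n * h n := by
  filter_upwards [hlow, eventually_log_rpow_le_mul_bandwidth hβ 2 (B / b)] with n h1 h2
  have h3 : (Real.log n) ^ (2 : ℝ) = Real.log n ^ 2 := by exact_mod_cast Real.rpow_natCast _ 2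
  rw [h3, div_mul_eq_mul_div, div_le_iff₀ hb] at h2
  have h4 : (n : ℝ) * (b * bandwidth β n) ≤ n * h n := by gcongr
  linarith

theorem tendsto_rate {β : ℝ} (hβ : 0 < β) : Tendsto (rate β) atTop (𝓝 0) := by
  have h1 := (tendsto_bandwidth hβ).rpow_const (p := β) (Or.inr hβ.le)
  rw [Real.zero_rpow hβ.ne'] at h1
  exact h1.congr fun n => bandwidth_rpow β n

theorem eventually_nonempty_alternatives {β L c : ℝ} (hβ : 0 < β) (hL : 0 < L) {ε : ℕ → ℝ}
    (hε : Tendsto ε atTop (𝓝 0)) {a b : ℝ} (hab : a ≤ b) :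
    ∀ᶠ n in atTop, (alternatives β L (Icc a b) ((1 + ε n) * c * rate β n)).Nonempty := by
  obtain ⟨r₀, hr₀, h⟩ := exists_nonempty_alternatives hβ hL hab
  have h1 : Tendsto (fun n => (1 + ε n) * c * rate β n) atTop (𝓝 ((1 + 0) * c * 0)) :=
    ((hε.const_add 1).mul_const c).mul (tendsto_rate hβ)
  rw [mul_zero] at h1
  filter_upwards [h1.eventually (ge_mem_nhds hr₀)] with n hn
  exact h _ hn


/-! ### Rate optimality for a general kernel -/

theorem IsKernel.mul_weightNorm_le (hψ : IsKernel ψ) {n : ℕ} (hn : 0 < n) {t h X S : ℝ}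
    (hh : 0 < h) (ht : t ∈ Icc h (1 - h)) (hX : 0 ≤ X) (hS : X * √(h * ∫ x, ψ x ^ 2) ≤ S) :
    X * weightNorm ψ n t h ≤ S := by
  refine le_trans (mul_le_mul_of_nonneg_left ?_ hX) hS
  exact Real.le_sqrt_of_sq_le (hψ.weightNorm_sq_le hn hh ht)

/-- The deviation is required on twice the window because, with `1/n ≤ h`, every block meeting the
window lies in the doubled one. -/
theorem IsKernel.le_abs_signal_of_deviation (hψ : IsKernel ψ) {σ g : ℝ → ℝ} (hgc : Continuous g)
    (hg : ∀ t ∈ Icc (0 : ℝ) 1, g t = σ t ^ 2 / l2NormSq σ) {n : ℕ} (hn : 0 < n) {t h s r : ℝ}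
    (hs : |s| = 1) (hh : 0 < h) (hnh : 1 / (n : ℝ) ≤ h) (ht : t ∈ Icc h (1 - h))
    (hr : ∀ x ∈ Icc (t - 2 * h) (t + 2 * h), r ≤ s * (g x - 1)) :
    (√2)⁻¹ * (√n * (h * (∫ x, ψ x) * r)) ≤ |signal ψ n t h σ| := by
  have h1 := hψ.le_abs_signal (φ := fun _ => r) continuous_const hg hn (t := t) (h := h) hs
    fun k x hx => by
      by_cases hx0 : x ∈ Icc (t - h) (t + h)
      · refine mul_le_mul_of_nonneg_left (le_mul_integral_block_sub_one hgc hn k fun y hy => ?_)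
          (hψ.nonneg _)
        have hlen := block_length n k
        exact hr y ⟨by linarith [hy.1, hx.2, hx0.1], by linarith [hy.2, hx.1, hx0.2]⟩
      · rw [hψ.eq_zero_of_lt hh hx0, zero_mul, zero_mul]
  rw [intervalIntegral.integral_mul_const,
    integral_zero_one_rescale hψ.support_subset_Ioo hh ht] at h1
  exact h1

theorem exists_powerTendsToOne (hψ : IsKernel ψ) {β L : ℝ} (hβ : 0 < β) (hL : 0 < L) :
    ∃ c : ℝ, 0 < c ∧ PowerTendsToOne ψ β L c := by
  obtain ⟨τ, hτ0, hτ2, hdev⟩ := exists_interval_deviation hβ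
  obtain ⟨M, hM0, hM⟩ := exists_of_mem_alternatives hβ hL
  have hI1 := hψ.integral_pos
  have hI2 := hψ.integral_sq_pos
  set I₁ := ∫ x, ψ x
  set I₂ := ∫ x, ψ x ^ 2
  set c₁ := (√2)⁻¹ * (√(τ / 2) * (I₁ / √I₂)) / 2 with hc₁
  have hc₁0 : 0 < c₁ := by positivity
  -- The first entry gives `L H^β ≤ cρ/16` at bandwidth `H`, as the deviation lemma needs; the
  -- second makes the signal at least `(√2 + 1) √(log n)`, of which `√2 √(log n)` pays for the
  -- correction.
  set c := max (16 * L) ((√2 + 1) / c₁) with hc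
  have hc0 : 0 < c := by positivity
  have hcL : 16 * L ≤ c := le_max_left _ _
  have hcc : √2 + 1 ≤ c * c₁ := by
    have : (√2 + 1) / c₁ ≤ c := le_max_right _ _
    rwa [div_le_iff₀ hc₁0] at this
  refine ⟨c, hc0, fun K hK z₀ α hα _ ε hε0 hε _ a b ha hab hb => ?_⟩
  -- The subinterval found at bandwidth `H` has half-length `τ H`, so this makes it exactly the
  -- doubled window `[t - 2h, t + 2h]`.
  set h : ℕ → ℝ := fun n => τ / 2 * bandwidth β n with hh
  have hlow : ∀ᶠ n in atTop, τ / 2 * bandwidth β n ≤ h n := Eventually.of_forall fun n => le_rfl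
  have hlim : Tendsto h atTop (𝓝 0) := by
    simpa using (tendsto_bandwidth hβ).const_mul (τ / 2)
  refine tendsto_iInf_power hψ hK z₀ hα hM0 _ h (fun n => c * c₁ * √(Real.log n))
    (eventually_nonempty_alternatives hβ hL hε hab) ?_ ?_
    (eventually_log_sq_le hβ (by positivity) hlow)
  · filter_upwards [eventually_mem_scaleSet hβ (K := K) (half_pos hτ0) hlow hlim
        (a' := a) (b' := (b + 1) / 2) ha (by linarith),
      (tendsto_bandwidth hβ).eventually (ge_mem_nhds (by linarith : 0 < (1 - b) / 2)),
      eventually_log_rpow_le_mul_bandwidth hβ 0 (2 / τ), eventually_ge_atTop 2]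
      with n hmem hbw hnbw hn2 σ hσ
    have hn : 0 < n := by omega
    have hn' : (0 : ℝ) < n := by positivity
    have hH := bandwidth_pos β hn2
    have hρ : 0 < rate β n := by
      rw [← bandwidth_rpow]
      positivity
    obtain ⟨hvol, hMσ, g, hg, hgσ, t₀, ht₀, hgt₀⟩ := hM a b _ (c * rate β n) hab
      (by nlinarith [mul_pos (mul_pos (hε0 n) hc0) hρ]) ha hb σ hσ
    obtain ⟨v, s, hs, hv, hvs⟩ := hdev L g t₀ (bandwidth β n) (c * rate β n) hL.le hg hH.le
      (by rw [bandwidth_rpow]; nlinarith) hgt₀.le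
    set t := t₀ + bandwidth β n * v with ht
    have hmem' : (t, h n) ∈ scaleSet n K := by
      refine hmem t ⟨?_, ?_⟩
      · have : 0 ≤ bandwidth β n * v := mul_nonneg hH.le (hτ0.le.trans hv.1)
        linarith [ht₀.1]
      · have : bandwidth β n * v ≤ bandwidth β n * 1 := by
          gcongr
          linarith [hv.2]
        linarith [ht₀.2]
    have hhn : 0 < h n := by
      simp only [hh]
      positivity
    refine ⟨hvol, hMσ, t, hmem', ?_⟩
    refine hψ.mul_weightNorm_le hn hhn hmem'.2 (by positivity) (le_trans ?_
      (hψ.le_abs_signal_of_deviation (continuous_of_mem_holderClass hg) hgσ hn hs hhn ?_ hmem'.2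
        (r := c * rate β n / 2) ?_))
    · have e1 : √(Real.log n) = √n * (√(bandwidth β n) * rate β n) := by
        rw [← mul_bandwidth_rpow hβ hn, Real.sqrt_mul hn'.le, Real.sqrt_mul hH.le,
          Real.sqrt_sq hρ.le]
      have e2 : √(h n * I₂) = √(τ / 2) * √(bandwidth β n) * √I₂ := by
        simp only [hh]
        rw [Real.sqrt_mul (by positivity), Real.sqrt_mul (by positivity)]
      have e3 : h n = √(τ / 2) * √(τ / 2) * (√(bandwidth β n) * √(bandwidth β n)) := by
        rw [Real.mul_self_sqrt (by positivity), Real.mul_self_sqrt hH.le]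
      rw [e1, e2, hc₁]
      conv_rhs => rw [e3]
      apply le_of_eq
      have : √I₂ ≠ 0 := by positivity
      field_simp
      rfl
    · rw [Real.rpow_zero, mul_one, div_le_iff₀ hτ0] at hnbw
      rw [div_le_iff₀ hn']
      simp only [hh]
      linarith
    · intro x hx
      have hx' : x = t₀ + bandwidth β n * ((x - t₀) / bandwidth β n) := by
        field_simp
        ring
      rw [hx']
      refine hvs _ ⟨?_, ?_⟩
      · rw [le_div_iff₀ hH]
        have := hx.1
        simp only [hh, ht] at this
        linarith
      · rw [div_le_iff₀ hH]
        have := hx.2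
        simp only [hh, ht] at this
        linarith
  · have hs : Tendsto (fun n : ℕ => √(Real.log n)) atTop atTop :=
      Real.tendsto_sqrt_atTop.comp tendsto_log_natCast
    refine tendsto_atTop_mono' _ ?_ hs
    filter_upwards [eventually_log_one_div_le hβ (half_pos hτ0)] with n hn
    have h1 := hn (h n) le_rfl
    have hl := Real.log_natCast_nonneg n
    have h2 : Real.log n / (2 * β + 1) ≤ Real.log n := div_le_self hl (by linarith)
    have h3 : √(2 * Real.log (1 / h n)) ≤ √2 * √(Real.log n) := by
      rw [← Real.sqrt_mul (by norm_num)]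
      exact Real.sqrt_le_sqrt (by linarith)
    nlinarith [Real.sqrt_nonneg (Real.log n)]

/-! ### The optimal recovery kernel -/

theorem natCeil_pred_eq_zero {β : ℝ} (hβ1 : β ≤ 1) : ⌈β⌉₊ - 1 = 0 := by
  have : ⌈β⌉₊ ≤ 1 := Nat.ceil_le.2 (by exact_mod_cast hβ1)
  omega

/-- For `β ≤ 1` no derivative is involved and continuity follows from the Hölder bound, after
rescaling the argument so that the Hölder constant is one. -/
theorem mem_holderClass_iff {β L : ℝ} (hβ : 0 < β) (hβ1 : β ≤ 1) (hL : 0 < L) {f : ℝ → ℝ} :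
    f ∈ holderClass β L ↔ ∀ x y, |f x - f y| ≤ L * |x - y| ^ β := by
  rw [holderClass, natCeil_pred_eq_zero hβ1]
  simp only [mem_ofPred_eq, iteratedDeriv_zero, Nat.cast_zero, sub_zero, contDiff_zero]
  refine ⟨fun h => h.2, fun h => ⟨?_, h⟩⟩
  have hLβ : (L ^ (-(1 / β)) : ℝ) ^ β = L⁻¹ := by
    rw [← Real.rpow_mul hL.le, neg_mul, one_div, inv_mul_cancel₀ hβ.ne', Real.rpow_neg_one]
  have hc : Continuous fun x => f (L ^ (-(1 / β)) * x) := by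
    refine continuous_of_holder hβ fun x y => (h _ _).trans (le_of_eq ?_)
    rw [← mul_sub, abs_mul, abs_of_pos (Real.rpow_pos_of_pos hL _),
      Real.mul_rpow (by positivity) (abs_nonneg _), hLβ, ← mul_assoc, mul_inv_cancel₀ hL.ne',
      one_mul]
  have hc' := hc.comp (continuous_const_mul (L ^ (1 / β)))
  refine hc'.congr fun x => ?_
  simp only [Function.comp_apply]
  rw [← mul_assoc, ← Real.rpow_add hL]
  simp

theorem abs_rpow_sub_rpow_le {β : ℝ} (hβ : 0 < β) (hβ1 : β ≤ 1) (x y : ℝ) :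
    |(|x| ^ β - |y| ^ β)| ≤ |x - y| ^ β := by
  have key : ∀ x y : ℝ, |x| ^ β - |y| ^ β ≤ |x - y| ^ β := fun x y => by
    have h1 : |x| ≤ |x - y| + |y| := by
      have := abs_add_le (x - y) y
      rwa [sub_add_cancel] at this
    have h2 := Real.rpow_le_rpow (abs_nonneg x) h1 hβ.le
    have h3 := Real.rpow_add_le_add_rpow (abs_nonneg (x - y)) (abs_nonneg y) hβ.le hβ1
    linarith
  rw [abs_le]
  refine ⟨?_, key x y⟩
  have := key y x
  rw [abs_sub_comm] at this
  linarith

theorem recoveryKernel_eq_max {β : ℝ} (hβ : 0 < β) (x : ℝ) :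
    recoveryKernel β x = max 0 (1 - |x| ^ β) := by
  rw [recoveryKernel]
  split_ifs with h
  · rw [max_eq_right]
    linarith [Real.rpow_le_one (abs_nonneg x) h hβ.le]
  · rw [max_eq_left]
    linarith [Real.one_le_rpow (not_le.1 h).le hβ.le]

theorem recoveryKernel_holder {β : ℝ} (hβ : 0 < β) (hβ1 : β ≤ 1) (x y : ℝ) :
    |recoveryKernel β x - recoveryKernel β y| ≤ |x - y| ^ β := by
  rw [recoveryKernel_eq_max hβ, recoveryKernel_eq_max hβ, max_comm 0, max_comm 0]
  refine (abs_max_sub_max_le_abs _ _ (0 : ℝ)).trans ?_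
  rw [sub_sub_sub_cancel_left, abs_sub_comm]
  exact abs_rpow_sub_rpow_le hβ hβ1 x y

theorem recoveryKernel_eq_zero {β x : ℝ} (hβ : 0 < β) (hx : 1 ≤ |x|) : recoveryKernel β x = 0 := by
  rw [recoveryKernel_eq_max hβ, max_eq_left]
  linarith [Real.one_le_rpow hx hβ.le]

/-- Clamping the argument to `[-1,1]` does not change the function, which is monotone on `[-1,0]`
and even. -/
theorem boundedVariationOn_recoveryKernel {β : ℝ} (hβ : 0 < β) :
    BoundedVariationOn (recoveryKernel β) univ := by
  have hcomp : recoveryKernel β = recoveryKernel β ∘ fun x => max (-1) (min x 1) := by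
    funext x
    simp only [Function.comp_apply]
    rcases le_total x (-1) with h | h
    · rw [min_eq_left (by linarith), max_eq_left h, recoveryKernel_eq_zero hβ,
        recoveryKernel_eq_zero hβ (by simp)]
      rw [abs_of_nonpos (by linarith)]
      linarith
    · rcases le_total x 1 with h' | h'
      · rw [min_eq_left h', max_eq_right h]
      · rw [min_eq_right h', max_eq_right (by norm_num), recoveryKernel_eq_zero hβ,
          recoveryKernel_eq_zero hβ (by simp)]
        rw [abs_of_nonneg (by linarith)]
        exact h'
  have hmono : MonotoneOn (fun x : ℝ => max (-1) (min x 1)) univ := fun x _ y _ hxy =>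
    max_le_max le_rfl (min_le_min hxy le_rfl)
  have hmaps : MapsTo (fun x : ℝ => max (-1) (min x 1)) univ (Icc (-1) 1) := fun x _ =>
    ⟨le_max_left _ _, max_le (by norm_num) (min_le_right _ _)⟩
  rw [BoundedVariationOn, hcomp]
  refine ne_top_of_le_ne_top ?_ (eVariationOn.comp_le_of_monotoneOn _ _ hmono hmaps)
  have hadd := eVariationOn.Icc_add_Icc (recoveryKernel β) (s := univ) (a := -1) (b := 0) (c := 1)
    (by norm_num) (by norm_num) (mem_univ _)
  simp only [univ_inter] at hadd
  rw [← hadd]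
  have hleft : eVariationOn (recoveryKernel β) (Icc (-1) 0) ≠ ∞ := by
    have hm : MonotoneOn (recoveryKernel β) (Icc (-1) 0) := fun x hx y hy hxy => by
      rw [recoveryKernel_eq_max hβ, recoveryKernel_eq_max hβ]
      refine max_le_max le_rfl (sub_le_sub_left (Real.rpow_le_rpow (abs_nonneg _) ?_ hβ.le) _)
      rw [abs_of_nonpos hx.2, abs_of_nonpos hy.2]
      linarith
    have := hm.eVariationOn_eq (a := -1) (b := 0) (by simp) (by simp)
    rw [inter_self] at this
    rw [this]
    exact ENNReal.ofReal_ne_top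
  refine ENNReal.add_ne_top.2 ⟨hleft, ne_top_of_le_ne_top hleft ?_⟩
  have heven : recoveryKernel β = recoveryKernel β ∘ Neg.neg := by
    funext x
    simp [recoveryKernel]
  conv_lhs => rw [heven]
  exact eVariationOn.comp_le_of_antitoneOn _ _ (fun x _ y _ hxy => neg_le_neg hxy)
    fun x hx => ⟨neg_le_neg hx.2, neg_nonpos.2 hx.1⟩

theorem isKernel_recoveryKernel {β : ℝ} (hβ : 0 < β) (hβ1 : β ≤ 1) :
    IsKernel (recoveryKernel β) where
  nonneg x := by
    rw [recoveryKernel_eq_max hβ]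
    exact le_max_left _ _
  at_zero := by simp [recoveryKernel, hβ.ne']
  le_one x := by
    rw [recoveryKernel_eq_max hβ]
    refine max_le zero_le_one ?_
    have : 0 ≤ |x| ^ β := by positivity
    linarith
  support x hx := by
    by_contra h
    refine hx (recoveryKernel_eq_zero hβ ?_)
    by_contra h'
    exact h (abs_le.1 (not_le.1 h').le)
  boundedVariation := boundedVariationOn_recoveryKernel hβ
  holder := ⟨β, hβ, hβ1, recoveryKernel_holder hβ hβ1⟩

theorem recoveryKernel_le_abs {β : ℝ} (hβ : 0 < β) (hβ1 : β ≤ 1) {φ : ℝ → ℝ}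
    (hφ : φ ∈ holderClass β 1) (hφ0 : 1 ≤ φ 0) (x : ℝ) :
    1 - |x| ^ β ≤ φ x ∧ recoveryKernel β x ≤ |φ x| := by
  rw [mem_holderClass_iff hβ hβ1 one_pos] at hφ
  have h1 := (abs_le.1 (hφ x 0)).1
  rw [sub_zero, one_mul] at h1
  have h2 : 1 - |x| ^ β ≤ φ x := by linarith
  refine ⟨h2, ?_⟩
  rw [recoveryKernel_eq_max hβ]
  exact max_le (abs_nonneg _) (h2.trans (le_abs_self _))

/-- Competitors dominate `ψ_β` pointwise in modulus. Equal norms give equal squares almost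
everywhere, then everywhere by continuity. -/
theorem isOptimalRecoveryKernel_iff {β : ℝ} (hβ : 0 < β) (hβ1 : β ≤ 1) (φ : ℝ → ℝ) :
    IsOptimalRecoveryKernel β φ ↔ φ = recoveryKernel β := by
  have hker := isKernel_recoveryKernel hβ hβ1
  have hmem : recoveryKernel β ∈ holderClass β 1 := by
    rw [mem_holderClass_iff hβ hβ1 one_pos]
    simpa using recoveryKernel_holder hβ hβ1
  have hle : ∀ φ ∈ holderClass β 1, 1 ≤ φ 0 → ∀ x, ‖recoveryKernel β x‖ ≤ ‖φ x‖ :=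
    fun φ hφ hφ0 x => by
      rw [Real.norm_of_nonneg (hker.nonneg x)]
      exact (recoveryKernel_le_abs hβ hβ1 hφ hφ0 x).2
  constructor
  · rintro ⟨hφ, hφ0, hmin⟩
    have hφc := continuous_of_mem_holderClass hφ
    have hL2 : MemLp (recoveryKernel β) 2 :=
      hker.continuous.memLp_of_hasCompactSupport hker.hasCompactSupport
    have h1 := hmin _ hmem hker.at_zero.ge
    have hφL2 : MemLp φ 2 := ⟨hφc.aestronglyMeasurable, h1.trans_lt hL2.2⟩
    have hsq : ∫ x, φ x ^ 2 ≤ ∫ x, recoveryKernel β x ^ 2 := by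
      have e : ∀ f : ℝ → ℝ, MemLp f 2 → eLpNorm f 2 volume ^ 2
          = ENNReal.ofReal (∫ x, f x ^ 2) := fun f hf => by
        have h2 := hf.eLpNorm_eq_integral_rpow_norm (by norm_num) (by norm_num)
        rw [h2, ← ENNReal.ofReal_pow (by positivity)]
        congr 1
        simp only [ENNReal.toReal_ofNat]
        have h3 : ∀ x, ‖f x‖ ^ (2 : ℝ) = f x ^ 2 := fun x => by
          rw [Real.rpow_two, Real.norm_eq_abs, sq_abs]
        simp_rw [h3]
        rw [← Real.rpow_natCast, ← Real.rpow_mul (integral_nonneg fun x => sq_nonneg _)]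
        norm_num
      have h4 := pow_le_pow_left₀ bot_le h1 2
      rw [e _ hφL2, e _ hL2] at h4
      exact (ENNReal.ofReal_le_ofReal_iff (integral_nonneg fun x => sq_nonneg _)).1 h4
    have hdiff0 : ∀ x, 0 ≤ φ x ^ 2 - recoveryKernel β x ^ 2 := fun x => by
      rw [sub_nonneg]
      exact sq_le_sq.2 (hle φ hφ hφ0 x)
    have hInt : ∫ x, (φ x ^ 2 - recoveryKernel β x ^ 2) = 0 := by
      refine le_antisymm ?_ (integral_nonneg hdiff0)
      rw [integral_sub hφL2.integrable_sq hL2.integrable_sq]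
      linarith
    have hae := (integral_eq_zero_iff_of_nonneg hdiff0
      (hφL2.integrable_sq.sub hL2.integrable_sq)).1 hInt
    have hcont : Continuous fun x => φ x ^ 2 - recoveryKernel β x ^ 2 :=
      (hφc.pow 2).sub (hker.continuous.pow 2)
    have heq := (hcont.ae_eq_iff_eq volume continuous_zero).1 hae
    funext x
    have h5 : φ x ^ 2 = recoveryKernel β x ^ 2 := sub_eq_zero.1 (congrFun heq x)
    rcases sq_eq_sq_iff_eq_or_eq_neg.1 h5 with h6 | h6
    · exact h6
    -- The opposite sign is impossible where `ψ_β > 0`, since there `φ ≥ 1 - |x|^β > 0`.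
    · have h7 := (recoveryKernel_le_abs hβ hβ1 hφ hφ0 x).1
      have h8 := hker.nonneg x
      have h9 : recoveryKernel β x = 0 := by
        by_contra hne
        have hpos : 0 < recoveryKernel β x := lt_of_le_of_ne h8 (Ne.symm hne)
        rw [recoveryKernel_eq_max hβ] at hpos h6
        rcases lt_max_iff.1 hpos with h | h
        · exact absurd h (lt_irrefl _)
        · rw [max_eq_right h.le] at h6
          linarith
      rw [h6, h9, neg_zero]
  · rintro rfl
    exact ⟨hmem, hker.at_zero.ge, fun φ hφ hφ0 => eLpNorm_mono (hle φ hφ hφ0)⟩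


/-! ### Sharp constant for the optimal recovery kernel -/

theorem exists_abs_eq_one_mul_eq_abs (x : ℝ) : ∃ s : ℝ, |s| = 1 ∧ s * x = |x| := by
  rcases le_total 0 x with h | h
  · exact ⟨1, by simp, by rw [abs_of_nonneg h, one_mul]⟩
  · exact ⟨-1, by simp, by rw [abs_of_nonpos h, neg_one_mul]⟩

/-- The Hölder condition bounds the signed deviation at `x` below by `L h^β - L |x - t|^β`, which on
the window is `L h^β ψ_β((x - t)/h)`. Block averaging costs `L n^(-β)`. -/
theorem le_abs_signal_recoveryKernel {β L : ℝ} (hβ : 0 < β) (hβ1 : β ≤ 1) (hL : 0 < L)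
    {σ g : ℝ → ℝ} (hgH : g ∈ holderClass β L)
    (hg : ∀ t ∈ Icc (0 : ℝ) 1, g t = σ t ^ 2 / l2NormSq σ) {n : ℕ} (hn : 0 < n) {t h : ℝ}
    (hh : 0 < h) (ht : t ∈ Icc h (1 - h)) (hgt : L * h ^ β ≤ |g t - 1|) :
    (√2)⁻¹ * (√n * (h * (L * h ^ β * (∫ x, recoveryKernel β x ^ 2)
      - L * (1 / (n : ℝ)) ^ β * ∫ x, recoveryKernel β x))) ≤
      |signal (recoveryKernel β) n t h σ| := by
  have hψ := isKernel_recoveryKernel hβ hβ1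
  have hgc := continuous_of_mem_holderClass hgH
  rw [mem_holderClass_iff hβ hβ1 hL] at hgH
  obtain ⟨s, hs, hst⟩ := exists_abs_eq_one_mul_eq_abs (g t - 1)
  have hs' : ∀ y z, -(L * |y - z| ^ β) ≤ s * (g y - g z) := fun y z => by
    have h1 := neg_abs_le (s * (g y - g z))
    rw [abs_mul, hs, one_mul] at h1
    linarith [hgH y z]
  set D := L * h ^ β
  set δ := L * (1 / (n : ℝ)) ^ β
  have hψc := hψ.continuous
  have h1 := hψ.le_abs_signal (φ := fun x => D * recoveryKernel β ((x - t) / h) - δ)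
    (by fun_prop) hg hn (t := t) (h := h) hs fun k x hx => by
      by_cases hx0 : x ∈ Icc (t - h) (t + h)
      · refine mul_le_mul_of_nonneg_left (le_mul_integral_block_sub_one hgc hn k fun y hy => ?_)
          (hψ.nonneg _)
        have hlen := block_length n k
        have hxy : |y - x| ≤ 1 / n := by
          rw [abs_le]
          exact ⟨by linarith [hy.1, hx.2], by linarith [hy.2, hx.1]⟩
        have hyx : L * |y - x| ^ β ≤ δ :=
          mul_le_mul_of_nonneg_left (Real.rpow_le_rpow (abs_nonneg _) hxy hβ.le) hL.le
        have hxt : |x - t| ≤ h := abs_le.2 ⟨by linarith [hx0.1], by linarith [hx0.2]⟩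
        have hD : D * recoveryKernel β ((x - t) / h) = D - L * |x - t| ^ β := by
          rw [recoveryKernel, abs_div, abs_of_pos hh, if_pos ((div_le_one hh).2 hxt),
            Real.div_rpow (abs_nonneg _) hh.le]
          have : h ^ β ≠ 0 := by positivity
          simp only [D]
          field_simp
        have e : s * (g y - 1) = s * (g t - 1) + s * (g x - g t) + s * (g y - g x) := by ring
        rw [hD, e]
        linarith [hs' x t, hs' y x]
      · rw [hψ.eq_zero_of_lt hh hx0, zero_mul, zero_mul]
  have hF : Function.support (fun v => recoveryKernel β v * (D * recoveryKernel β v - δ))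
      ⊆ Ioo (-1) 1 := by
    refine Subset.trans (fun v hv => ?_) hψ.support_subset_Ioo
    exact left_ne_zero_of_mul hv
  rw [integral_zero_one_rescale hF hh ht] at h1
  have e : ∫ v, recoveryKernel β v * (D * recoveryKernel β v - δ)
      = D * (∫ x, recoveryKernel β x ^ 2) - δ * ∫ x, recoveryKernel β x := by
    rw [← integral_const_mul, ← integral_const_mul,
      ← integral_sub (hψ.integrable_sq.const_mul D) (hψ.integrable.const_mul δ)]
    congr 1
    funext v
    ring
  rwa [e] at h1

theorem cStar_pos {β L : ℝ} (hβ : 0 < β) (hβ1 : β ≤ 1) (hL : 0 < L) : 0 < cStar β L := by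
  have := (isKernel_recoveryKernel hβ hβ1).integral_sq_pos
  rw [cStar]
  positivity

/-- The defining equation of the constant: with `h = (c/L)^(1/β) H`, where `H` is the bandwidth,
half of `n h (c ρ)² ‖ψ_β‖²` is `2 log n / (2β + 1)`, the leading term of `2 log (1/h)`. -/
theorem cStar_rpow_mul {β L : ℝ} (hβ : 0 < β) (hβ1 : β ≤ 1) (hL : 0 < L) :
    (cStar β L / L) ^ (1 / β) * cStar β L ^ 2 * (∫ x, recoveryKernel β x ^ 2)
      = 4 / (2 * β + 1) := by
  have hI := (isKernel_recoveryKernel hβ hβ1).integral_sq_pos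
  have hc := cStar_pos hβ hβ1 hL
  have h1 : cStar β L ^ (1 / β) * cStar β L ^ 2
      = 4 * L ^ (1 / β) / ((2 * β + 1) * ∫ x, recoveryKernel β x ^ 2) := by
    rw [← Real.rpow_natCast, ← Real.rpow_add hc, cStar, ← Real.rpow_mul (by positivity)]
    have : β / (2 * β + 1) * (1 / β + (2 : ℕ)) = 1 := by
      push_cast
      field_simp
      ring
    rw [this, Real.rpow_one]
  rw [Real.div_rpow hc.le hL.le, div_mul_eq_mul_div, h1]
  have : L ^ (1 / β) ≠ 0 := by positivity
  field_simp

/-- Keeps the standardized block-averaging error bounded, even for small `β`. Writing `H` for the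
bandwidth, `log n = n H · H^(2β)`, so the bound `log n ≤ (n H)^(2β)` amounts to `n H ≤ n^(2β)`. -/
theorem eventually_mul_bandwidth_mul_le_one {β : ℝ} (hβ : 0 < β) :
    ∀ᶠ n : ℕ in atTop, √(n * bandwidth β n) * (1 / (n : ℝ)) ^ β ≤ 1 := by
  filter_upwards [eventually_log_rpow_le_mul_bandwidth hβ (1 / (2 * β)) 1,
    eventually_ge_atTop 2] with n hn hn2
  have hn0 : 0 < n := by omega
  have hn' : (0 : ℝ) < n := by positivity
  have hH := bandwidth_pos β hn2
  have hl := Real.log_natCast_nonneg n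
  have h1 : Real.log n ≤ (n * bandwidth β n) ^ (2 * β) := by
    have := Real.rpow_le_rpow (by positivity) hn (by positivity : 0 ≤ 2 * β)
    rwa [one_mul, ← Real.rpow_mul hl, one_div, inv_mul_cancel₀ (by positivity),
      Real.rpow_one] at this
  have h2 : Real.log n = n * bandwidth β n * (bandwidth β n ^ β) ^ 2 := by
    rw [bandwidth_rpow, ← mul_bandwidth_rpow hβ hn0, mul_assoc]
  have h3 : (n * bandwidth β n) ^ (2 * β) = ((n : ℝ) ^ β) ^ 2 * (bandwidth β n ^ β) ^ 2 := by
    rw [mul_comm 2 β, Real.rpow_mul (by positivity), Real.rpow_two,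
      Real.mul_rpow hn'.le hH.le, mul_pow]
  rw [h3, h2] at h1
  have h4 : n * bandwidth β n ≤ ((n : ℝ) ^ β) ^ 2 := le_of_mul_le_mul_right h1 (by positivity)
  rw [Real.div_rpow zero_le_one hn'.le, Real.one_rpow, mul_one_div, div_le_one (by positivity)]
  exact Real.sqrt_le_iff.2 ⟨by positivity, h4⟩

theorem powerTendsToOne_recoveryKernel {β L : ℝ} (hβ : 0 < β) (hβ1 : β ≤ 1) (hL : 0 < L) :
    PowerTendsToOne (recoveryKernel β) β L (cStar β L) := by
  intro K hK z₀ α hα _ ε hε0 hε hεlog a b ha hab hb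
  have hψ := isKernel_recoveryKernel hβ hβ1
  obtain ⟨M, hM0, hM⟩ := exists_of_mem_alternatives hβ hL
  have hI1 := hψ.integral_pos
  have hI2 := hψ.integral_sq_pos
  have hc0 := cStar_pos hβ hβ1 hL
  have hcid := cStar_rpow_mul hβ hβ1 hL
  set I₁ := ∫ x, recoveryKernel β x with hI₁
  set I₂ := ∫ x, recoveryKernel β x ^ 2 with hI₂
  set c := cStar β L
  set b₀ := (c / L) ^ (1 / β)
  have hb₀ : 0 < b₀ := by positivity
  -- Half of `ε n` enlarges the bandwidth and signal; the other half gives the strict inequality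
  -- needed to find a point of deviation.
  set e : ℕ → ℝ := fun n => ε n / 2 with he
  have he0 : ∀ n, 0 < e n := fun n => half_pos (hε0 n)
  set h : ℕ → ℝ := fun n => (1 + e n) ^ (1 / β) * b₀ * bandwidth β n with hh
  -- The signal bound divided by the upper bound `√(h ‖ψ_β‖²)` for `Λ`.
  set X : ℕ → ℝ := fun n =>
    (√2)⁻¹ * (√(n * h n) * (L * h n ^ β * √I₂ - L * (1 / (n : ℝ)) ^ β * (I₁ / √I₂))) with hX
  have hone : ∀ n, 1 ≤ (1 + e n) ^ (1 / β) := fun n =>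
    Real.one_le_rpow (by linarith [he0 n]) (by positivity)
  have hHnn := bandwidth_nonneg β
  have hlow' : ∀ n, b₀ * bandwidth β n ≤ h n := fun n => by
    have h1 := mul_le_mul_of_nonneg_right (hone n) (mul_nonneg hb₀.le (hHnn n))
    rw [one_mul, ← mul_assoc] at h1
    exact h1
  have hlow : ∀ᶠ n in atTop, b₀ * bandwidth β n ≤ h n := Eventually.of_forall hlow'
  have hlim : Tendsto h atTop (𝓝 0) := by
    have h1 : Tendsto (fun n => 1 + e n) atTop (𝓝 1) := by
      simpa using (hε.div_const 2).const_add 1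
    have h2 := h1.rpow_const (p := 1 / β) (Or.inl one_ne_zero)
    have h3 := (h2.mul_const b₀).mul (tendsto_bandwidth hβ)
    rwa [mul_zero] at h3
  have hhβ : ∀ n, L * h n ^ β = (1 + e n) * c * rate β n := fun n => by
    have h1 : 0 ≤ 1 + e n := by linarith [he0 n]
    simp only [hh]
    rw [Real.mul_rpow (by positivity) (hHnn n), bandwidth_rpow,
      Real.mul_rpow (by positivity) hb₀.le, ← Real.rpow_mul h1, ← Real.rpow_mul (by positivity),
      one_div, inv_mul_cancel₀ hβ.ne', Real.rpow_one, Real.rpow_one]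
    field_simp
  have hXlim : Tendsto (fun n => X n - √(2 * Real.log (1 / h n))) atTop atTop := by
    set C := (√2)⁻¹ * (√(2 ^ (1 / β) * b₀) * (L * (I₁ / √I₂))) with hC
    -- The gain over the correction is `e n √(2 log n / (2β + 1))` up to a constant; this is where
    -- `ε² log n → ∞` is used.
    have h1 : Tendsto (fun n : ℕ => √(e n ^ 2 * (2 * Real.log n / (2 * β + 1))) - C)
        atTop atTop := by
      refine tendsto_atTop_add_const_right _ _ (Real.tendsto_sqrt_atTop.comp ?_)
      have h2 := hεlog.const_mul_atTop (by positivity : 0 < 1 / (2 * (2 * β + 1)))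
      refine h2.congr fun n => ?_
      simp only [he]
      field_simp
    refine tendsto_atTop_mono' _ ?_ h1
    filter_upwards [eventually_log_one_div_le hβ hb₀, eventually_mul_bandwidth_mul_le_one hβ,
      hε.eventually (ge_mem_nhds (by norm_num : (0 : ℝ) < 1)), eventually_ge_atTop 2]
      with n hlog herr hε1 hn2
    have hn : 0 < n := by omega
    have hn' : (0 : ℝ) < n := by positivity
    have hl := Real.log_natCast_nonneg n
    have hH := bandwidth_pos β hn2
    set w := 2 * Real.log n / (2 * β + 1) with hw
    have hw0 : 0 ≤ w := by positivity
    have hsq : √(2 * Real.log (1 / h n)) ≤ √w := by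
      refine Real.sqrt_le_sqrt ?_
      rw [hw, mul_div_assoc]
      linarith [hlog (h n) (hlow' n)]
    have hew : √(e n ^ 2 * w) = e n * √w := by
      rw [Real.sqrt_mul (sq_nonneg _), Real.sqrt_sq (he0 n).le]
    have hmain : (1 + e n) * √w ≤ (√2)⁻¹ * (√(n * h n) * (L * h n ^ β * √I₂)) := by
      have h0 := he0 n
      refine abs_le_of_sq_le_sq' ?_ (by positivity) |>.2
      have h2 : ((√2)⁻¹ * (√(n * h n) * (L * h n ^ β * √I₂))) ^ 2
          = (1 + e n) ^ (1 / β) * ((1 + e n) ^ 2 * w) := by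
        have hρ : (n : ℝ) * (bandwidth β n * rate β n ^ 2) = Real.log n :=
          mul_bandwidth_rpow hβ hn
        rw [hhβ]
        simp only [mul_pow, inv_pow]
        rw [Real.sq_sqrt (by norm_num), Real.sq_sqrt (by positivity), Real.sq_sqrt hI2.le]
        calc (2 : ℝ)⁻¹ * (n * h n * ((1 + e n) ^ 2 * c ^ 2 * rate β n ^ 2 * I₂))
            = (2 : ℝ)⁻¹ * ((1 + e n) ^ (1 / β) * (1 + e n) ^ 2 * (b₀ * c ^ 2 * I₂)
              * (n * (bandwidth β n * rate β n ^ 2))) := by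
              simp only [hh]
              ring
          _ = (1 + e n) ^ (1 / β) * ((1 + e n) ^ 2 * w) := by
              rw [hρ, hcid, hw]
              ring
      rw [h2, mul_pow, Real.sq_sqrt hw0]
      exact le_mul_of_one_le_left (by positivity) (hone n)
    have herr' : (√2)⁻¹ * (√(n * h n) * (L * (1 / (n : ℝ)) ^ β * (I₁ / √I₂))) ≤ C := by
      have h2 : √(n * h n) ≤ √(2 ^ (1 / β) * b₀) * √(n * bandwidth β n) := by
        rw [← Real.sqrt_mul (by positivity)]
        refine Real.sqrt_le_sqrt ?_
        have h3 : (1 + e n) ^ (1 / β) ≤ 2 ^ (1 / β) := by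
          have := he0 n
          refine Real.rpow_le_rpow (by linarith) ?_ (by positivity)
          simp only [he]
          linarith
        calc (n : ℝ) * h n = (1 + e n) ^ (1 / β) * (b₀ * (n * bandwidth β n)) := by
              simp only [hh]
              ring
          _ ≤ 2 ^ (1 / β) * (b₀ * (n * bandwidth β n)) := by gcongr
          _ = 2 ^ (1 / β) * b₀ * (n * bandwidth β n) := by ring
      rw [hC]
      refine mul_le_mul_of_nonneg_left ?_ (by positivity)
      calc √(n * h n) * (L * (1 / (n : ℝ)) ^ β * (I₁ / √I₂))
          ≤ √(2 ^ (1 / β) * b₀) * √(n * bandwidth β n)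
            * (L * (1 / (n : ℝ)) ^ β * (I₁ / √I₂)) := by gcongr
        _ = √(2 ^ (1 / β) * b₀) * (L * (I₁ / √I₂))
            * (√(n * bandwidth β n) * (1 / (n : ℝ)) ^ β) := by ring
        _ ≤ √(2 ^ (1 / β) * b₀) * (L * (I₁ / √I₂)) * 1 := by gcongr
        _ = _ := mul_one _
    rw [hew]
    simp only [hX]
    rw [mul_sub, mul_sub]
    linarith
  refine tendsto_iInf_power hψ hK z₀ hα hM0 _ h X
    (eventually_nonempty_alternatives hβ hL hε hab) ?_ hXlim (eventually_log_sq_le hβ hb₀ hlow)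
  filter_upwards [eventually_mem_scaleSet hβ (K := K) hb₀ hlow hlim ha hb,
    hXlim.eventually_ge_atTop 0, eventually_ge_atTop 2] with n hmem hX0 hn2 σ hσ
  have hn : 0 < n := by omega
  have hn' : (0 : ℝ) < n := by positivity
  have hH := bandwidth_pos β hn2
  have hhn : 0 < h n := lt_of_lt_of_le (by positivity) (hlow' n)
  have hρ : 0 < rate β n := by
    rw [← bandwidth_rpow]
    positivity
  obtain ⟨hvol, hMσ, g, hg, hgσ, t, ht, hgt⟩ := hM a b _ ((1 + e n) * c * rate β n) hab
    (by
      simp only [he]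
      nlinarith [mul_pos (mul_pos (hε0 n) hc0) hρ]) ha hb σ hσ
  have hmem' := hmem t ht
  refine ⟨hvol, hMσ, t, hmem', hψ.mul_weightNorm_le hn hhn hmem'.2
    (by linarith [Real.sqrt_nonneg (2 * Real.log (1 / h n))])
    (le_trans (le_of_eq ?_) (le_abs_signal_recoveryKernel hβ hβ1 hL hg hgσ hn hhn hmem'.2
      (by rw [hhβ]; exact hgt.le)))⟩
  rw [← hI₁, ← hI₂]
  simp only [hX]
  rw [Real.sqrt_mul hn'.le, Real.sqrt_mul hhn.le]
  have e1 : I₂ = √I₂ * √I₂ := (Real.mul_self_sqrt hI2.le).symm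
  have e2 : √(h n) * √(h n) = h n := Real.mul_self_sqrt hhn.le
  have e3 : I₁ / √I₂ * √I₂ = I₁ := div_mul_cancel₀ _ (by positivity)
  calc _ = (√2)⁻¹ * (√n * ((√(h n) * √(h n)) * (L * h n ^ β * (√I₂ * √I₂)
        - L * (1 / (n : ℝ)) ^ β * (I₁ / √I₂ * √I₂)))) := by ring
    _ = _ := by rw [e2, e3, ← e1]

end ConstVol

end

theorem theorem3 (β L : ℝ) (hβ : 0 < β) (hL : 0 < L) :
    (∀ ψ : ℝ → ℝ, ConstVol.IsKernel ψ →
      (∃ K, ConstVol.IsCalibrationConstant ψ K) ∧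
      ∃ c : ℝ, 0 < c ∧ ConstVol.PowerTendsToOne ψ β L c) ∧
    (β ≤ 1 →
      (∀ φ : ℝ → ℝ, ConstVol.IsOptimalRecoveryKernel β φ ↔ φ = ConstVol.recoveryKernel β) ∧
      ConstVol.IsKernel (ConstVol.recoveryKernel β) ∧
      ConstVol.PowerTendsToOne (ConstVol.recoveryKernel β) β L (ConstVol.cStar β L)) :=
  ⟨fun _ hψ => ⟨hψ.exists_isCalibrationConstant, ConstVol.exists_powerTendsToOne hψ hβ hL⟩,
    fun hβ1 => ⟨ConstVol.isOptimalRecoveryKernel_iff hβ hβ1,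
      ConstVol.isKernel_recoveryKernel hβ hβ1,
      ConstVol.powerTendsToOne_recoveryKernel hβ hβ1 hL⟩⟩
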